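/- For a finite group $G$ and a prime $p$ dividing $|G|$, a quasi $p$-Steinberg character of $G$ is an irreducible complex character $\theta$ of $G$ with $\theta(g)\neq 0$ for every $g\in G$ whose order is not divisible by $p$. For a partition $\lambda$ of $n$, let $\chi_\lambda$ be the character of the Specht module of $S_n$ over $\mathbb{C}$ attached to $\lambda$, and let $\lambda'$ be the conjugate partition. If $\lambda\neq\lambda'$, let $\chi_\lambda^{\downarrow}=\chi_\lambda|_{A_n}$; if $\lambda=\lambda'$, let $\chi_\lambda^{+}\neq\chi_\lambda^{-}$ be the two irreducible characters of $A_n$ with $\chi_\lambda|_{A_n}=\chi_\lambda^{+}+\chi_\lambda^{-}$. Write $\chi_\lambda^{*}$ for any of these characters of $A_n$. **Theorem.** Let $n\geq 3$ and let $\lambda$ be a partition of $n$ with $\lambda\neq(n),(1^n)$. The irreducible characters $\chi_\lambda^{*}$ of $A_n$ exist: $\chi_\lambda|_{A_n}$ is irreducible if $\lambda\neq\lambda'$, and $\chi_\lambda|_{A_n}$ is the sum of two distinct irreducible characters if $\lambda=\lambda'$. For every prime $p$ and every such $\chi_\lambda^{*}$, the character $\chi_\lambda^{*}$ is a quasi $p$-Steinberg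 character of $A_n$ if and only if $(n,\lambda,p)$ or $(n,\lambda',p)$ is one of the following: - $n=3$: $(2,1)$ with $p=3$; - $n=4$: $(2,2)$ with $p=2$; $(3,1)$ and $(2,2)$ with $p=3$; - $n=5$: $(4,1)$ with $p=2$; $(3,1,1)$ with $p=3$; $(3,2)$ with $p=5$; - $n=6$: $(3,2,1)$ with $p=2$; $(4,2)$ with $p=3$; $(5,1)$ and $(3,3)$ with $p=5$; - $n=8$: $(5,2,1)$ with $p=2$; - $n=9$: $(7,2)$ with $p=3$. Moreover, for any $n\geq 0$ and any prime $p$, if $A_n$ has a quasi $p$-Steinberg character of degree different from $1$, then $n\leq 9$. -/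

import Mathlib

noncomputable section

namespace QuasiSteinberg

/-! ### Specht modules over the complex numbers -/

/-- A Young tableau of shape `lam` with entries `1, …, n`: a bijective numbering of the cells of
the Young diagram `lam` by `Fin n`. `T i` is the cell `(row, column)` carrying the label `i`.
Such a numbering exists exactly when `lam` is (the diagram of) a partition of `n`. -/
abbrev Tableau (n : ℕ) (lam : YoungDiagram) : Type := Fin n ≃ lam.cells

variable {n : ℕ} {lam : YoungDiagram}

open Classical in
/-- The sum, in the group algebra, of all permutations preserving every row of `T`. -/
def rowSymmetrizer (T : Tableau n lam) : MonoidAlgebra ℂ (Equiv.Perm (Fin n)) :=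
  ∑ σ : Equiv.Perm (Fin n) with ∀ i, (T (σ i)).1.1 = (T i).1.1, MonoidAlgebra.of ℂ _ σ

open Classical in
/-- The signed sum, in the group algebra, of all permutations preserving every column of `T`. -/
def columnAntisymmetrizer (T : Tableau n lam) : MonoidAlgebra ℂ (Equiv.Perm (Fin n)) :=
  ∑ σ : Equiv.Perm (Fin n) with ∀ i, (T (σ i)).1.2 = (T i).1.2,
    ((Equiv.Perm.sign σ : ℤ) : ℂ) • MonoidAlgebra.of ℂ _ σ

/-- The Specht module `V_lam`. The left ideal `A a_T` of `A = ℂ[S_n]`, with `a_T` the row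
symmetrizer, is the permutation module on row tabloids, and `b_T a_T`, with `b_T` the column
antisymmetrizer, is the polytabloid of `T`; the Specht module is the left ideal `A b_T a_T`
that it generates. Up to isomorphism it depends only on the shape `lam`. -/
def spechtModule (T : Tableau n lam) : Submodule ℂ (MonoidAlgebra ℂ (Equiv.Perm (Fin n))) :=
  (Submodule.span (MonoidAlgebra ℂ (Equiv.Perm (Fin n)))
    {columnAntisymmetrizer T * rowSymmetrizer T}).restrictScalars ℂ

theorem of_mul_mem_spechtModule (T : Tableau n lam) (σ : Equiv.Perm (Fin n))
    (x : MonoidAlgebra ℂ (Equiv.Perm (Fin n))) (hx : x ∈ spechtModule T) :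
    LinearMap.mulLeft ℂ (MonoidAlgebra.of ℂ _ σ) x ∈ spechtModule T :=
  Submodule.smul_mem (Submodule.span (MonoidAlgebra ℂ (Equiv.Perm (Fin n)))
    {columnAntisymmetrizer T * rowSymmetrizer T}) (MonoidAlgebra.of ℂ _ σ) hx

/-- The representation of `S_n` on the Specht module by left multiplication. -/
def spechtRep (T : Tableau n lam) : Representation ℂ (Equiv.Perm (Fin n)) (spechtModule T) where
  toFun σ := (LinearMap.mulLeft ℂ (MonoidAlgebra.of ℂ _ σ)).restrict (of_mul_mem_spechtModule T σ)
  map_one' := by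
    ext x
    simp [LinearMap.restrict_apply]
  map_mul' σ τ := by
    apply LinearMap.ext
    intro x
    apply Subtype.ext
    simp only [map_mul, LinearMap.restrict_apply, LinearMap.mulLeft_apply, Module.End.mul_apply,
      mul_assoc]

/-- The character `χ_lam` of `S_n` afforded by the Specht module. -/
def spechtCharacter (T : Tableau n lam) : Equiv.Perm (Fin n) → ℂ := (spechtRep T).character

/-- The restriction of `χ_lam` to the alternating group `A_n`. -/
def spechtCharacterAlt (T : Tableau n lam) : alternatingGroup (Fin n) → ℂ :=
  fun g => spechtCharacter T (g : Equiv.Perm (Fin n))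

/-! ### Irreducible characters and quasi Steinberg characters -/

/-- `θ` is the character of an irreducible finite-dimensional complex representation of `G`. -/
def IsIrreducibleCharacter {G : Type*} [Group G] (θ : G → ℂ) : Prop :=
  ∃ (d : ℕ) (ρ : Representation ℂ G (Fin d → ℂ)), ρ.IsIrreducible ∧ ρ.character = θ

/-- For a finite group `G` and a prime `p`: `p` divides the order of `G`, and `θ` is an
irreducible character of `G` with a nonzero value at every element of order prime to `p`. -/
def IsQuasiSteinberg {G : Type*} [Group G] (p : ℕ) (θ : G → ℂ) : Prop :=
  p ∣ Nat.card G ∧ IsIrreducibleCharacter θ ∧ ∀ g : G, ¬ p ∣ orderOf g → θ g ≠ 0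

/-- `θ` is one of the irreducible characters `χ_lam^*` of `A_n`: the restriction `χ_lam^↓` of
`χ_lam` if `lam` is not self-conjugate, and one of the two distinct irreducible characters
`χ_lam^+`, `χ_lam^-` of sum `χ_lam|_{A_n}` if `lam` is self-conjugate. -/
def IsAltSpechtCharacter (T : Tableau n lam) (θ : alternatingGroup (Fin n) → ℂ) : Prop :=
  IsIrreducibleCharacter θ ∧
    ((lam.transpose ≠ lam ∧ θ = spechtCharacterAlt T) ∨
      (lam.transpose = lam ∧ ∃ θ' : alternatingGroup (Fin n) → ℂ,
        IsIrreducibleCharacter θ' ∧ θ' ≠ θ ∧ spechtCharacterAlt T = θ + θ'))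

/-! ### The table -/

/-- The triples `(n, lam, p)` of the table, a partition being written as the list of its parts in
decreasing order. One partition of each conjugate pair is listed. -/
def altTable : Set (ℕ × List ℕ × ℕ) :=
  {(3, [2, 1], 3),
   (4, [2, 2], 2), (4, [3, 1], 3), (4, [2, 2], 3),
   (5, [4, 1], 2), (5, [3, 1, 1], 3), (5, [3, 2], 5),
   (6, [3, 2, 1], 2), (6, [4, 2], 3), (6, [5, 1], 5), (6, [3, 3], 5),
   (8, [5, 2, 1], 2),
   (9, [7, 2], 3)}

end QuasiSteinberg

end

/-! The proof makes the values of χ_λ computable, finds regular classes on which they vanish, and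
settles the remaining cases one by one.

The Specht module is the left ideal generated by the Young symmetrizer c = b a, and c² = κ c with κ
≠ 0. Hence χ_λ(g) is κ⁻¹ times the trace of x ↦ g x c on the whole group algebra
(`spechtCharacter_eq_algChar`), and inner products of such functions are traces of maps x ↦ e x f.
The products b k a decide these traces: they vanish, or are multiples of c, according to a
comparison of the integers Σ i λ_i (`rowStat`), which serve in place of the dominance order. So the
χ_λ are orthonormal, and there are as many of them as conjugacy classes. A triangularity argument in
the same statistic identifies χ_λ(g) with the coefficient of x^(λ+δ) in the Vandermonde alternant
times the power sums of the cycle lengths of g (`spechtCharacter_eq_frobeniusClass`). Splitting off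
one power sum at a time gives the recursion `mnVal`.

On A_n the restriction of χ_λ has norm 1 or 2, according to whether λ ≠ λ' or λ = λ'. In the second
case odd permutations exchange the two halves, so both equal χ_λ/2 at every element commuting with
an odd permutation. A p-regular even class with χ_λ = 0 therefore rules out p, as long as λ ≠ λ' or
the class is centralized by an odd permutation.

For n ≤ 14 such a class is found by evaluation in every case outside the table, except for (3,3,2)
with p = 3, which is settled by restriction to A_7. The table entries with λ ≠ λ' are verified by
evaluation. For those with λ = λ', every p-regular element has order a power of some prime q not
dividing the degree of the half, and a sum of d roots of unity of q-power order is nonzero when q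
does not divide d.

For n ≥ 15, nonvanishing at classes with a cycle of length n - a, a ≤ 5, forces hooks of two
different lengths close to n. They cannot both be the corner hook, so the first row or column has
length at least n - 8 (`long_of_two_hooks`). Then λ or λ' is (n - |ν|, ν) with |ν| ≤ 8. Its value at
cycle lengths (n - |σ|, σ) does not depend on n (`mnVal_eq_tailVal`), so a finite list of zeros
excludes every prime. Finally, every irreducible character of A_n is a constituent of some
restricted χ_λ, which gives the bound n ≤ 9. -/

noncomputable section

namespace QuasiSteinberg

/-! ### Characters of finite groups -/

section FiniteGroup

variable {G : Type*} [Group G]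

/-- The standard bilinear form on complex functions on a finite group. -/
def charInner [Fintype G] (φ ψ : G → ℂ) : ℂ :=
  (Nat.card G : ℂ)⁻¹ * ∑ g, φ g * ψ g⁻¹

theorem charInner_comm [Fintype G] (φ ψ : G → ℂ) : charInner φ ψ = charInner ψ φ := by
  unfold charInner
  congr 1
  refine Fintype.sum_equiv (Equiv.inv G) _ _ fun g => ?_
  simp [mul_comm]

theorem charInner_add_left [Fintype G] (φ φ' ψ : G → ℂ) :
    charInner (φ + φ') ψ = charInner φ ψ + charInner φ' ψ := by
  simp [charInner, add_mul, Finset.sum_add_distrib, mul_add]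

theorem charInner_add_right [Fintype G] (φ ψ ψ' : G → ℂ) :
    charInner φ (ψ + ψ') = charInner φ ψ + charInner φ ψ' := by
  rw [charInner_comm, charInner_add_left, charInner_comm ψ, charInner_comm ψ']

theorem charInner_smul_left [Fintype G] (c : ℂ) (φ ψ : G → ℂ) :
    charInner (c • φ) ψ = c * charInner φ ψ := by
  simp only [charInner, Pi.smul_apply, smul_eq_mul, Finset.mul_sum]
  exact Finset.sum_congr rfl fun _ _ => by ring

theorem charInner_zero_left [Fintype G] (ψ : G → ℂ) : charInner 0 ψ = 0 := by
  simp [charInner]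

/-- A basis moves the representation to coordinates, as `IsIrreducibleCharacter` demands;
irreducibility is carried over as simplicity of the module over the group algebra. -/
theorem isIrreducibleCharacter_of_isIrreducible {V : Type*} [AddCommGroup V] [Module ℂ V]
    [FiniteDimensional ℂ V] (ρ : Representation ℂ G V) (hρ : ρ.IsIrreducible) :
    IsIrreducibleCharacter ρ.character := by
  let e : V ≃ₗ[ℂ] (Fin (Module.finrank ℂ V) → ℂ) := (Module.finBasis ℂ V).equivFun
  let σ : Representation ℂ G (Fin (Module.finrank ℂ V) → ℂ) :=
    { toFun := fun g => e.conj (ρ g)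
      map_one' := by ext; simp
      map_mul' := fun g h => by simp [Module.End.mul_eq_comp, LinearEquiv.conj_comp] }
  have φ : ρ.Equiv σ := Representation.Equiv.mk e fun g => by
    ext x; simp [σ, LinearEquiv.conj_apply]
  refine ⟨_, σ, ?_, (Representation.char_iso φ).symm⟩
  have h1 : IsSimpleModule (MonoidAlgebra ℂ G) ρ.asModule :=
    (Representation.irreducible_iff_isSimpleModule_asModule ρ).1 hρ
  rw [Representation.irreducible_iff_isSimpleModule_asModule]
  let f := Representation.IntertwiningMap.equivLinearMapAsModule ρ σ φ.toIntertwiningMap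
  have hf : Function.Bijective f := φ.toLinearEquiv.bijective
  exact IsSimpleModule.congr (LinearEquiv.ofBijective f hf).symm

theorem charInner_irreducible [Fintype G] {θ θ' : G → ℂ} (h : IsIrreducibleCharacter θ)
    (h' : IsIrreducibleCharacter θ') [Decidable (θ = θ')] :
    charInner θ θ' = if θ = θ' then 1 else 0 := by
  obtain ⟨d, ρ, hρ, rfl⟩ := h
  obtain ⟨d', ρ', hρ', rfl⟩ := h'
  have : Invertible (Nat.card G : ℂ) := invertibleOfNonzero (by simp)
  have key := Representation.char_orthonormal ρ ρ'
  split_ifs with h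
  · rw [charInner, ← h, Representation.char_orthonormal ρ ρ, if_pos ⟨Representation.Equiv.refl ρ⟩]
  · rw [charInner, key, if_neg]
    rintro ⟨φ⟩
    exact h (Representation.char_iso φ).symm

theorem character_eq_add_of_isCompl {V : Type*} [AddCommGroup V] [Module ℂ V]
    [FiniteDimensional ℂ V] {ρ : Representation ℂ G V} {W W' : Subrepresentation ρ}
    (h : IsCompl W.toSubmodule W'.toSubmodule) :
    ρ.character = W.toRepresentation.character + W'.toRepresentation.character := by
  ext g
  let e := Submodule.prodEquivOfIsCompl _ _ h
  have : ρ g = e.conj (LinearMap.prodMap (W.toRepresentation g) (W'.toRepresentation g)) := by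
    ext x
    obtain ⟨y, rfl⟩ := e.surjective x
    simp only [LinearEquiv.conj_apply_apply, LinearEquiv.symm_apply_apply]
    rw [Submodule.coe_prodEquivOfIsCompl', Submodule.coe_prodEquivOfIsCompl']
    simp [Subrepresentation.toRepresentation]
  simp only [Representation.character, Pi.add_apply]
  rw [this, LinearMap.trace_conj', LinearMap.trace_prodMap']

/-- Maschke's theorem by induction on the dimension. The zero space is not irreducible and
contributes the empty multiset. -/
theorem exists_multiset_sum_eq_character [Finite G] {V : Type*} [AddCommGroup V] [Module ℂ V]
    [FiniteDimensional ℂ V] (ρ : Representation ℂ G V) :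
    ∃ L : Multiset (G → ℂ), (∀ θ ∈ L, IsIrreducibleCharacter θ) ∧ ρ.character = L.sum := by
  induction hd : Module.finrank ℂ V using Nat.strong_induction_on generalizing V with
  | _ d ih =>
    by_cases hρ : ρ.IsIrreducible
    · exact ⟨{ρ.character}, by simpa using isIrreducibleCharacter_of_isIrreducible ρ hρ, by simp⟩
    · rcases subsingleton_or_nontrivial V with hV | hV
      · refine ⟨0, by simp, ?_⟩
        ext g
        have : ρ g = 0 := LinearMap.ext fun x => Subsingleton.elim _ _
        simp [Representation.character, this]
      · have hnt : Nontrivial (Subrepresentation ρ) := by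
          refine ⟨⊥, ⊤, fun h => ?_⟩
          have : (⊥ : Submodule ℂ V) = ⊤ := congrArg Subrepresentation.toSubmodule h
          exact bot_ne_top this
        obtain ⟨W, hW0, hW1⟩ : ∃ W : Subrepresentation ρ, W ≠ ⊥ ∧ W ≠ ⊤ := by
          by_contra! hcon
          exact hρ ⟨fun W => or_iff_not_imp_left.2 (hcon W)⟩
        have : NeZero (Nat.card G : ℂ) := ⟨Nat.cast_ne_zero.2 Nat.card_pos.ne'⟩
        obtain ⟨W', hW'⟩ := exists_isCompl W
        have hc : IsCompl W.toSubmodule W'.toSubmodule := by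
          refine ⟨disjoint_iff.2 ?_, codisjoint_iff.2 ?_⟩
          · exact congrArg Subrepresentation.toSubmodule hW'.inf_eq_bot
          · exact congrArg Subrepresentation.toSubmodule hW'.sup_eq_top
        have hsum := Submodule.finrank_add_eq_of_isCompl hc
        have hpos : ∀ U : Subrepresentation ρ, U ≠ ⊥ → 0 < Module.finrank ℂ U.toSubmodule := by
          intro U hU
          rw [Module.finrank_pos_iff, Submodule.nontrivial_iff_ne_bot]
          exact fun h => hU (Subrepresentation.toSubmodule_injective h)
        have hW'0 : W' ≠ ⊥ := fun h => hW1 (by simpa [h] using hW'.sup_eq_top)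
        have h1 := hpos W hW0
        have h2 := hpos W' hW'0
        obtain ⟨L, hL, hLs⟩ := ih _ (by omega) W.toRepresentation rfl
        obtain ⟨L', hL', hLs'⟩ := ih _ (by omega) W'.toRepresentation rfl
        refine ⟨L + L', ?_, ?_⟩
        · intro θ hθ
          rcases Multiset.mem_add.1 hθ with h | h
          exacts [hL θ h, hL' θ h]
        · rw [character_eq_add_of_isCompl hc, hLs, hLs', Multiset.sum_add]

open Classical in
theorem charInner_multiset_sum_irreducible [Fintype G] {L : Multiset (G → ℂ)}
    (hL : ∀ θ ∈ L, IsIrreducibleCharacter θ) {ψ : G → ℂ} (hψ : IsIrreducibleCharacter ψ) :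
    charInner L.sum ψ = L.count ψ := by
  induction L using Multiset.induction_on with
  | empty => simp [charInner_zero_left]
  | cons a s ih =>
    rw [Multiset.sum_cons, charInner_add_left, ih fun θ h => hL θ (Multiset.mem_cons_of_mem h),
      charInner_irreducible (hL a (Multiset.mem_cons_self a s)) hψ, Multiset.count_cons]
    by_cases h : a = ψ
    · subst h; simp [add_comm]
    · simp [h, Ne.symm h]

/-- The norm of a sum of irreducible characters is at least the number of summands. -/
theorem exists_nat_charInner_multiset_sum_self [Fintype G] {L : Multiset (G → ℂ)}
    (hL : ∀ θ ∈ L, IsIrreducibleCharacter θ) :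
    ∃ k : ℕ, charInner L.sum L.sum = k ∧ L.card ≤ k ∧ (¬ L.Nodup → L.card < k) := by
  classical
  induction L using Multiset.induction_on with
  | empty => exact ⟨0, by simp [charInner_zero_left]⟩
  | cons a s ih =>
    have hs : ∀ θ ∈ s, IsIrreducibleCharacter θ := fun θ h => hL θ (Multiset.mem_cons_of_mem h)
    have ha := hL a (Multiset.mem_cons_self a s)
    obtain ⟨k, hk, hk', hk''⟩ := ih hs
    refine ⟨1 + 2 * s.count a + k, ?_, ?_, ?_⟩
    · rw [Multiset.sum_cons, charInner_add_left, charInner_add_right, charInner_add_right, hk,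
        charInner_comm a s.sum, charInner_multiset_sum_irreducible hs ha,
        charInner_irreducible ha ha, if_pos rfl]
      push_cast
      ring
    · simp; omega
    · intro hnd
      simp only [Multiset.nodup_cons, not_and_or, not_not] at hnd
      simp only [Multiset.card_cons]
      rcases hnd with h | h
      · have := Multiset.count_pos.2 h; omega
      · have := hk'' h; omega

theorem IsIrreducibleCharacter.one_ne_zero {θ : G → ℂ} (h : IsIrreducibleCharacter θ) :
    θ 1 ≠ 0 := by
  obtain ⟨d, ρ, hρ, rfl⟩ := h
  rw [Representation.char_one]
  have : Nontrivial (Fin d → ℂ) := by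
    by_contra hV
    rw [not_nontrivial_iff_subsingleton] at hV
    obtain ⟨U, U', hU⟩ := hρ.exists_pair_ne
    refine hU (Subrepresentation.toSubmodule_injective ?_)
    ext x
    simp [Subsingleton.elim x 0]
  exact_mod_cast (Module.finrank_pos (R := ℂ) (M := Fin d → ℂ)).ne'

theorem IsIrreducibleCharacter.conj_apply {θ : G → ℂ} (h : IsIrreducibleCharacter θ) (g x : G) :
    θ (x * g * x⁻¹) = θ g := by
  obtain ⟨d, ρ, hρ, rfl⟩ := h
  exact Representation.char_conj ρ g x

/-! ### Sums of roots of unity of prime power order -/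

theorem exists_multiset_sum_pow_prime_pow {R : Type*} [CommRing R] {q : ℕ} (hq : q.Prime) (k : ℕ)
    (S : Multiset R) : ∃ r, S.sum ^ q ^ k = (S.map (· ^ q ^ k)).sum + q * r := by
  induction S using Multiset.induction_on with
  | empty => exact ⟨0, by simp [hq.ne_zero]⟩
  | cons a S ih =>
    obtain ⟨r, hr⟩ := ih
    obtain ⟨r', hr'⟩ := exists_add_pow_prime_pow_eq hq a S.sum k
    refine ⟨r + a * S.sum * r', ?_⟩
    rw [Multiset.sum_cons, hr', hr, Multiset.map_cons, Multiset.sum_cons]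
    ring

/-- Raising to the power q^k is additive modulo q. In the ring of algebraic integers this turns a
vanishing sum into 0 = |S| + q r, so |S|/q is a rational algebraic integer, hence an integer. -/
theorem dvd_card_of_sum_eq_zero_of_pow_eq_one {q k : ℕ} (hq : q.Prime) (S : Multiset ℂ)
    (hS : ∀ r ∈ S, r ^ q ^ k = 1) (h0 : S.sum = 0) : q ∣ S.card := by
  have hpos : 0 < q ^ k := pow_pos hq.pos k
  have hint : ∀ r ∈ S, r ∈ integralClosure ℤ ℂ := fun r hr => by
    refine ⟨Polynomial.X ^ q ^ k - 1, Polynomial.monic_X_pow_sub_C 1 hpos.ne', ?_⟩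
    simp [hS r hr]
  lift S to Multiset (integralClosure ℤ ℂ) using hint
  obtain ⟨r, hr⟩ := exists_multiset_sum_pow_prime_pow hq k S
  have h1 : S.sum = 0 := by
    apply Subtype.ext
    exact (map_multiset_sum (integralClosure ℤ ℂ).subtype S).trans h0
  have h2 : (S.map (· ^ q ^ k)).sum = S.card := by
    rw [Multiset.map_congr rfl (g := fun _ => 1), Multiset.map_const', Multiset.sum_replicate]
    · simp
    · intro x hx
      apply Subtype.ext
      simpa using hS x (Multiset.mem_map_of_mem _ hx)
  rw [h1, h2, zero_pow hpos.ne'] at hr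
  have hr' : (r : ℂ) = algebraMap ℚ ℂ (-(S.card : ℚ) / q) := by
    have hq0 : (q : ℂ) ≠ 0 := by exact_mod_cast hq.ne_zero
    have := congrArg (Subtype.val) hr
    push_cast at this
    simp only [eq_ratCast]
    push_cast
    field_simp
    linear_combination -this
  have hi : IsIntegral ℤ (-(S.card : ℚ) / q) := by
    have := r.2
    rw [hr'] at this
    exact (isIntegral_algebraMap_iff (algebraMap ℚ ℂ).injective).1 this
  obtain ⟨z, hz⟩ := IsIntegrallyClosed.isIntegral_iff.1 hi
  rw [Multiset.card_map]
  have hq0 : (q : ℚ) ≠ 0 := by exact_mod_cast hq.ne_zero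
  have h3 : (S.card : ℚ) = q * (-z : ℤ) := by
    simp only [eq_intCast] at hz
    push_cast
    rw [hz]
    field_simp
  have h4 : (S.card : ℤ) = q * (-z) := by exact_mod_cast h3
  exact Int.natCast_dvd_natCast.1 ⟨-z, h4⟩

/-- A sum of `d` roots of unity of order a power of a prime `q` not dividing `d` is nonzero. -/
theorem IsIrreducibleCharacter.ne_zero_of_pow_eq_one {θ : G → ℂ} (h : IsIrreducibleCharacter θ)
    {q k d : ℕ} (hq : q.Prime) {g : G} (hg : g ^ q ^ k = 1) (hd : θ 1 = d) (hqd : ¬ q ∣ d) :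
    θ g ≠ 0 := by
  obtain ⟨d', ρ, hρ, rfl⟩ := h
  rw [Representation.char_one] at hd
  have hd' : d = d' := by
    have : Module.finrank ℂ (Fin d' → ℂ) = d := by exact_mod_cast hd
    simpa using this.symm
  subst hd'
  intro h0
  -- The character value is the sum of the d eigenvalues with multiplicity, each of them a q^k-th
  -- root of unity.
  have hsp := IsAlgClosed.splits (ρ g).charpoly
  refine hqd ?_
  have hcard : (ρ g).charpoly.roots.card = d := by
    rw [← hsp.natDegree_eq_card_roots, LinearMap.charpoly_natDegree]
    simp
  rw [← hcard]
  refine dvd_card_of_sum_eq_zero_of_pow_eq_one (k := k) hq _ (fun r hr => ?_) ?_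
  · have hr' := (Polynomial.mem_roots'.1 hr).2
    rw [← Module.End.hasEigenvalue_iff_isRoot_charpoly] at hr'
    obtain ⟨v, hv⟩ := hr'.exists_hasEigenvector
    have h1 := hv.pow_apply (q ^ k)
    rw [← map_pow, hg, map_one, Module.End.one_apply] at h1
    have h2 : (r ^ q ^ k - 1) • v = 0 := by rw [sub_smul, one_smul, ← h1, sub_self]
    exact sub_eq_zero.1 ((smul_eq_zero.1 h2).resolve_right hv.2)
  · rw [← Module.End.trace_eq_sum_roots_charpoly_of_splits hsp]
    exact h0

end FiniteGroup

/-! ### Class functions from the group algebra -/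

section GroupAlgebra

variable {G : Type*} [Group G]

open MonoidAlgebra

/-- The trace of `x ↦ g * x * f` on the group algebra, as a function of `g`. -/
def algChar (f : MonoidAlgebra ℂ G) (g : G) : ℂ :=
  LinearMap.trace ℂ _ (LinearMap.mulLeft ℂ (of ℂ G g) ∘ₗ LinearMap.mulRight ℂ f)

theorem algChar_apply [Fintype G] (f : MonoidAlgebra ℂ G) (g : G) :
    algChar f g = ∑ k, f.coeff (k⁻¹ * g⁻¹ * k) := by
  classical
  let b : Module.Basis G ℂ (MonoidAlgebra ℂ G) := .ofRepr (coeffLinearEquiv ℂ)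
  rw [algChar, LinearMap.trace_eq_matrix_trace ℂ b, Matrix.trace]
  refine Finset.sum_congr rfl fun k _ => ?_
  have hb : b k = single k 1 := by
    rw [Module.Basis.apply_eq_iff]
    rfl
  rw [Matrix.diag_apply, LinearMap.toMatrix_apply, hb]
  change (of ℂ G g * (single k 1 * f)).coeff k = _
  rw [of_apply, ← mul_assoc, single_mul_single, coeff_single_mul_apply]
  simp

theorem algChar_conj [Fintype G] (f : MonoidAlgebra ℂ G) (g h : G) :
    algChar f (h * g * h⁻¹) = algChar f g := by
  rw [algChar_apply, algChar_apply]
  refine Fintype.sum_equiv (Equiv.mulLeft h⁻¹) _ _ fun k => ?_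
  simp [mul_assoc]

theorem trace_mulLeft_mulRight [Fintype G] (e f : MonoidAlgebra ℂ G) :
    LinearMap.trace ℂ _ (LinearMap.mulLeft ℂ e ∘ₗ LinearMap.mulRight ℂ f) =
      ∑ x, e.coeff x * algChar f x := by
  have he : e = ∑ x, e.coeff x • of ℂ G x := by
    ext y
    simp
  have : LinearMap.mulLeft ℂ e ∘ₗ LinearMap.mulRight ℂ f =
      ∑ x, e.coeff x • (LinearMap.mulLeft ℂ (of ℂ G x) ∘ₗ LinearMap.mulRight ℂ f) := by
    refine LinearMap.ext fun y => ?_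
    conv_lhs => rw [he]
    simp only [LinearMap.comp_apply, LinearMap.mulLeft_apply, LinearMap.mulRight_apply,
      LinearMap.sum_apply, LinearMap.smul_apply, Finset.sum_mul, smul_mul_assoc]
  rw [this]
  simp [algChar]

/-- By `algChar_apply`, `algChar e` sums the coefficients of e over conjugates of the inverse. A
class function cannot distinguish these conjugates, so the average collapses to the evaluation of φ
on e. -/
theorem charInner_algChar [Fintype G] {φ : G → ℂ} (hφ : ∀ g h, φ (h * g * h⁻¹) = φ g)
    (e : MonoidAlgebra ℂ G) : charInner φ (algChar e) = ∑ x, e.coeff x * φ x := by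
  have h1 : ∀ k : G, ∑ g, φ g * e.coeff (k⁻¹ * g * k) = ∑ x, e.coeff x * φ x := by
    intro k
    refine Fintype.sum_equiv (MulAut.conj k⁻¹).toEquiv _ _ fun g => ?_
    have := hφ (k⁻¹ * g * k) k
    simp only [mul_assoc, mul_inv_cancel_left, mul_inv_cancel, mul_one] at this
    simp [mul_assoc, mul_comm, this]
  have h2 : ∑ g, φ g * algChar e g⁻¹ = ∑ k : G, ∑ x, e.coeff x * φ x := by
    simp only [algChar_apply, inv_inv, Finset.mul_sum]
    rw [Finset.sum_comm]
    exact Finset.sum_congr rfl fun k _ => h1 k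
  rw [charInner, h2]
  have : (Nat.card G : ℂ) ≠ 0 := Nat.cast_ne_zero.2 Nat.card_pos.ne'
  rw [Finset.sum_const, Finset.card_univ, nsmul_eq_mul, ← Nat.card_eq_fintype_card,
    inv_mul_cancel_left₀ this]

/-- This turns inner products into traces of x ↦ e x f, so that orthogonality becomes a question
about the products e g f. -/
theorem charInner_algChar_algChar [Fintype G] (e f : MonoidAlgebra ℂ G) :
    charInner (algChar f) (algChar e) =
      LinearMap.trace ℂ _ (LinearMap.mulLeft ℂ e ∘ₗ LinearMap.mulRight ℂ f) := by
  rw [charInner_algChar (algChar_conj f), trace_mulLeft_mulRight]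

/-- A linear map of the form `x ↦ e * x * f` vanishing identically has trace zero. -/
theorem charInner_algChar_eq_zero [Fintype G] {e f : MonoidAlgebra ℂ G}
    (h : ∀ g : G, e * of ℂ G g * f = 0) : charInner (algChar f) (algChar e) = 0 := by
  have : LinearMap.mulLeft ℂ e ∘ₗ LinearMap.mulRight ℂ f = 0 := by
    refine LinearMap.ext fun x => ?_
    induction x using MonoidAlgebra.induction_on with
    | of g => simpa [mul_assoc] using h g
    | add x y hx hy => simp only [map_add, hx, hy]
    | smul r x hx => simp only [map_smul, hx]
  rw [charInner_algChar_algChar, this, map_zero]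

/-- If `x ↦ e * x * f` has image in the line spanned by `v`, its trace is its eigenvalue at `v`. -/
theorem charInner_algChar_eq_of_line [Fintype G] {e f v : MonoidAlgebra ℂ G} {c : ℂ} (hv : v ≠ 0)
    (h : ∀ g : G, ∃ r : ℂ, e * of ℂ G g * f = r • v) (hc : e * v * f = c • v) :
    charInner (algChar f) (algChar e) = c := by
  rw [charInner_algChar_algChar]
  set F := LinearMap.mulLeft ℂ e ∘ₗ LinearMap.mulRight ℂ f
  have hF : ∀ x, F x ∈ Submodule.span ℂ {v} := by
    intro x
    induction x using MonoidAlgebra.induction_on with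
    | of g =>
      obtain ⟨r, hr⟩ := h g
      rw [Submodule.mem_span_singleton]
      exact ⟨r, by simp [F, ← hr, mul_assoc]⟩
    | add x y hx hy => rw [map_add]; exact Submodule.add_mem _ hx hy
    | smul r x hx => rw [map_smul]; exact Submodule.smul_mem _ _ hx
  rw [← LinearMap.trace_restrict_eq_of_forall_mem _ F hF]
  have : F.restrict (fun x _ => hF x : ∀ x ∈ Submodule.span ℂ {v}, F x ∈ Submodule.span ℂ {v}) =
      c • LinearMap.id := by
    ext ⟨x, hx⟩
    obtain ⟨r, rfl⟩ := Submodule.mem_span_singleton.1 hx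
    have hFv : F v = c • v := by simp [F, ← hc, mul_assoc]
    have : F (r • v) = c • r • v := by rw [map_smul, hFv, smul_comm]
    simp [LinearMap.restrict_apply, this]
  rw [this, map_smul, LinearMap.trace_id, finrank_span_singleton hv]
  simp

end GroupAlgebra

/-! ### Young symmetrizers -/

section YoungSymmetrizer

open MonoidAlgebra

variable {n : ℕ} {lam mu : YoungDiagram}

open Classical in
/-- The sum in the group algebra of the permutations preserving a colouring. -/
def colorSymmetrizer {n : ℕ} (f : Fin n → ℕ) : MonoidAlgebra ℂ (Equiv.Perm (Fin n)) :=
  ∑ σ : Equiv.Perm (Fin n) with ∀ i, f (σ i) = f i, of ℂ _ σ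

/-- The sum of the row indices of the cells of a Young diagram. -/
def rowStat (lam : YoungDiagram) : ℕ := ∑ c ∈ lam.cells, c.1

theorem sum_row_eq_rowStat (T : Tableau n lam) : ∑ i, (T i).1.1 = rowStat lam := by
  rw [rowStat, ← Finset.sum_coe_sort lam.cells fun c => c.1]
  exact Fintype.sum_equiv T _ _ fun _ => rfl

theorem rowSymmetrizer_eq (T : Tableau n lam) :
    rowSymmetrizer T = colorSymmetrizer fun i => (T i).1.1 := rfl

theorem of_mul_colorSymmetrizer (f : Fin n → ℕ) (σ : Equiv.Perm (Fin n))
    (hσ : ∀ i, f (σ i) = f i) : of ℂ _ σ * colorSymmetrizer f = colorSymmetrizer f := by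
  classical
  simp only [colorSymmetrizer, Finset.mul_sum, ← map_mul]
  refine Finset.sum_equiv (Equiv.mulLeft σ) (fun τ => ?_) fun τ _ => rfl
  simp [hσ]

theorem columnAntisymmetrizer_mul_of (T : Tableau n lam) (σ : Equiv.Perm (Fin n))
    (hσ : ∀ i, (T (σ i)).1.2 = (T i).1.2) :
    columnAntisymmetrizer T * of ℂ _ σ =
      ((Equiv.Perm.sign σ : ℤ) : ℂ) • columnAntisymmetrizer T := by
  classical
  simp only [columnAntisymmetrizer, Finset.sum_mul, Finset.smul_sum, smul_mul_assoc, ← map_mul]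
  refine Finset.sum_equiv (Equiv.mulRight σ) (fun τ => ?_) fun τ _ => ?_
  · simp only [Finset.mem_filter, Finset.mem_univ, true_and, Equiv.coe_mulRight,
      Equiv.Perm.mul_apply]
    constructor
    · intro h i
      rw [h, hσ]
    · intro h i
      have h1 := h (σ⁻¹ i)
      have h2 := hσ (σ⁻¹ i)
      rw [show σ (σ⁻¹ i) = i by simp] at h1 h2
      rw [h1, h2]
  · simp only [Equiv.coe_mulRight, smul_smul, Equiv.Perm.sign_mul, Units.val_mul]
    rcases Int.units_eq_one_or (Equiv.Perm.sign σ) with h | h <;> simp [h]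

theorem colorSymmetrizer_mul_self (f : Fin n → ℕ) :
    colorSymmetrizer f * colorSymmetrizer f =
      ((Finset.univ.filter fun σ : Equiv.Perm (Fin n) => ∀ i, f (σ i) = f i).card : ℂ) •
        colorSymmetrizer f := by
  classical
  conv_lhs => enter [1]; rw [colorSymmetrizer]
  rw [Finset.sum_mul, Nat.cast_smul_eq_nsmul, ← Finset.sum_const]
  exact Finset.sum_congr (by ext; simp) fun σ hσ =>
    of_mul_colorSymmetrizer f σ (Finset.mem_filter.1 hσ).2

/-- The transposition (i j) is absorbed on the left with sign -1. Moved past k it becomes a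
transposition preserving f, absorbed on the right with sign +1. The product is thus its own
negative. -/
theorem columnAntisymmetrizer_mul_of_mul_colorSymmetrizer_eq_zero (T : Tableau n lam)
    (f : Fin n → ℕ) (k : Equiv.Perm (Fin n)) {i j : Fin n} (hij : i ≠ j)
    (hc : (T i).1.2 = (T j).1.2) (hf : f (k⁻¹ i) = f (k⁻¹ j)) :
    columnAntisymmetrizer T * of ℂ _ k * colorSymmetrizer f = 0 := by
  have h1 : columnAntisymmetrizer T * of ℂ _ (Equiv.swap i j) = -columnAntisymmetrizer T := by
    rw [columnAntisymmetrizer_mul_of, Equiv.Perm.sign_swap hij]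
    · simp
    · intro x
      rcases eq_or_ne x i with rfl | hxi
      · simp [hc]
      rcases eq_or_ne x j with rfl | hxj
      · simp [hc]
      rw [Equiv.swap_apply_of_ne_of_ne hxi hxj]
  have h2 : of ℂ _ (Equiv.swap (k⁻¹ i) (k⁻¹ j)) * colorSymmetrizer f = colorSymmetrizer f := by
    apply of_mul_colorSymmetrizer
    intro x
    rcases eq_or_ne x (k⁻¹ i) with rfl | hxi
    · rw [Equiv.swap_apply_left, hf]
    rcases eq_or_ne x (k⁻¹ j) with rfl | hxj
    · rw [Equiv.swap_apply_right, hf]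
    rw [Equiv.swap_apply_of_ne_of_ne hxi hxj]
  have h3 : Equiv.swap i j * k = k * Equiv.swap (k⁻¹ i) (k⁻¹ j) := by
    rw [Equiv.mul_swap_eq_swap_mul]
    simp
  have h4 : columnAntisymmetrizer T * of ℂ _ k * colorSymmetrizer f =
      -(columnAntisymmetrizer T * of ℂ _ k * colorSymmetrizer f) := by
    conv_lhs => rw [← h2]
    rw [← mul_assoc, mul_assoc _ (of ℂ _ k), ← map_mul, ← h3, map_mul, ← mul_assoc, h1]
    simp [mul_assoc]
  have h5 : (2 : ℂ) • (columnAntisymmetrizer T * of ℂ _ k * colorSymmetrizer f) = 0 := by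
    rw [two_smul]
    exact add_eq_zero_iff_eq_neg.2 h4
  exact (smul_eq_zero.1 h5).resolve_left two_ne_zero

theorem sum_range_card_le_sum (s : Finset ℕ) :
    ∑ i ∈ Finset.range s.card, i ≤ ∑ i ∈ s, i ∧
      (∑ i ∈ Finset.range s.card, i = ∑ i ∈ s, i → s = Finset.range s.card) := by
  induction hm : s.card generalizing s with
  | zero => simp [Finset.card_eq_zero.1 hm]
  | succ m ih =>
    have hne : s.Nonempty := Finset.card_pos.1 (by omega)
    have hcard : (s.erase (s.max' hne)).card = m := by
      rw [Finset.card_erase_of_mem (s.max'_mem hne), hm]; rfl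
    obtain ⟨h1, h2⟩ := ih _ hcard
    have hmax : m ≤ s.max' hne := by
      by_contra hlt
      have hsub : s ⊆ Finset.range m := fun x hx =>
        Finset.mem_range.2 ((s.le_max' x hx).trans_lt (not_le.1 hlt))
      have := Finset.card_le_card hsub
      simp [hm] at this
    have hs := Finset.sum_erase_add s (fun i => i) (s.max'_mem hne)
    rw [Finset.sum_range_succ]
    refine ⟨by omega, fun h => ?_⟩
    have h3 := h2 (by omega)
    have h4 : s.max' hne = m := by omega
    rw [← Finset.insert_erase (s.max'_mem hne), h3, h4, Finset.range_add_one]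

theorem card_filter_col_eq (T : Tableau n lam) (c : ℕ) :
    (Finset.univ.filter fun i => (T i).1.2 = c).card = lam.colLen c := by
  rw [YoungDiagram.colLen_eq_card]
  refine Finset.card_bij (fun i _ => (T i).1) (fun i hi => ?_) (fun i _ j _ h => ?_) fun x hx => ?_
  · rw [YoungDiagram.mem_col_iff]
    exact ⟨(YoungDiagram.mem_cells _).1 (T i).2, (Finset.mem_filter.1 hi).2⟩
  · exact T.injective (Subtype.ext h)
  · rw [YoungDiagram.mem_col_iff] at hx
    exact ⟨T.symm ⟨x, hx.1⟩, by simp [hx.2], by simp⟩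

theorem card_filter_row_eq (T : Tableau n lam) (r : ℕ) :
    (Finset.univ.filter fun i => (T i).1.1 = r).card = lam.rowLen r := by
  rw [YoungDiagram.rowLen_eq_card]
  refine Finset.card_bij (fun i _ => (T i).1) (fun i hi => ?_) (fun i _ j _ h => ?_) fun x hx => ?_
  · rw [YoungDiagram.mem_row_iff]
    exact ⟨(YoungDiagram.mem_cells _).1 (T i).2, (Finset.mem_filter.1 hi).2⟩
  · exact T.injective (Subtype.ext h)
  · rw [YoungDiagram.mem_row_iff] at hx
    exact ⟨T.symm ⟨x, hx.1⟩, by simp [hx.2], by simp⟩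

/-- Column by column: a column of length c carries c distinct values, whose sum is at least 0 + 1 +
… + (c - 1), the sum of its row indices. Equality forces the values to be exactly 0, …, c - 1, so F
becomes the row index after a permutation within columns. -/
theorem rowStat_le_sum_of_injective_on_columns (T : Tableau n lam) (F : Fin n → ℕ)
    (hF : ∀ i j, (T i).1.2 = (T j).1.2 → F i = F j → i = j) :
    rowStat lam ≤ ∑ i, F i ∧ (rowStat lam = ∑ i, F i →
      ∃ q : Equiv.Perm (Fin n), (∀ i, (T (q i)).1.2 = (T i).1.2) ∧ ∀ i, F i = (T (q i)).1.1) := by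
  classical
  let cols : Finset ℕ := Finset.univ.image fun i => (T i).1.2
  let S : ℕ → Finset (Fin n) := fun c => Finset.univ.filter fun i => (T i).1.2 = c
  have hS : ∀ c, Set.InjOn F (S c) := fun c i hi j hj h =>
    hF i j ((Finset.mem_filter.1 hi).2.trans (Finset.mem_filter.1 hj).2.symm) h
  have hrow : ∀ c, Set.InjOn (fun i => (T i).1.1) (S c) := fun c i hi j hj h =>
    T.injective (Subtype.ext (Prod.ext h
      ((Finset.mem_filter.1 hi).2.trans (Finset.mem_filter.1 hj).2.symm)))
  have himg : ∀ c, (S c).image (fun i => (T i).1.1) = Finset.range (lam.colLen c) := by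
    intro c
    apply Finset.eq_of_subset_of_card_le
    · intro x hx
      obtain ⟨i, hi, rfl⟩ := Finset.mem_image.1 hx
      rw [Finset.mem_range, ← YoungDiagram.mem_iff_lt_colLen, ← (Finset.mem_filter.1 hi).2]
      exact (YoungDiagram.mem_cells _).1 (T i).2
    · rw [Finset.card_image_of_injOn (hrow c), card_filter_col_eq, Finset.card_range]
  have hcard : ∀ c, ((S c).image F).card = lam.colLen c := fun c => by
    rw [Finset.card_image_of_injOn (hS c), card_filter_col_eq]
  have hsum : ∀ g : Fin n → ℕ, ∑ i, g i = ∑ c ∈ cols, ∑ i ∈ S c, g i := fun g =>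
    (Finset.sum_fiberwise_of_maps_to (fun i hi => Finset.mem_image_of_mem _ hi) g).symm
  have h1 : ∀ c, ∑ i ∈ S c, (T i).1.1 = ∑ x ∈ Finset.range (lam.colLen c), x := fun c => by
    rw [← himg c, Finset.sum_image (hrow c)]
  have h2 : ∀ c, ∑ i ∈ S c, F i = ∑ x ∈ (S c).image F, x := fun c => by
    rw [Finset.sum_image (hS c)]
  have hle : ∀ c ∈ cols, ∑ i ∈ S c, (T i).1.1 ≤ ∑ i ∈ S c, F i := fun c _ => by
    rw [h1, h2, ← hcard c]
    exact (sum_range_card_le_sum _).1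
  rw [← sum_row_eq_rowStat T, hsum, hsum F]
  refine ⟨Finset.sum_le_sum hle, fun heq => ?_⟩
  rw [Finset.sum_eq_sum_iff_of_le hle] at heq
  have hmem : ∀ i, (F i, (T i).1.2) ∈ lam.cells := by
    intro i
    have hc := heq (T i).1.2 (Finset.mem_image_of_mem _ (Finset.mem_univ i))
    rw [h1, h2, ← hcard] at hc
    have := (sum_range_card_le_sum _).2 hc
    rw [YoungDiagram.mem_cells, YoungDiagram.mem_iff_lt_colLen, ← Finset.mem_range, ← hcard, ← this]
    exact Finset.mem_image_of_mem _ (by simp [S])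
  let q : Fin n → Fin n := fun i => T.symm ⟨_, hmem i⟩
  have hq : Function.Injective q := fun i j h => by
    have h' : (F i, (T i).1.2) = (F j, (T j).1.2) := congrArg Subtype.val (T.symm.injective h)
    obtain ⟨h1, h2⟩ := Prod.mk.inj h'
    exact hF i j h2 h1
  exact ⟨Equiv.ofBijective q (Finite.injective_iff_bijective.1 hq), fun i => by simp [q],
    fun i => by simp [q]⟩

/-- The Young symmetrizer generating the Specht module. -/
def youngSymmetrizer (T : Tableau n lam) : MonoidAlgebra ℂ (Equiv.Perm (Fin n)) :=
  columnAntisymmetrizer T * rowSymmetrizer T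

theorem columnAntisymmetrizer_mul_of_mul_colorSymmetrizer (T : Tableau n lam) (f : Fin n → ℕ)
    (k : Equiv.Perm (Fin n))
    (h : columnAntisymmetrizer T * of ℂ _ k * colorSymmetrizer f ≠ 0) :
    rowStat lam ≤ ∑ i, f i ∧ (rowStat lam = ∑ i, f i →
      ∃ q : Equiv.Perm (Fin n), (∀ i, (T (q i)).1.2 = (T i).1.2) ∧
        ∀ i, f (k⁻¹ i) = (T (q i)).1.1) := by
  have hinj : ∀ i j, (T i).1.2 = (T j).1.2 → f (k⁻¹ i) = f (k⁻¹ j) → i = j := by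
    intro i j hc hf
    by_contra hij
    exact h (columnAntisymmetrizer_mul_of_mul_colorSymmetrizer_eq_zero T f k hij hc hf)
  have hs : ∑ i, f (k⁻¹ i) = ∑ i, f i := Equiv.sum_comp k⁻¹ f
  rw [← hs]
  exact rowStat_le_sum_of_injective_on_columns T _ hinj

theorem eq_of_row_comp_eq (T : Tableau n lam) (S : Tableau n mu) (k q : Equiv.Perm (Fin n))
    (h : ∀ i, (S (k i)).1.1 = (T (q i)).1.1) : lam = mu := by
  have hrow : ∀ r, lam.rowLen r = mu.rowLen r := by
    intro r
    rw [← card_filter_row_eq T, ← card_filter_row_eq S]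
    refine Finset.card_equiv (q.symm.trans k) fun i => ?_
    have := h (q.symm i)
    simp only [Equiv.apply_symm_apply] at this
    simp [this]
  ext ⟨i, j⟩
  simp [YoungDiagram.mem_iff_lt_rowLen, hrow]

/-- A nonzero product would force equality in the row statistics, and then the rows of S would be a
rearrangement of those of T. -/
theorem columnAntisymmetrizer_mul_of_mul_rowSymmetrizer_eq_zero (T : Tableau n lam)
    (S : Tableau n mu) (hne : lam ≠ mu) (hle : rowStat mu ≤ rowStat lam) (k : Equiv.Perm (Fin n)) :
    columnAntisymmetrizer T * of ℂ _ k * rowSymmetrizer S = 0 := by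
  by_contra h
  rw [rowSymmetrizer_eq] at h
  obtain ⟨h1, h2⟩ := columnAntisymmetrizer_mul_of_mul_colorSymmetrizer T _ k h
  rw [sum_row_eq_rowStat S] at h1 h2
  obtain ⟨q, -, hq⟩ := h2 (le_antisymm h1 hle)
  exact hne (eq_of_row_comp_eq T S _ q hq)

/-- If the product is nonzero, equality in the row statistic factors k as a column permutation q⁻¹
times a row permutation q k; the outer factors absorb both, up to a sign. -/
theorem exists_smul_youngSymmetrizer (T : Tableau n lam) (k : Equiv.Perm (Fin n)) :
    ∃ c : ℂ, columnAntisymmetrizer T * of ℂ _ k * rowSymmetrizer T = c • youngSymmetrizer T := by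
  by_cases h : columnAntisymmetrizer T * of ℂ _ k * rowSymmetrizer T = 0
  · exact ⟨0, by rw [h, zero_smul]⟩
  have h' := h
  rw [rowSymmetrizer_eq] at h'
  obtain ⟨-, h2⟩ := columnAntisymmetrizer_mul_of_mul_colorSymmetrizer T _ k h'
  obtain ⟨q, hq1, hq2⟩ := h2 (sum_row_eq_rowStat T).symm
  refine ⟨((Equiv.Perm.sign q⁻¹ : ℤ) : ℂ), ?_⟩
  have hk : k = q⁻¹ * (q * k) := by group
  have hr : of ℂ _ (q * k) * rowSymmetrizer T = rowSymmetrizer T := by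
    rw [rowSymmetrizer_eq]
    refine of_mul_colorSymmetrizer _ _ fun i => ?_
    rw [Equiv.Perm.mul_apply, ← hq2 (k i)]
    simp
  have hq' : ∀ i, (T (q⁻¹ i)).1.2 = (T i).1.2 := fun i => by
    have := hq1 (q⁻¹ i)
    simpa using this.symm
  rw [hk, map_mul, ← mul_assoc, mul_assoc _ _ (rowSymmetrizer T), hr,
    columnAntisymmetrizer_mul_of T _ hq', smul_mul_assoc, youngSymmetrizer]

theorem mul_mul_eq_zero_of_forall_of {G : Type*} [Group G] {e f : MonoidAlgebra ℂ G}
    (h : ∀ g, e * of ℂ G g * f = 0) (x : MonoidAlgebra ℂ G) : e * x * f = 0 := by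
  induction x using MonoidAlgebra.induction_on with
  | of g => exact h g
  | add x y hx hy => rw [mul_add, add_mul, hx, hy, add_zero]
  | smul r x hx => rw [mul_smul_comm, smul_mul_assoc, hx, smul_zero]

theorem exists_smul_of_forall_of {G : Type*} [Group G] {e f v : MonoidAlgebra ℂ G}
    (h : ∀ g, ∃ c : ℂ, e * of ℂ G g * f = c • v) (x : MonoidAlgebra ℂ G) :
    ∃ c : ℂ, e * x * f = c • v := by
  induction x using MonoidAlgebra.induction_on with
  | of g => exact h g
  | add x y hx hy =>
    obtain ⟨c, hc⟩ := hx
    obtain ⟨d, hd⟩ := hy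
    exact ⟨c + d, by rw [mul_add, add_mul, hc, hd, add_smul]⟩
  | smul r x hx =>
    obtain ⟨c, hc⟩ := hx
    exact ⟨r * c, by rw [mul_smul_comm, smul_mul_assoc, hc, smul_smul]⟩

open Classical in
theorem youngSymmetrizer_coeff (T : Tableau n lam) (y : Equiv.Perm (Fin n)) :
    (youngSymmetrizer T).coeff y =
      ∑ q : Equiv.Perm (Fin n) with ∀ i, (T (q i)).1.2 = (T i).1.2,
        ∑ r : Equiv.Perm (Fin n) with ∀ i, (T (r i)).1.1 = (T i).1.1,
          if q * r = y then ((Equiv.Perm.sign q : ℤ) : ℂ) else 0 := by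
  rw [youngSymmetrizer, columnAntisymmetrizer, rowSymmetrizer, Finset.sum_mul_sum]
  simp only [coeff_sum, smul_mul_assoc, of_apply, single_mul_single, coeff_smul,
    Finsupp.finsetSum_apply, Finsupp.smul_apply, coeff_single, Finsupp.single_apply, smul_eq_mul,
    mul_ite, mul_one, mul_zero]

/-- A cell is determined by its row and column, so a column permutation times a row permutation is
trivial only if both are. -/
theorem youngSymmetrizer_coeff_one (T : Tableau n lam) : (youngSymmetrizer T).coeff 1 = 1 := by
  classical
  rw [youngSymmetrizer_coeff, Finset.sum_eq_single 1, Finset.sum_eq_single 1]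
  · simp
  · intro r _ hr
    simp [hr]
  · simp
  · intro q hq hq1
    refine Finset.sum_eq_zero fun r hr => if_neg fun h => hq1 ?_
    have hqr : q = r⁻¹ := eq_inv_of_mul_eq_one_left h
    ext i
    have h1 := (Finset.mem_filter.1 hq).2 i
    have h2 := (Finset.mem_filter.1 hr).2 (q i)
    have h3 : r (q i) = i := by rw [hqr]; simp
    rw [h3] at h2
    have : T (q i) = T i := Subtype.ext (Prod.ext h2.symm h1)
    simp [T.injective this]
  · simp

theorem youngSymmetrizer_ne_zero (T : Tableau n lam) : youngSymmetrizer T ≠ 0 := by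
  intro h
  have := youngSymmetrizer_coeff_one T
  rw [h] at this
  simp at this

/-- The scalar `κ` with `c * c = κ • c` for the Young symmetrizer `c`. -/
def hookScalar (T : Tableau n lam) : ℂ := (youngSymmetrizer T * youngSymmetrizer T).coeff 1

theorem youngSymmetrizer_mul_self (T : Tableau n lam) :
    youngSymmetrizer T * youngSymmetrizer T = hookScalar T • youngSymmetrizer T := by
  obtain ⟨c, hc⟩ := exists_smul_of_forall_of (exists_smul_youngSymmetrizer T)
    (rowSymmetrizer T * columnAntisymmetrizer T)
  have h : youngSymmetrizer T * youngSymmetrizer T = c • youngSymmetrizer T := by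
    rw [← hc]
    simp only [youngSymmetrizer, mul_assoc]
  rw [hookScalar, h, coeff_smul, Finsupp.smul_apply, youngSymmetrizer_coeff_one]
  simp

/-- Right multiplication by c has trace n! times the coefficient of c at 1, which is n!. If κ = 0 it
would be nilpotent, with trace 0. -/
theorem hookScalar_ne_zero (T : Tableau n lam) : hookScalar T ≠ 0 := by
  intro h
  have h1 : algChar (youngSymmetrizer T) 1 = (n.factorial : ℂ) := by
    rw [algChar_apply]
    simp [youngSymmetrizer_coeff_one, Fintype.card_perm]
  have h2 := youngSymmetrizer_mul_self T
  rw [h, zero_smul] at h2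
  have h3 : IsNilpotent (LinearMap.mulLeft ℂ (of ℂ (Equiv.Perm (Fin n)) 1) ∘ₗ
      LinearMap.mulRight ℂ (youngSymmetrizer T)) := by
    refine ⟨2, LinearMap.ext fun x => ?_⟩
    simp only [pow_two, map_one, LinearMap.mulLeft_one, Module.End.mul_apply, LinearMap.comp_apply,
      LinearMap.id_apply, LinearMap.mulRight_apply, mul_assoc x, h2, mul_zero,
      LinearMap.zero_apply]
  have h4 := (LinearMap.isNilpotent_trace_of_isNilpotent h3).eq_zero
  rw [algChar] at h1
  rw [h1] at h4
  exact Nat.factorial_ne_zero n (by exact_mod_cast h4)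

end YoungSymmetrizer

/-! ### Characters of Specht modules -/

section SpechtCharacter

open MonoidAlgebra

variable {n : ℕ} {lam mu : YoungDiagram}

/-- Since c² = κ c, right multiplication by κ⁻¹ c projects the algebra onto the Specht module. The
trace on the module is thus the trace of x ↦ κ⁻¹ g x c on the whole algebra. -/
theorem spechtCharacter_eq_algChar (T : Tableau n lam) (g : Equiv.Perm (Fin n)) :
    spechtCharacter T g = (hookScalar T)⁻¹ * algChar (youngSymmetrizer T) g := by
  have hmem : ∀ x, x ∈ spechtModule T ↔ ∃ y, y * youngSymmetrizer T = x := fun x => by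
    rw [spechtModule, Submodule.restrictScalars_mem, Submodule.mem_span_singleton]
    rfl
  set F := (hookScalar T)⁻¹ • (LinearMap.mulLeft ℂ (of ℂ (Equiv.Perm (Fin n)) g) ∘ₗ
    LinearMap.mulRight ℂ (youngSymmetrizer T)) with hF
  have hFmem : ∀ x, F x ∈ spechtModule T := fun x =>
    (hmem _).2 ⟨(hookScalar T)⁻¹ • (of ℂ _ g * x), by simp [hF, mul_assoc]⟩
  have hrep : spechtRep T g = F.restrict fun x _ => hFmem x := by
    refine LinearMap.ext fun x => Subtype.ext ?_
    obtain ⟨y, hy⟩ := (hmem _).1 x.2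
    change of ℂ _ g * x.1 = (hookScalar T)⁻¹ • (of ℂ _ g * (x.1 * youngSymmetrizer T))
    rw [← hy, mul_assoc y, youngSymmetrizer_mul_self, mul_smul_comm, mul_smul_comm, smul_smul,
      inv_mul_cancel₀ (hookScalar_ne_zero T), one_smul]
  rw [spechtCharacter, Representation.character, hrep,
    LinearMap.trace_restrict_eq_of_forall_mem _ F hFmem, hF, map_smul, algChar, smul_eq_mul]

theorem spechtCharacter_eq_smul (T : Tableau n lam) :
    spechtCharacter T = (hookScalar T)⁻¹ • algChar (youngSymmetrizer T) :=
  funext fun g => spechtCharacter_eq_algChar T g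

theorem spechtCharacter_conj (T : Tableau n lam) (g h : Equiv.Perm (Fin n)) :
    spechtCharacter T (h * g * h⁻¹) = spechtCharacter T g :=
  Representation.char_conj _ g h

theorem spechtCharacter_inv (T : Tableau n lam) (g : Equiv.Perm (Fin n)) :
    spechtCharacter T g⁻¹ = spechtCharacter T g := by
  have : IsConj g g⁻¹ := by
    rw [Equiv.Perm.isConj_iff_cycleType_eq, Equiv.Perm.cycleType_inv]
  obtain ⟨c, hc⟩ := isConj_iff.1 this
  rw [← hc, spechtCharacter_conj]

/-- After ordering the two shapes by `rowStat`, every product c_S g c_T contains a factor b_S x a_T,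
which vanishes. -/
theorem charInner_spechtCharacter_of_ne (T : Tableau n lam) (S : Tableau n mu) (h : lam ≠ mu) :
    charInner (spechtCharacter T) (spechtCharacter S) = 0 := by
  wlog hle : rowStat lam ≤ rowStat mu generalizing lam mu
  · rw [charInner_comm]
    exact this S T h.symm (le_of_not_ge hle)
  rw [spechtCharacter_eq_smul T, spechtCharacter_eq_smul S, charInner_smul_left, charInner_comm,
    charInner_smul_left, charInner_comm, charInner_algChar_eq_zero, mul_zero, mul_zero]
  intro g
  have := mul_mul_eq_zero_of_forall_of
    (columnAntisymmetrizer_mul_of_mul_rowSymmetrizer_eq_zero S T h.symm hle)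
    (rowSymmetrizer S * of ℂ _ g * columnAntisymmetrizer T)
  simpa only [youngSymmetrizer, mul_assoc] using this

/-- The map x ↦ c x c has image in the line through c and eigenvalue κ² there; the two factors κ⁻¹
cancel it. -/
theorem charInner_spechtCharacter_self (T : Tableau n lam) :
    charInner (spechtCharacter T) (spechtCharacter T) = 1 := by
  have h := charInner_algChar_eq_of_line (e := youngSymmetrizer T) (f := youngSymmetrizer T)
    (v := youngSymmetrizer T) (c := hookScalar T * hookScalar T) (youngSymmetrizer_ne_zero T)
    (fun g => ?_) ?_
  · rw [spechtCharacter_eq_smul, charInner_smul_left, charInner_comm, charInner_smul_left, h]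
    have := hookScalar_ne_zero T
    field_simp
  · obtain ⟨c, hc⟩ := exists_smul_of_forall_of (exists_smul_youngSymmetrizer T)
      (rowSymmetrizer T * of ℂ _ g * columnAntisymmetrizer T)
    exact ⟨c, by rw [← hc]; simp only [youngSymmetrizer, mul_assoc]⟩
  · rw [youngSymmetrizer_mul_self, smul_mul_assoc, youngSymmetrizer_mul_self, smul_smul]

/-- The permutations preserving a colouring. -/
def colorStabilizer {n : ℕ} (f : Fin n → ℕ) : Finset (Equiv.Perm (Fin n)) :=
  Finset.univ.filter fun σ => ∀ i, f (σ i) = f i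

theorem mem_colorStabilizer {f : Fin n → ℕ} {σ : Equiv.Perm (Fin n)} :
    σ ∈ colorStabilizer f ↔ ∀ i, f (σ i) = f i := by
  simp [colorStabilizer]

theorem colorSymmetrizer_coeff (f : Fin n → ℕ) (σ : Equiv.Perm (Fin n)) :
    (colorSymmetrizer f).coeff σ = if σ ∈ colorStabilizer f then 1 else 0 := by
  classical
  simp only [colorSymmetrizer, coeff_sum, of_apply, coeff_single, Finsupp.finsetSum_apply,
    Finsupp.single_apply, Finset.sum_ite_eq', mem_colorStabilizer]
  congr! 1
  simp

theorem charInner_algChar_colorSymmetrizer {φ : Equiv.Perm (Fin n) → ℂ}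
    (hφ : ∀ g h, φ (h * g * h⁻¹) = φ g) (f : Fin n → ℕ) :
    charInner φ (algChar (colorSymmetrizer f)) = ∑ σ ∈ colorStabilizer f, φ σ := by
  rw [charInner_algChar hφ]
  simp [colorSymmetrizer_coeff]

/-- The sum is the stabilizer's order times the multiplicity of the Specht module in the permutation
module of f. For the colouring by rows that multiplicity is one, as the next lemma shows. -/
theorem sum_colorStabilizer_spechtCharacter_eq_zero (T : Tableau n lam) (f : Fin n → ℕ)
    (hf : ∀ k : Equiv.Perm (Fin n), columnAntisymmetrizer T * of ℂ _ k * colorSymmetrizer f = 0) :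
    ∑ σ ∈ colorStabilizer f, spechtCharacter T σ = 0 := by
  rw [← charInner_algChar_colorSymmetrizer (spechtCharacter_conj T), spechtCharacter_eq_smul,
    charInner_smul_left, charInner_comm, charInner_algChar_eq_zero, mul_zero]
  intro g
  have := mul_mul_eq_zero_of_forall_of hf (rowSymmetrizer T * of ℂ _ g)
  simpa only [youngSymmetrizer, mul_assoc] using this

theorem sum_colorStabilizer_row_spechtCharacter (T : Tableau n lam) :
    ∑ σ ∈ colorStabilizer (fun i => (T i).1.1), spechtCharacter T σ =
      (colorStabilizer fun i => (T i).1.1).card := by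
  have h := charInner_algChar_eq_of_line (e := youngSymmetrizer T) (f := rowSymmetrizer T)
    (v := youngSymmetrizer T) (c := hookScalar T * (colorStabilizer fun i => (T i).1.1).card)
    (youngSymmetrizer_ne_zero T) (fun g => ?_) ?_
  · rw [← charInner_algChar_colorSymmetrizer (spechtCharacter_conj T), spechtCharacter_eq_smul,
      charInner_smul_left, charInner_comm, ← rowSymmetrizer_eq, h,
      inv_mul_cancel_left₀ (hookScalar_ne_zero T)]
  · obtain ⟨c, hc⟩ := exists_smul_of_forall_of (exists_smul_youngSymmetrizer T)
      (rowSymmetrizer T * of ℂ _ g)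
    exact ⟨c, by rw [← hc]; simp only [youngSymmetrizer, mul_assoc]⟩
  · have h2 := colorSymmetrizer_mul_self fun i => (T i).1.1
    rw [← rowSymmetrizer_eq] at h2
    rw [youngSymmetrizer_mul_self, smul_mul_assoc, youngSymmetrizer, mul_assoc, h2, mul_smul_comm,
      smul_smul]
    rfl

/-- Transposing exchanges row and column groups. Inversion turns q r into r⁻¹ q⁻¹, and the sign
moves from one factor to the other at the cost of the sign of y. -/
theorem youngSymmetrizer_transpose_coeff (T : Tableau n lam) (S : Tableau n lam.transpose)
    (hS : ∀ i, (S i).1 = (T i).1.swap) (y : Equiv.Perm (Fin n)) :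
    (youngSymmetrizer S).coeff y =
      ((Equiv.Perm.sign y : ℤ) : ℂ) * (youngSymmetrizer T).coeff y⁻¹ := by
  classical
  have hinv : ∀ (F : Fin n → ℕ) (q : Equiv.Perm (Fin n)), (∀ i, F (q i) = F i) ↔
      ∀ i, F (q⁻¹ i) = F i := fun F q =>
    ⟨fun h i => by simpa using (h (q⁻¹ i)).symm, fun h i => by simpa using (h (q i)).symm⟩
  rw [youngSymmetrizer_coeff, youngSymmetrizer_coeff, Finset.mul_sum, Finset.sum_comm]
  simp only [hS, Prod.fst_swap, Prod.snd_swap]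
  refine Finset.sum_equiv (Equiv.inv _) (fun q => ?_) fun q hq => ?_
  · simpa using hinv (fun i => (T i).1.2) q
  · rw [Finset.mul_sum]
    refine Finset.sum_equiv (Equiv.inv _) (fun r => ?_) fun r hr => ?_
    · simpa using hinv (fun i => (T i).1.1) r
    · simp only [Equiv.inv_apply, ← mul_inv_rev, inv_inj]
      split_ifs with h
      · subst h
        rcases Int.units_eq_one_or (Equiv.Perm.sign q) with h1 | h1 <;> simp [h1]
      · simp

theorem spechtCharacter_transpose (T : Tableau n lam) (S : Tableau n lam.transpose)
    (hS : ∀ i, (S i).1 = (T i).1.swap) (g : Equiv.Perm (Fin n)) :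
    spechtCharacter S g = ((Equiv.Perm.sign g : ℤ) : ℂ) * spechtCharacter T g := by
  have hk : hookScalar S = hookScalar T := by
    rw [hookScalar, hookScalar, coeff_mul_apply_left, coeff_mul_apply_left, Finsupp.sum_fintype,
      Finsupp.sum_fintype]
    · refine Fintype.sum_equiv (Equiv.inv _) _ _ fun y => ?_
      simp only [youngSymmetrizer_transpose_coeff T S hS]
      rcases Int.units_eq_one_or (Equiv.Perm.sign y) with h1 | h1 <;> simp [h1]
    · simp
    · simp
  rw [← spechtCharacter_inv T, spechtCharacter_eq_algChar, spechtCharacter_eq_algChar, hk,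
    algChar_apply, algChar_apply]
  simp only [youngSymmetrizer_transpose_coeff T S hS, Finset.mul_sum]
  refine Finset.sum_congr rfl fun k _ => ?_
  simp only [Equiv.Perm.sign_mul, Equiv.Perm.sign_inv, mul_inv_rev, inv_inv, mul_assoc]
  rcases Int.units_eq_one_or (Equiv.Perm.sign g) with h1 | h1 <;>
  rcases Int.units_eq_one_or (Equiv.Perm.sign k) with h2 | h2 <;> simp [h1, h2]

/-- The transpose of a tableau. -/
def transposeTableau (T : Tableau n lam) : Tableau n lam.transpose :=
  T.trans ((Equiv.prodComm ℕ ℕ).subtypeEquiv fun c => by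
    rw [YoungDiagram.mem_cells, YoungDiagram.mem_cells, YoungDiagram.mem_transpose]; rfl)

theorem transposeTableau_apply (T : Tableau n lam) (i : Fin n) :
    (transposeTableau T i).1 = (T i).1.swap := rfl

theorem Tableau.card_eq (T : Tableau n lam) : lam.card = n := by
  have := Fintype.card_congr T
  simpa using this.symm

/-! ### Completeness of the Specht characters -/

theorem card_eq_sum_rowLens (lam : YoungDiagram) : lam.card = lam.rowLens.sum := by
  have h : ∀ c ∈ lam.cells, c.1 ∈ Finset.range (lam.colLen 0) := fun c hc => by
    rw [Finset.mem_range, ← YoungDiagram.mem_iff_lt_colLen]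
    exact lam.up_left_mem le_rfl (Nat.zero_le _) ((YoungDiagram.mem_cells c).1 hc)
  rw [YoungDiagram.card, Finset.card_eq_sum_card_fiberwise h]
  refine (Finset.sum_congr rfl fun i _ => ?_).trans
    (rfl : ∑ i ∈ Finset.range (lam.colLen 0), lam.rowLen i = _)
  exact lam.rowLen_eq_card.symm

theorem factorsThrough_partition {φ : Equiv.Perm (Fin n) → ℂ}
    (hφ : ∀ g h, φ (h * g * h⁻¹) = φ g) :
    φ.FactorsThrough (Equiv.Perm.partition : Equiv.Perm (Fin n) → _) := by
  intro g h hgh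
  obtain ⟨c, hc⟩ := isConj_iff.1 (Equiv.Perm.partition_eq_of_isConj.2 hgh)
  rw [← hc, hφ]

/-- An orthonormal family of class functions indexed by the conjugacy classes is complete. -/
theorem eq_zero_of_charInner_eq_zero {G ι : Type*} [Group G] [Fintype G] [Fintype ι]
    [DecidableEq ι] (c : G → ι) (χ : ι → G → ℂ) (hχ : ∀ μ, (χ μ).FactorsThrough c)
    (horth : ∀ μ ν, charInner (χ μ) (χ ν) = if μ = ν then 1 else 0) {φ : G → ℂ}
    (hφ : φ.FactorsThrough c) (h0 : ∀ μ, charInner φ (χ μ) = 0) : φ = 0 := by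
  let Φ : (ι → ℂ) →ₗ[ℂ] (ι → ℂ) :=
    { toFun := fun a μ => charInner (a ∘ c) (χ μ)
      map_add' := fun a b => funext fun μ => charInner_add_left _ _ _
      map_smul' := fun r a => funext fun μ => charInner_smul_left r _ _ }
  have hext : ∀ ψ : G → ℂ, ψ.FactorsThrough c → Function.extend c ψ 0 ∘ c = ψ := fun ψ hψ =>
    funext fun g => hψ.extend_apply _ _
  have hΦa : ∀ μ ν, Φ (Function.extend c (χ μ) 0) ν = if μ = ν then 1 else 0 := fun μ ν => by
    change charInner (Function.extend c (χ μ) 0 ∘ c) (χ ν) = _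
    rw [hext _ (hχ μ), horth]
  have hsurj : Function.Surjective Φ := fun b => by
    refine ⟨∑ μ, b μ • Function.extend c (χ μ) 0, ?_⟩
    rw [map_sum]
    ext ν
    simp [hΦa]
  have hinj := LinearMap.injective_iff_surjective.2 hsurj
  have hz : Function.extend c φ 0 = 0 := by
    apply hinj
    rw [map_zero]
    ext μ
    change charInner (Function.extend c φ 0 ∘ c) (χ μ) = 0
    rw [hext _ hφ, h0]
  rw [← hext φ hφ, hz]
  rfl

/-- The Young diagram of a partition. -/
def partitionDiagram {m : ℕ} (μ : m.Partition) : YoungDiagram :=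
  YoungDiagram.ofRowLens (μ.parts.sort (· ≥ ·)) (μ.parts.pairwise_sort _).sortedGE

theorem rowLens_partitionDiagram {m : ℕ} (μ : m.Partition) :
    (partitionDiagram μ).rowLens = μ.parts.sort (· ≥ ·) :=
  YoungDiagram.rowLens_ofRowLens_eq_self fun _ hx => μ.parts_pos ((Multiset.mem_sort _).1 hx)

theorem partitionDiagram_injective {m : ℕ} :
    Function.Injective (partitionDiagram : m.Partition → YoungDiagram) := by
  intro μ ν h
  have h' := congrArg YoungDiagram.rowLens h
  rw [rowLens_partitionDiagram, rowLens_partitionDiagram] at h'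
  have := congrArg (fun l : List ℕ => (l : Multiset ℕ)) h'
  simp only [Multiset.sort_eq] at this
  exact Nat.Partition.ext this

theorem nonempty_tableau {lam : YoungDiagram} (h : lam.rowLens.sum = n) :
    Nonempty (Tableau n lam) := by
  refine ⟨Fintype.equivOfCardEq ?_⟩
  rw [Fintype.card_fin, Fintype.card_coe, ← h]
  exact (card_eq_sum_rowLens lam).symm

theorem sum_rowLens_partitionDiagram {m : ℕ} (μ : m.Partition) :
    (partitionDiagram μ).rowLens.sum = m := by
  rw [rowLens_partitionDiagram, ← Multiset.sum_coe, Multiset.sort_eq, μ.parts_sum]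

/-- The Specht characters span the class functions. -/
theorem eq_zero_of_charInner_spechtCharacter_eq_zero {φ : Equiv.Perm (Fin n) → ℂ}
    (hφ : ∀ g h, φ (h * g * h⁻¹) = φ g)
    (h0 : ∀ lam : YoungDiagram, Nonempty (Tableau n lam) →
      ∃ T : Tableau n lam, charInner φ (spechtCharacter T) = 0) :
    φ = 0 := by
  -- Cycle partitions live over `Fintype.card (Fin n)`, which is only propositionally `n`.
  have hT : ∀ μ : (Fintype.card (Fin n)).Partition, Nonempty (Tableau n (partitionDiagram μ)) :=
    fun μ => nonempty_tableau ((sum_rowLens_partitionDiagram μ).trans (Fintype.card_fin n))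
  let T := fun μ => (h0 _ (hT μ)).choose
  refine eq_zero_of_charInner_eq_zero Equiv.Perm.partition (fun μ => spechtCharacter (T μ))
    (fun μ => factorsThrough_partition (spechtCharacter_conj (T μ))) (fun μ ν => ?_)
    (factorsThrough_partition hφ) fun μ => (h0 _ (hT μ)).choose_spec
  split_ifs with h
  · subst h
    exact charInner_spechtCharacter_self _
  · exact charInner_spechtCharacter_of_ne _ _ fun h' => h (partitionDiagram_injective h')

end SpechtCharacter

/-! ### The generating polynomial of fixed colourings -/

section FixedColorings

open MvPolynomial

variable {α κ : Type*} [Fintype α] [DecidableEq κ] {N : ℕ}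

/-- The generating polynomial, by content, of the colourings fixed by `g`. -/
def fixPoly [DecidableEq α] (N : ℕ) (g : Equiv.Perm α) : MvPolynomial (Fin N) ℤ :=
  ∑ F : α → Fin N with ∀ a, F (g a) = F a, ∏ a, X (F a)

/-- The complete homogeneous symmetric polynomial. -/
def completePoly (N m : ℕ) : MvPolynomial (Fin N) ℤ :=
  ∑ c ∈ Finset.piAntidiag (Finset.univ : Finset (Fin N)) m, ∏ i, X i ^ c i

/-- The joint content of two colourings. -/
def jointContent (f : α → κ) (F : α → Fin N) (j : κ) (i : Fin N) : ℕ :=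
  (Finset.univ.filter fun a => f a = j ∧ F a = i).card

theorem prod_X_eq_prod_jointContent [Fintype κ] (f : α → κ) (F : α → Fin N) :
    ∏ a, (X (F a) : MvPolynomial (Fin N) ℤ) = ∏ j, ∏ i, X i ^ jointContent f F j i := by
  rw [← Finset.prod_fiberwise (s := Finset.univ) (g := f)]
  refine Finset.prod_congr rfl fun j _ => ?_
  rw [← Finset.prod_fiberwise (s := Finset.univ.filter fun a => f a = j) (g := F)]
  refine Finset.prod_congr rfl fun i _ => ?_
  rw [jointContent, Finset.filter_filter]
  rw [Finset.prod_congr rfl (g := fun _ => X i), Finset.prod_const]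
  intro a ha
  rw [(Finset.mem_filter.1 ha).2.2]

theorem exists_jointContent_eq (f : α → κ) (c : κ → Fin N → ℕ)
    (hc : ∀ j, ∑ i, c j i = (Finset.univ.filter fun a => f a = j).card) :
    ∃ F : α → Fin N, jointContent f F = c := by
  have e : ∀ j, Nonempty ({a // f a = j} ≃ Σ i : Fin N, Fin (c j i)) := fun j => by
    refine ⟨Fintype.equivOfCardEq ?_⟩
    rw [Fintype.card_sigma, Fintype.card_subtype]
    simp [hc]
  refine ⟨fun a => ((e (f a)).some ⟨a, rfl⟩).1, ?_⟩
  have hF : ∀ j a (h : f a = j), ((e (f a)).some ⟨a, rfl⟩).1 = ((e j).some ⟨a, h⟩).1 := by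
    rintro _ a rfl
    rfl
  ext j i
  rw [jointContent]
  have : Fintype.card (Fin (c j i)) = c j i := Fintype.card_fin _
  rw [← this, ← Finset.card_univ]
  symm
  refine Finset.card_bij (fun x _ => ((e j).some.symm ⟨i, x⟩).1) (fun x _ => ?_)
    (fun x _ y _ h => ?_) fun a ha => ?_
  · simp only [Finset.mem_filter, Finset.mem_univ, true_and]
    refine ⟨((e j).some.symm ⟨i, x⟩).2, ?_⟩
    rw [hF j _ ((e j).some.symm ⟨i, x⟩).2]
    simp
  · have := (e j).some.symm.injective (Subtype.ext h)
    simpa using this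
  · obtain ⟨h1, h2⟩ := (Finset.mem_filter.1 ha).2
    rw [hF j a h1] at h2
    obtain ⟨x, hx⟩ : ∃ x : Fin (c j i), (e j).some ⟨a, h1⟩ = ⟨i, x⟩ := by
      subst h2
      exact ⟨_, rfl⟩
    exact ⟨x, Finset.mem_univ _, by rw [← hx]; simp⟩

theorem exists_perm_of_jointContent_eq {f : α → κ} {F F' : α → Fin N}
    (h : jointContent f F = jointContent f F') :
    ∃ τ : Equiv.Perm α, (∀ a, f (τ a) = f a) ∧ ∀ a, F' (τ a) = F a := by
  have e : ∀ p : κ × Fin N, Nonempty ({a // (f a, F a) = p} ≃ {a // (f a, F' a) = p}) := by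
    rintro ⟨j, i⟩
    refine ⟨Fintype.equivOfCardEq ?_⟩
    have := congrFun (congrFun h j) i
    simp only [jointContent] at this
    simpa [Fintype.card_subtype] using this
  refine ⟨Equiv.ofFiberEquiv fun p => (e p).some, fun a => ?_, fun a => ?_⟩
  · exact congrArg Prod.fst (Equiv.ofFiberEquiv_map (fun p => (e p).some) a)
  · exact congrArg Prod.snd (Equiv.ofFiberEquiv_map (fun p => (e p).some) a)

variable [DecidableEq α] [Fintype κ]

/-- Orbit counting for the stabilizer of a colouring acting on a second colouring. -/
theorem sum_card_stabilizer_of_jointContent (f : α → κ) (c : κ → Fin N → ℕ)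
    (hc : ∀ j, ∑ i, c j i = (Finset.univ.filter fun a => f a = j).card) :
    ∑ F : α → Fin N with jointContent f F = c,
        (Finset.univ.filter fun σ : Equiv.Perm α =>
          (∀ a, f (σ a) = f a) ∧ ∀ a, F (σ a) = F a).card =
      (Finset.univ.filter fun σ : Equiv.Perm α => ∀ a, f (σ a) = f a).card := by
  obtain ⟨F₀, hF₀⟩ := exists_jointContent_eq f c hc
  have hmaps : ∀ τ ∈ (Finset.univ.filter fun σ : Equiv.Perm α => ∀ a, f (σ a) = f a),
      (F₀ ∘ τ) ∈ (Finset.univ.filter fun F : α → Fin N => jointContent f F = c) := by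
    intro τ hτ
    rw [Finset.mem_filter] at hτ ⊢
    refine ⟨Finset.mem_univ _, ?_⟩
    rw [← hF₀]
    ext j i
    refine Finset.card_equiv τ fun a => ?_
    simp [hτ.2]
  rw [Finset.card_eq_sum_card_fiberwise hmaps]
  refine Finset.sum_congr rfl fun F hF => ?_
  obtain ⟨τ, hτf, hτF⟩ := exists_perm_of_jointContent_eq ((Finset.mem_filter.1 hF).2.trans hF₀.symm)
  refine Finset.card_equiv (Equiv.mulLeft τ) fun σ => ?_
  simp only [Finset.mem_filter, Finset.mem_univ, true_and, Equiv.coe_mulLeft,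
    Equiv.Perm.mul_apply, funext_iff, Function.comp_apply, hτf, hτF]

/-- Count pairs of a permutation in the Young subgroup and a colouring it fixes. The orbits of
colourings correspond to joint contents, and each orbit contributes the subgroup's order, by orbit
counting; joint contents are the terms of a product of complete homogeneous polynomials. -/
theorem sum_fixPoly_stabilizer (f : α → κ) :
    ∑ σ : Equiv.Perm α with ∀ a, f (σ a) = f a, fixPoly N σ =
      ((Finset.univ.filter fun σ : Equiv.Perm α => ∀ a, f (σ a) = f a).card : ℤ) •
        ∏ j, completePoly N (Finset.univ.filter fun a => f a = j).card := by
  simp only [fixPoly]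
  have h1 : ∑ σ : Equiv.Perm α with ∀ a, f (σ a) = f a,
      ∑ F : α → Fin N with ∀ a, F (σ a) = F a, ∏ a, (X (F a) : MvPolynomial (Fin N) ℤ) =
      ∑ F : α → Fin N, ((Finset.univ.filter fun σ : Equiv.Perm α =>
          (∀ a, f (σ a) = f a) ∧ ∀ a, F (σ a) = F a).card : ℤ) • ∏ a, X (F a) := by
    rw [Finset.sum_comm' (s' := fun F => Finset.univ.filter fun σ : Equiv.Perm α =>
      (∀ a, f (σ a) = f a) ∧ ∀ a, F (σ a) = F a) (t' := Finset.univ) (by simp)]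
    refine Finset.sum_congr rfl fun F _ => ?_
    rw [Finset.sum_const, natCast_zsmul]
  rw [h1]
  have hmaps : ∀ F ∈ (Finset.univ : Finset (α → Fin N)), jointContent f F ∈
      Fintype.piFinset fun j => Finset.piAntidiag (Finset.univ : Finset (Fin N))
        (Finset.univ.filter fun a => f a = j).card := by
    intro F _
    rw [Fintype.mem_piFinset]
    intro j
    rw [Finset.mem_piAntidiag]
    refine ⟨?_, by simp⟩
    change ∑ i, jointContent f F j i = _
    simp only [jointContent, ← Finset.filter_filter]
    exact (Finset.card_eq_sum_card_fiberwise (fun a _ => Finset.mem_univ _)).symm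
  rw [← Finset.sum_fiberwise_of_maps_to hmaps]
  simp only [completePoly]
  rw [Finset.prod_univ_sum, Finset.smul_sum]
  refine Finset.sum_congr rfl fun c hc => ?_
  have hc' : ∀ j, ∑ i, c j i = (Finset.univ.filter fun a => f a = j).card := fun j =>
    (Finset.mem_piAntidiag.1 (Fintype.mem_piFinset.1 hc j)).1
  rw [← sum_card_stabilizer_of_jointContent f c hc', Nat.cast_sum, Finset.sum_smul]
  refine Finset.sum_congr rfl fun F hF => ?_
  rw [prod_X_eq_prod_jointContent f F, (Finset.mem_filter.1 hF).2]

theorem fixPoly_conj (g h : Equiv.Perm α) : fixPoly N (h * g * h⁻¹) = fixPoly N g := by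
  refine Finset.sum_equiv (Equiv.arrowCongr h.symm (Equiv.refl _)) (fun F => ?_) fun F hF => ?_
  · rw [Finset.mem_filter, Finset.mem_filter]
    simp only [Finset.mem_univ, true_and, Equiv.arrowCongr_apply,
      Equiv.coe_refl, Function.comp_apply, id, Equiv.symm_symm, Equiv.Perm.mul_apply]
    constructor
    · intro H a
      simpa using H (h a)
    · intro H a
      simpa using H (h⁻¹ a)
  · exact (Equiv.prod_comp h fun a => X (F a)).symm

end FixedColorings

/-! ### Alternants and Pieri's rule -/

section Alternants

open MvPolynomial

variable {N : ℕ}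

/-- The coefficient of a polynomial at an exponent vector. -/
def coeffAt (P : MvPolynomial (Fin N) ℤ) (β : Fin N → ℕ) : ℤ :=
  coeff (Finsupp.equivFunOnFinite.symm β) P

/-- The exponents `N - 1, …, 1, 0`. -/
def staircase (N : ℕ) (i : Fin N) : ℕ := N - 1 - i

/-- The Vandermonde alternant. -/
def vandermondePoly (N : ℕ) : MvPolynomial (Fin N) ℤ :=
  ∑ σ : Equiv.Perm (Fin N), (Equiv.Perm.sign σ : ℤ) • ∏ i, X i ^ staircase N (σ i)

/-- Polynomials that change by the sign under permutations of the variables. -/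
def IsAlternating (P : MvPolynomial (Fin N) ℤ) : Prop :=
  ∀ τ : Equiv.Perm (Fin N), rename τ P = (Equiv.Perm.sign τ : ℤ) • P

theorem isAlternating_vandermondePoly : IsAlternating (vandermondePoly N) := by
  intro τ
  simp only [vandermondePoly, map_sum, map_zsmul, map_prod, map_pow, rename_X, Finset.smul_sum,
    smul_smul]
  refine Fintype.sum_equiv (Equiv.mulRight τ⁻¹) _ _ fun σ => ?_
  have h1 : Equiv.Perm.sign τ * Equiv.Perm.sign (σ * τ⁻¹) = Equiv.Perm.sign σ := by
    rw [map_mul, map_inv, mul_comm, mul_assoc, inv_mul_cancel, mul_one]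
  rw [Equiv.coe_mulRight, ← Units.val_mul, h1]
  congr 1
  refine Fintype.prod_equiv τ _ _ fun i => ?_
  simp

theorem IsAlternating.mul_isSymmetric {P Q : MvPolynomial (Fin N) ℤ} (hP : IsAlternating P)
    (hQ : Q.IsSymmetric) : IsAlternating (P * Q) := by
  intro τ
  rw [map_mul, hP τ, hQ τ, smul_mul_assoc]

theorem isSymmetric_completePoly (m : ℕ) : (completePoly N m).IsSymmetric := by
  intro τ
  simp only [completePoly, map_sum, map_prod, map_pow, rename_X]
  refine Finset.sum_equiv (Equiv.arrowCongr τ (Equiv.refl ℕ)) (fun c => ?_) fun c _ => ?_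
  · rw [Finset.mem_piAntidiag, Finset.mem_piAntidiag]
    simp only [Finset.mem_univ, implies_true, and_true]
    rw [← Equiv.sum_comp τ.symm c]
    rfl
  · refine Fintype.prod_equiv τ _ _ fun i => ?_
    simp

theorem coeffAt_comp {P : MvPolynomial (Fin N) ℤ} (hP : IsAlternating P)
    (τ : Equiv.Perm (Fin N)) (β : Fin N → ℕ) :
    coeffAt P (β ∘ τ) = Equiv.Perm.sign τ * coeffAt P β := by
  have h : coeffAt (rename τ P) β = coeffAt P (β ∘ τ) := by
    rw [coeffAt, coeffAt, ← coeff_rename_mapDomain τ τ.injective P]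
    congr 1
    ext i
    rw [Finsupp.mapDomain_equiv_apply]
    simp
  rw [← h, hP τ, coeffAt, coeff_smul, smul_eq_mul, coeffAt]

theorem coeffAt_eq_zero {P : MvPolynomial (Fin N) ℤ} (hP : IsAlternating P) {β : Fin N → ℕ}
    {i j : Fin N} (hij : i ≠ j) (h : β i = β j) : coeffAt P β = 0 := by
  have := coeffAt_comp hP (Equiv.swap i j) β
  rw [Equiv.Perm.sign_swap hij] at this
  have h2 : β ∘ Equiv.swap i j = β := by
    funext k
    simp only [Function.comp_apply, Equiv.swap_apply_def]
    split_ifs with h1 h2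
    · rw [h1, h]
    · rw [h2, h]
    · rfl
  rw [h2] at this
  simp only [Units.val_neg, Units.val_one] at this
  lia

open Classical in
theorem coeffAt_mul_prod_X_pow (P : MvPolynomial (Fin N) ℤ) (c β : Fin N → ℕ) :
    coeffAt (P * ∏ i, X i ^ c i) β = if c ≤ β then coeffAt P (β - c) else 0 := by
  have h : (∏ i, X i ^ c i : MvPolynomial (Fin N) ℤ) =
      monomial (Finsupp.equivFunOnFinite.symm c) 1 := by
    rw [monomial_eq, C_1, one_mul, Finsupp.prod_fintype _ _ (fun i => pow_zero _)]
    rfl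
  rw [coeffAt, h, coeff_mul_monomial']
  have h1 : Finsupp.equivFunOnFinite.symm c ≤ Finsupp.equivFunOnFinite.symm β ↔ c ≤ β := Iff.rfl
  simp only [h1, mul_one]
  refine if_congr Iff.rfl (congrArg (coeff · P) ?_) rfl
  ext i
  simp

theorem coeffAt_sum {ι : Type*} (s : Finset ι) (P : ι → MvPolynomial (Fin N) ℤ) (β : Fin N → ℕ) :
    coeffAt (∑ i ∈ s, P i) β = ∑ i ∈ s, coeffAt (P i) β :=
  coeff_sum _ _ _

theorem coeffAt_prod_X_pow (c β : Fin N → ℕ) :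
    coeffAt (∏ i, X i ^ c i : MvPolynomial (Fin N) ℤ) β = if c = β then 1 else 0 := by
  have h : (∏ i, X i ^ c i : MvPolynomial (Fin N) ℤ) =
      monomial (Finsupp.equivFunOnFinite.symm c) 1 := by
    rw [monomial_eq, C_1, one_mul, Finsupp.prod_fintype _ _ (fun i => pow_zero _)]
    rfl
  rw [coeffAt, h, coeff_monomial]
  simp

theorem coeffAt_vandermondePoly (β : Fin N → ℕ) :
    coeffAt (vandermondePoly N) β =
      ∑ σ : Equiv.Perm (Fin N), if staircase N ∘ σ = β then (Equiv.Perm.sign σ : ℤ) else 0 := by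
  rw [vandermondePoly, coeffAt_sum]
  refine Finset.sum_congr rfl fun σ _ => ?_
  have := coeffAt_prod_X_pow (fun i => staircase N (σ i)) β
  rw [coeffAt, coeff_smul, ← coeffAt, this, smul_eq_mul, mul_ite, mul_one, mul_zero]
  rfl

/-- The part of Pieri's rule that restricts the support. -/
theorem exists_interlacing_of_coeffAt_mul_completePoly {P : MvPolynomial (Fin N) ℤ}
    (hP : IsAlternating P) {m : ℕ} {β : Fin N → ℕ} (hβ : Antitone β)
    (h : coeffAt (P * completePoly N m) β ≠ 0) :
    ∃ γ : Fin N → ℕ, coeffAt P γ ≠ 0 ∧ γ ≤ β ∧ ∑ i, γ i + m = ∑ i, β i ∧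
      ∀ i j : Fin N, (j : ℕ) = i + 1 → β j < γ i := by
  classical
  by_contra hno
  push Not at hno
  refine h ?_
  rw [completePoly, Finset.mul_sum, coeffAt_sum]
  simp only [coeffAt_mul_prod_X_pow]
  rw [← Finset.sum_filter]
  set bad : (Fin N → ℕ) → Prop := fun γ => ∃ i j : Fin N, (j : ℕ) = i + 1 ∧ γ i ≤ β j
  -- Substitute γ = β - c; the terms are then indexed by the exponents of P itself.
  have hred : ∑ c ∈ Finset.piAntidiag Finset.univ m with c ≤ β, coeffAt P (β - c) =
      ∑ γ ∈ (Fintype.piFinset fun i => Finset.range (β i + 1)) with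
        ∑ i, γ i + m = ∑ i, β i, coeffAt P γ := by
    refine Finset.sum_bij' (fun c _ => β - c) (fun γ _ => β - γ) ?_ ?_ ?_ ?_ ?_
    · intro c hc
      simp only [Finset.mem_filter, Finset.mem_piAntidiag, Fintype.mem_piFinset, Finset.mem_range,
        Pi.sub_apply] at hc ⊢
      refine ⟨fun i => by omega, ?_⟩
      rw [← hc.1.1, ← Finset.sum_add_distrib]
      exact Finset.sum_congr rfl fun i _ => Nat.sub_add_cancel (hc.2 i)
    · intro γ hγ
      simp only [Finset.mem_filter, Finset.mem_piAntidiag, Fintype.mem_piFinset, Finset.mem_range,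
        Pi.sub_apply] at hγ ⊢
      refine ⟨⟨?_, fun i _ => Finset.mem_univ i⟩, fun i => Nat.sub_le _ _⟩
      have : ∑ i, (β i - γ i) + ∑ i, γ i = ∑ i, β i := by
        rw [← Finset.sum_add_distrib]
        exact Finset.sum_congr rfl fun i _ => Nat.sub_add_cancel (Nat.le_of_lt_succ (hγ.1 i))
      omega
    · intro c hc
      simp only [Finset.mem_filter] at hc
      exact tsub_tsub_cancel_of_le hc.2
    · intro γ hγ
      simp only [Finset.mem_filter, Fintype.mem_piFinset, Finset.mem_range] at hγ
      exact tsub_tsub_cancel_of_le fun i => Nat.le_of_lt_succ (hγ.1 i)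
    · intro c hc
      rfl
  rw [hred]
  have hgood : ∀ γ ∈ (Fintype.piFinset fun i => Finset.range (β i + 1)).filter
      fun γ => ∑ i, γ i + m = ∑ i, β i, coeffAt P γ ≠ 0 → bad γ := by
    intro γ hγ h0
    simp only [Finset.mem_filter, Fintype.mem_piFinset, Finset.mem_range] at hγ
    obtain ⟨i, j, hij, hle⟩ := hno γ h0 (fun i => Nat.le_of_lt_succ (hγ.1 i)) hγ.2
    exact ⟨i, j, hij, hle⟩
  rw [← Finset.sum_filter_of_ne hgood]
  -- The first failure of interlacing is used so that the swap below leaves its position unchanged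
  -- and is an involution.
  have hfirst : ∀ γ, bad γ → ∃ i j : Fin N, (j : ℕ) = i + 1 ∧ γ i ≤ β j ∧
      ∀ i' j' : Fin N, (j' : ℕ) = i' + 1 → i' < i → β j' < γ i' := by
    intro γ hγ
    obtain ⟨i, hi, hmin⟩ := (Set.toFinite
      {i : Fin N | ∃ j : Fin N, (j : ℕ) = i + 1 ∧ γ i ≤ β j}).exists_minimal hγ
    obtain ⟨j, hij, hle⟩ := hi
    refine ⟨i, j, hij, hle, fun i' j' hij' hlt => ?_⟩
    by_contra hcon
    exact absurd (hmin (y := i') ⟨j', hij', not_lt.1 hcon⟩ hlt.le) (not_le.2 hlt)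
  rcases isEmpty_or_nonempty (Fin N) with hN | hN
  · exact Finset.sum_eq_zero fun γ hγ => hN.elim (Finset.mem_filter.1 hγ).2.choose
  choose! I J hJ hIJ hlt using hfirst
  have hfix : ∀ γ, bad γ → ∀ k, k < I γ → (γ ∘ Equiv.swap (I γ) (J γ)) k = γ k := by
    intro γ hb k hk
    have h1 := hJ γ hb
    rw [Function.comp_apply, Equiv.swap_apply_of_ne_of_ne hk.ne]
    intro h2
    rw [h2, Fin.lt_def] at hk
    omega
  have hIswap : ∀ γ, bad γ → (∀ i, γ i ≤ β i) → (γ ∘ Equiv.swap (I γ) (J γ)) (I γ) ≤ β (J γ) := by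
    intro γ hb hγ
    rw [Function.comp_apply, Equiv.swap_apply_left]
    exact hγ _
  have hbad' : ∀ γ, bad γ → (∀ i, γ i ≤ β i) → bad (γ ∘ Equiv.swap (I γ) (J γ)) := fun γ hb hγ =>
    ⟨I γ, J γ, hJ γ hb, hIswap γ hb hγ⟩
  have hI : ∀ γ, bad γ → (∀ i, γ i ≤ β i) → I (γ ∘ Equiv.swap (I γ) (J γ)) = I γ := by
    intro γ hb hγ
    set γ' := γ ∘ Equiv.swap (I γ) (J γ) with hγ'
    have hb' := hbad' γ hb hγ
    rcases lt_trichotomy (I γ') (I γ) with h1 | h1 | h1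
    · have h2 := hIJ γ' hb'
      rw [show γ' (I γ') = _ from hfix γ hb _ h1] at h2
      exact absurd h2 (not_le.2 (hlt γ hb _ _ (hJ γ' hb') h1))
    · exact h1
    · exact absurd (hIswap γ hb hγ) (not_le.2 (hlt γ' hb' _ _ (hJ γ hb) h1))
  have hJ' : ∀ γ, bad γ → (∀ i, γ i ≤ β i) → J (γ ∘ Equiv.swap (I γ) (J γ)) = J γ := by
    intro γ hb hγ
    ext
    rw [hJ _ (hbad' γ hb hγ), hI γ hb hγ, hJ γ hb]
  have hmem : ∀ γ, γ ∈ ((Fintype.piFinset fun i => Finset.range (β i + 1)).filter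
      fun γ => ∑ i, γ i + m = ∑ i, β i).filter bad ↔
        ((∀ i, γ i ≤ β i) ∧ ∑ i, γ i + m = ∑ i, β i) ∧ bad γ := fun γ => by
    simp only [Finset.mem_filter, Fintype.mem_piFinset, Finset.mem_range, Nat.lt_succ_iff]
  have hne : ∀ γ, bad γ → I γ ≠ J γ := fun γ hb h1 => by
    have := hJ γ hb
    rw [← h1] at this
    omega
  -- Exchanging the entries at the first failure i and at i + 1 negates the coefficient. Entries
  -- below β stay below β because γ i ≤ β (i + 1), and a fixed vector has two equal entries, hence
  -- coefficient zero.
  refine Finset.sum_involution (fun γ _ => γ ∘ Equiv.swap (I γ) (J γ)) ?_ ?_ ?_ ?_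
  · intro γ hγ
    rw [coeffAt_comp hP, Equiv.Perm.sign_swap (hne γ ((hmem γ).1 hγ).2)]
    simp
  · intro γ hγ h0 heq
    refine h0 (coeffAt_eq_zero hP (hne γ ((hmem γ).1 hγ).2) ?_)
    have := congrFun heq (I γ)
    rw [Function.comp_apply, Equiv.swap_apply_left] at this
    exact this.symm
  · intro γ hγ
    obtain ⟨⟨h1, h2⟩, h3⟩ := (hmem γ).1 hγ
    refine (hmem _).2 ⟨⟨fun i => ?_, ?_⟩, hbad' γ h3 h1⟩
    · rw [Function.comp_apply, Equiv.swap_apply_def]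
      split_ifs with h4 h5
      · rw [h4]
        refine (h1 _).trans (hβ ?_)
        rw [Fin.le_def, hJ γ h3]
        omega
      · rw [h5]
        exact hIJ γ h3
      · exact h1 i
    · rw [← h2]
      congr 1
      exact Equiv.sum_comp (Equiv.swap (I γ) (J γ)) γ
  · intro γ hγ
    obtain ⟨⟨h1, h2⟩, h3⟩ := (hmem γ).1 hγ
    simp only [hI γ h3 h1, hJ' γ h3 h1]
    funext k
    simp

theorem eq_staircase_of_coeffAt_vandermondePoly_ne_zero {β : Fin N → ℕ} (hβ : StrictAnti β)
    (h : coeffAt (vandermondePoly N) β ≠ 0) : β = staircase N := by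
  rw [coeffAt_vandermondePoly] at h
  obtain ⟨σ, -, hσ⟩ := Finset.exists_ne_zero_of_sum_ne_zero h
  have hσ' : staircase N ∘ σ = β := by
    by_contra hne
    exact hσ (if_neg hne)
  have hmono : StrictMono σ := by
    intro i j hij
    have := hβ hij
    rw [← hσ', Function.comp_apply, Function.comp_apply, staircase, staircase] at this
    rw [Fin.lt_def]
    omega
  have : (σ : Fin N → Fin N) = id := by
    have h1 : StrictMono (fun i => σ i) := hmono
    exact (StrictMono.range_inj hmono strictMono_id).1 (by
      rw [Set.range_id, σ.surjective.range_eq])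
  rw [← hσ', this, Function.comp_id]

/-- The leading term property of the product of a Vandermonde alternant and complete homogeneous
polynomials. -/
theorem sum_mul_le_of_coeffAt_prod_completePoly_ne_zero (μ : ℕ → ℕ) (k : ℕ) {β : Fin N → ℕ}
    (hβ : StrictAnti β)
    (h : coeffAt (vandermondePoly N * ∏ j ∈ Finset.range k, completePoly N (μ j)) β ≠ 0) :
    (∀ i : Fin N, k ≤ i → β i = staircase N i) ∧
      ∑ i : Fin N, i * β i ≤ ∑ i : Fin N, i * staircase N i + ∑ j ∈ Finset.range k, j * μ j := by
  induction k generalizing β with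
  | zero =>
    rw [Finset.prod_range_zero, mul_one] at h
    rw [eq_staircase_of_coeffAt_vandermondePoly_ne_zero hβ h]
    simp
  | succ k ih =>
    have hsymm : ∀ k, (∏ j ∈ Finset.range k, completePoly N (μ j)).IsSymmetric := fun k τ => by
      rw [map_prod]
      exact Finset.prod_congr rfl fun j _ => isSymmetric_completePoly _ τ
    rw [Finset.prod_range_succ, ← mul_assoc] at h
    obtain ⟨γ, hγ0, hγβ, hsum, hint⟩ := exists_interlacing_of_coeffAt_mul_completePoly
      (isAlternating_vandermondePoly.mul_isSymmetric (hsymm k)) hβ.antitone h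
    have hγ : StrictAnti γ := by
      intro i j hij
      rw [Fin.lt_def] at hij
      have hlt := hint i ⟨i + 1, by omega⟩ rfl
      refine lt_of_le_of_lt ((hγβ j).trans (hβ.antitone ?_)) hlt
      rw [Fin.le_def]
      exact hij
    obtain ⟨h1, h2⟩ := ih hγ hγ0
    -- Rows beyond k gain nothing at step k: interlacing with the untouched row above leaves no
    -- room.
    have h3 : ∀ i : Fin N, k + 1 ≤ i → β i = γ i := by
      intro i hi
      have h4 := hint ⟨i - 1, by omega⟩ i (by simp only; omega)
      rw [h1 _ (by simp only; omega)] at h4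
      have h5 := hγβ i
      rw [h1 i (by omega)] at h5 ⊢
      have := i.2
      simp only [staircase] at h4 h5 ⊢
      omega
    refine ⟨fun i hi => (h3 i hi).trans (h1 i (by omega)), ?_⟩
    rw [Finset.sum_range_succ]
    have h4 : ∑ i : Fin N, (i : ℕ) * β i ≤ ∑ i : Fin N, (i : ℕ) * γ i + k * μ k := by
      -- Each unit added at this step lies in a row of index at most k, so it raises the weighted
      -- sum by at most k.
      have h5 : ∀ i : Fin N, (i : ℕ) * β i + k * γ i ≤ i * γ i + k * β i := by
        intro i
        rcases Nat.lt_or_ge k i with hi | hi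
        · rw [h3 i hi]
        · have := Nat.mul_le_mul hi (le_refl (β i - γ i))
          have h6 := Nat.sub_add_cancel (hγβ i)
          rw [← h6]
          nlinarith
      have h6 := Finset.sum_le_sum fun i (_ : i ∈ Finset.univ) => h5 i
      rw [Finset.sum_add_distrib, Finset.sum_add_distrib, ← Finset.mul_sum, ← Finset.mul_sum,
        ← hsum] at h6
      nlinarith
    omega

end Alternants

/-! ### Frobenius' character formula -/

section Frobenius

open MonoidAlgebra

variable {n N : ℕ} {lam mu : YoungDiagram}

/-- The number of labels of each colour. -/
abbrev content (F : Fin n → Fin N) : Fin N → ℕ := jointContent (fun _ => ()) F ()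

theorem content_apply (F : Fin n → Fin N) (i : Fin N) :
    content F i = (Finset.univ.filter fun a => F a = i).card := by
  simp [content, jointContent]

theorem prod_X_eq_prod_content (F : Fin n → Fin N) :
    ∏ a, (MvPolynomial.X (F a) : MvPolynomial (Fin N) ℤ) = ∏ i, MvPolynomial.X i ^ content F i := by
  rw [prod_X_eq_prod_jointContent (fun _ => ()) F]
  simp

theorem sum_eq_sum_mul_content (F : Fin n → Fin N) :
    ∑ a, (F a : ℕ) = ∑ i : Fin N, i * content F i := by
  rw [← Finset.sum_fiberwise (s := Finset.univ) (g := F)]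
  refine Finset.sum_congr rfl fun i _ => ?_
  rw [Finset.sum_congr rfl fun a ha => congrArg Fin.val (Finset.mem_filter.1 ha).2,
    Finset.sum_const, smul_eq_mul, content_apply, mul_comm]

/-- The rearrangement inequality, in the exact form that the excess is half of Σ (i - σ i)²; this
also gives the equality case. -/
theorem sum_mul_staircase_le (σ : Equiv.Perm (Fin N)) :
    ∑ i : Fin N, i * staircase N i ≤ ∑ i : Fin N, i * staircase N (σ i) ∧
      (∑ i : Fin N, i * staircase N (σ i) = ∑ i : Fin N, i * staircase N i → σ = 1) := by
  have h1 : ∀ i j : Fin N, ((i * staircase N j : ℕ) : ℤ) = i * (N - 1) - i * j := by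
    intro i j
    have := j.2
    rw [staircase, Nat.cast_mul, Nat.cast_sub (by omega), Nat.cast_sub (by omega)]
    push_cast
    ring
  have h2 : ∑ i : Fin N, (((i : ℕ) : ℤ) - ((σ i : ℕ) : ℤ)) ^ 2 =
      2 * (((∑ i : Fin N, i * staircase N (σ i) : ℕ) : ℤ) - ((∑ i : Fin N, i * staircase N i : ℕ) : ℤ)) := by
    rw [Nat.cast_sum, Nat.cast_sum]
    simp only [h1, Finset.sum_sub_distrib]
    have h3 : ∑ i : Fin N, ((σ i : ℕ) : ℤ) ^ 2 = ∑ i : Fin N, ((i : ℕ) : ℤ) ^ 2 :=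
      Equiv.sum_comp σ fun i : Fin N => ((i : ℕ) : ℤ) ^ 2
    simp only [sub_sq, Finset.sum_add_distrib, Finset.sum_sub_distrib, h3, mul_assoc,
      ← Finset.mul_sum]
    simp only [sq]
    ring
  constructor
  · have := Finset.sum_nonneg fun (i : Fin N) (_ : i ∈ Finset.univ) =>
      sq_nonneg (((i : ℕ) : ℤ) - ((σ i : ℕ) : ℤ))
    zify
    push_cast at h2
    linarith
  · intro h
    rw [h, sub_self, mul_zero, Finset.sum_eq_zero_iff_of_nonneg fun i _ => sq_nonneg _] at h2
    ext i
    have := pow_eq_zero_iff (two_ne_zero) |>.1 (h2 i (Finset.mem_univ i))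
    rw [Equiv.Perm.one_apply]
    lia

/-- The strictly decreasing sequence attached to a diagram. -/
def shiftedRows (N : ℕ) (lam : YoungDiagram) (i : Fin N) : ℕ := lam.rowLen i + staircase N i

theorem shiftedRows_strictAnti : StrictAnti (shiftedRows N lam) := by
  intro i j hij
  have := lam.rowLen_anti _ _ (Fin.le_def.1 hij.le)
  rw [Fin.lt_def] at hij
  have := j.2
  simp only [shiftedRows, staircase]
  omega

/-- The class function defined by Frobenius' formula. -/
def frobeniusClass (N : ℕ) (lam : YoungDiagram) (g : Equiv.Perm (Fin n)) : ℂ :=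
  (coeffAt (vandermondePoly N * fixPoly N g) (shiftedRows N lam) : ℤ)

theorem frobeniusClass_conj (g h : Equiv.Perm (Fin n)) :
    frobeniusClass N lam (h * g * h⁻¹) = frobeniusClass N lam g := by
  rw [frobeniusClass, fixPoly_conj, frobeniusClass]

theorem coeffAt_vandermondePoly_mul_fixPoly (g : Equiv.Perm (Fin n)) (β : Fin N → ℕ) :
    coeffAt (vandermondePoly N * fixPoly N g) β =
      ∑ σ : Equiv.Perm (Fin N), ∑ F : Fin n → Fin N with staircase N ∘ σ + content F = β,
        if ∀ a, F (g a) = F a then (Equiv.Perm.sign σ : ℤ) else 0 := by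
  rw [vandermondePoly, Finset.sum_mul, coeffAt_sum]
  refine Finset.sum_congr rfl fun σ _ => ?_
  rw [fixPoly, Finset.mul_sum, coeffAt_sum, Finset.sum_filter, Finset.sum_filter]
  refine Finset.sum_congr rfl fun F _ => ?_
  by_cases hF : ∀ a, F (g a) = F a
  swap
  · simp [hF]
  rw [if_pos hF, if_pos hF]
  have h := coeffAt_prod_X_pow (N := N) (staircase N ∘ σ + content F) β
  rw [prod_X_eq_prod_content, smul_mul_assoc, ← Finset.prod_mul_distrib, coeffAt,
    MvPolynomial.coeff_smul, ← coeffAt]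
  simp only [← pow_add]
  simp only [Pi.add_apply, Function.comp_apply] at h
  rw [h]
  split_ifs <;> simp

/-- Expanding the alternant writes the Frobenius class function as a signed sum over colourings, the
analogue of the Jacobi–Trudi determinant. Each term then needs only the sum of φ over a colour
stabilizer. -/
theorem sum_frobeniusClass_mul (N : ℕ) (lam : YoungDiagram) (φ : Equiv.Perm (Fin n) → ℂ) :
    ∑ g, frobeniusClass N lam g * φ g =
      ∑ σ : Equiv.Perm (Fin N), ∑ F : Fin n → Fin N with
        staircase N ∘ σ + content F = shiftedRows N lam,
        ((Equiv.Perm.sign σ : ℤ) : ℂ) * ∑ g ∈ colorStabilizer (fun a => (F a : ℕ)), φ g := by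
  simp only [frobeniusClass, coeffAt_vandermondePoly_mul_fixPoly, Int.cast_sum, Finset.sum_mul]
  rw [Finset.sum_comm]
  refine Finset.sum_congr rfl fun σ _ => ?_
  rw [Finset.sum_comm]
  refine Finset.sum_congr rfl fun F _ => ?_
  rw [Finset.mul_sum, colorStabilizer, Finset.sum_filter]
  refine Finset.sum_congr rfl fun g _ => ?_
  simp only [Fin.ext_iff]
  split_ifs <;> simp

/-- The colouring of the labels by rows. -/
def rowColor (T : Tableau n lam) (h : lam.colLen 0 ≤ N) (a : Fin n) : Fin N :=
  ⟨(T a).1.1, lt_of_lt_of_le (YoungDiagram.mem_iff_lt_colLen.1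
    (lam.up_left_mem le_rfl (Nat.zero_le _) ((YoungDiagram.mem_cells _).1 (T a).2))) h⟩

theorem content_rowColor (T : Tableau n lam) (h : lam.colLen 0 ≤ N) (i : Fin N) :
    content (rowColor T h) i = lam.rowLen i := by
  rw [content_apply, ← card_filter_row_eq T]
  simp [rowColor, Fin.ext_iff]

theorem rowStat_eq_sum (T : Tableau n lam) (h : lam.colLen 0 ≤ N) :
    rowStat lam = ∑ i : Fin N, i * lam.rowLen i := by
  rw [← sum_row_eq_rowStat T]
  refine (sum_eq_sum_mul_content (rowColor T h)).trans ?_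
  simp only [content_rowColor]

/-- The content of F is λ + δ - σδ, so its weighted sum falls short of `rowStat lam` by the excess
in the rearrangement inequality for σ. -/
theorem sum_le_rowStat (T : Tableau n lam) (h : lam.colLen 0 ≤ N) {σ : Equiv.Perm (Fin N)}
    {F : Fin n → Fin N} (hF : staircase N ∘ σ + content F = shiftedRows N lam) :
    ∑ a, (F a : ℕ) ≤ rowStat lam ∧ (∑ a, (F a : ℕ) = rowStat lam → σ = 1) := by
  have h1 := sum_mul_staircase_le σ
  have h2 : ∑ i : Fin N, i * staircase N (σ i) + ∑ i : Fin N, i * content F i =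
      rowStat lam + ∑ i : Fin N, i * staircase N i := by
    rw [rowStat_eq_sum T h, ← Finset.sum_add_distrib, ← Finset.sum_add_distrib]
    refine Finset.sum_congr rfl fun i _ => ?_
    rw [← mul_add, ← mul_add]
    exact congrArg _ (congrFun hF i)
  rw [← sum_eq_sum_mul_content] at h2
  refine ⟨by omega, fun h3 => h1.2 (by omega)⟩

theorem sum_stabilizer_spechtCharacter_eq_zero (S : Tableau n mu) {F : Fin n → ℕ}
    (h : ∑ a, F a ≤ rowStat mu)
    (hne : ∑ a, F a = rowStat mu → ∀ k q : Equiv.Perm (Fin n), ¬ ∀ i, F (k i) = (S (q i)).1.1) :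
    ∑ g ∈ colorStabilizer F, spechtCharacter S g = 0 := by
  refine sum_colorStabilizer_spechtCharacter_eq_zero S F fun k => ?_
  by_contra hk
  obtain ⟨h1, h2⟩ := columnAntisymmetrizer_mul_of_mul_colorSymmetrizer S F k hk
  obtain ⟨q, -, hq⟩ := h2 (le_antisymm h1 h)
  exact hne (le_antisymm h h1) k⁻¹ q hq

theorem charInner_spechtCharacter_right (φ : Equiv.Perm (Fin n) → ℂ) (S : Tableau n mu) :
    charInner φ (spechtCharacter S) =
      (Nat.card (Equiv.Perm (Fin n)) : ℂ)⁻¹ * ∑ g, φ g * spechtCharacter S g := by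
  simp only [charInner, spechtCharacter_inv]

theorem sum_row_stabilizer_eq_zero (T : Tableau n lam) (S : Tableau n mu)
    (hle : rowStat lam ≤ rowStat mu) (hne : lam ≠ mu) :
    ∑ g ∈ colorStabilizer (fun a => (T a).1.1), spechtCharacter S g = 0 := by
  refine sum_stabilizer_spechtCharacter_eq_zero S ((sum_row_eq_rowStat T).trans_le hle)
    fun _ k q h => hne ?_
  exact (eq_of_row_comp_eq S T k q h).symm

/-- A surviving term must have weighted sum equal to both row statistics. Then σ = 1, F has content
λ, and F is a rearrangement of the rows of S, so λ = μ. -/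
theorem charInner_frobeniusClass_eq_zero_of_le (T : Tableau n lam) (S : Tableau n mu)
    (hN : lam.colLen 0 ≤ N) (hle : rowStat lam ≤ rowStat mu) (hne : lam ≠ mu) :
    charInner (frobeniusClass N lam) (spechtCharacter S) = 0 := by
  rw [charInner_spechtCharacter_right, sum_frobeniusClass_mul]
  refine mul_eq_zero_of_right _ (Finset.sum_eq_zero fun σ _ => Finset.sum_eq_zero fun F hF => ?_)
  have hF' := (Finset.mem_filter.1 hF).2
  obtain ⟨h1, h2⟩ := sum_le_rowStat T hN hF'
  rw [sum_stabilizer_spechtCharacter_eq_zero S (h1.trans hle), mul_zero]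
  intro h3 k q hq
  have hσ := h2 (le_antisymm h1 (hle.trans h3.ge))
  subst hσ
  have hcont : jointContent (fun _ => ()) F = jointContent (fun _ => ()) (rowColor T hN) := by
    funext _ i
    have := congrFun hF' i
    rw [← content, ← content, content_rowColor T hN]
    simp only [Pi.add_apply, Function.comp_apply, Equiv.Perm.one_apply, shiftedRows] at this
    omega
  obtain ⟨τ, -, hτ⟩ := exists_perm_of_jointContent_eq hcont
  refine hne (eq_of_row_comp_eq S T (τ * k) q fun i => ?_).symm
  rw [← hq, ← hτ]
  rfl

/-- Only σ = 1 survives. The remaining colourings form one orbit, that of the colouring by rows, and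
each contributes the order of its stabilizer, for a total of n!. -/
theorem charInner_frobeniusClass_self (T : Tableau n lam) (hN : lam.colLen 0 ≤ N) :
    charInner (frobeniusClass N lam) (spechtCharacter T) = 1 := by
  rw [charInner_spechtCharacter_right, sum_frobeniusClass_mul, Finset.sum_eq_single 1]
  · have hcond : ∀ F : Fin n → Fin N, staircase N ∘ (1 : Equiv.Perm (Fin N)) + content F =
        shiftedRows N lam ↔
        jointContent (fun _ => ()) F = jointContent (fun _ => ()) (rowColor T hN) := by
      intro F
      constructor
      · intro h
        funext _ i
        have := congrFun h i
        rw [← content, ← content, content_rowColor T hN]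
        simp only [Pi.add_apply, Function.comp_apply, Equiv.Perm.one_apply, shiftedRows] at this
        omega
      · intro h
        funext i
        rw [Pi.add_apply, content, h, ← content, content_rowColor, shiftedRows, add_comm]
        rfl
    simp only [hcond]
    have hF : ∀ F ∈ Finset.univ.filter (fun F : Fin n → Fin N =>
        jointContent (fun _ => ()) F = jointContent (fun _ => ()) (rowColor T hN)),
        (((Equiv.Perm.sign (1 : Equiv.Perm (Fin N)) : ℤ) : ℂ) *
          ∑ g ∈ colorStabilizer (fun a => (F a : ℕ)), spechtCharacter T g) =
        ((Finset.univ.filter fun σ : Equiv.Perm (Fin n) =>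
          (∀ _ : Fin n, () = ()) ∧ ∀ a, F (σ a) = F a).card : ℂ) := by
      intro F hF
      obtain ⟨τ, -, hτ⟩ := exists_perm_of_jointContent_eq (Finset.mem_filter.1 hF).2
      have hτ' : ∀ a, (T (τ a)).1.1 = (F a : ℕ) := fun a => congrArg Fin.val (hτ a)
      have h1 : ∑ g ∈ colorStabilizer (fun a => (F a : ℕ)), spechtCharacter T g =
          ∑ g ∈ colorStabilizer (fun a => (T a).1.1), spechtCharacter T g := by
        refine Finset.sum_equiv (MulAut.conj τ).toEquiv (fun g => ?_) fun g _ => ?_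
        · simp only [mem_colorStabilizer, ← hτ']
          constructor
          · intro h a
            have := h (τ⁻¹ a)
            simpa using this
          · intro h a
            have := h (τ a)
            simpa using this
        · exact (spechtCharacter_conj T g τ).symm
      have h2 : (colorStabilizer fun a => (T a).1.1).card =
          (colorStabilizer fun a => (F a : ℕ)).card := by
        refine (Finset.card_equiv (MulAut.conj τ).toEquiv fun g => ?_).symm
        simp only [mem_colorStabilizer, ← hτ']
        constructor
        · intro h a
          have := h (τ⁻¹ a)
          simpa using this
        · intro h a
          have := h (τ a)
          simpa using this
      rw [h1, sum_colorStabilizer_row_spechtCharacter, h2]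
      simp only [colorStabilizer, map_one, Units.val_one, Int.cast_one, one_mul, Fin.ext_iff,
        implies_true, true_and]
    rw [Finset.sum_congr rfl hF, ← Nat.cast_sum]
    have hsum := sum_card_stabilizer_of_jointContent (fun _ : Fin n => ())
      (jointContent (fun _ => ()) (rowColor T hN)) fun _ => ?_
    · have e : ∀ k m : ℕ, m ≠ 0 → k = m → (m : ℂ)⁻¹ * k = 1 := by
        rintro k m hm rfl
        exact inv_mul_cancel₀ (Nat.cast_ne_zero.2 hm)
      refine e _ _ Nat.card_pos.ne' ?_
      have : (Finset.univ.filter fun σ : Equiv.Perm (Fin n) => ∀ _ : Fin n, () = ()).card =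
          Nat.card (Equiv.Perm (Fin n)) := by
        simp
      rw [← this]
      convert hsum
    · simp only [jointContent, true_and, Finset.filter_true]
      exact (Finset.card_eq_sum_card_fiberwise fun a _ => Finset.mem_univ _).symm
  · intro σ _ hσ
    refine Finset.sum_eq_zero fun F hF => ?_
    obtain ⟨h1, h2⟩ := sum_le_rowStat T hN (Finset.mem_filter.1 hF).2
    rw [sum_stabilizer_spechtCharacter_eq_zero T h1 fun h3 => absurd (h2 h3) hσ, mul_zero]
  · simp

/-- The sum is a multiple of the coefficient at λ + δ of the alternant times the product of the
complete polynomials of the rows of μ. Pieri's rule makes this zero when μ has the smaller row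
statistic. -/
theorem sum_row_stabilizer_frobeniusClass (T : Tableau n lam) (S : Tableau n mu)
    (hN : lam.colLen 0 ≤ N) (hlt : rowStat mu < rowStat lam) :
    ∑ g ∈ colorStabilizer (fun a => (S a).1.1), (frobeniusClass N lam g : ℂ) = 0 := by
  set M := mu.colLen 0
  have h1 : colorStabilizer (fun a => (S a).1.1) = Finset.univ.filter fun σ : Equiv.Perm (Fin n) =>
      ∀ a, rowColor S (le_refl M) (σ a) = rowColor S (le_refl M) a := by
    simp only [colorStabilizer, rowColor, Fin.ext_iff]
  have h2 : ∑ g ∈ colorStabilizer (fun a => (S a).1.1),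
      coeffAt (vandermondePoly N * fixPoly N g) (shiftedRows N lam) = 0 := by
    rw [h1, ← coeffAt_sum, ← Finset.mul_sum, show ∑ σ : Equiv.Perm (Fin n) with
      ∀ a, rowColor S (le_refl M) (σ a) = rowColor S (le_refl M) a, fixPoly N σ = _ from
        (Finset.sum_congr (by congr!) fun _ _ => rfl).trans
          (sum_fixPoly_stabilizer (N := N) (rowColor S (le_refl M))), mul_smul_comm, coeffAt,
      MvPolynomial.coeff_smul, ← coeffAt]
    refine smul_eq_zero_of_right _ ?_
    have h3 : ∀ j : Fin M, (Finset.univ.filter fun a => rowColor S (le_refl M) a = j).card =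
        mu.rowLen j := fun j => by rw [← content_rowColor S (le_refl M), content_apply]
    simp only [h3]
    rw [Fin.prod_univ_eq_prod_range (fun j => completePoly N (mu.rowLen j)) M]
    by_contra h0
    have h4 := (sum_mul_le_of_coeffAt_prod_completePoly_ne_zero mu.rowLen M
      shiftedRows_strictAnti h0).2
    have h5 := rowStat_eq_sum T hN
    have h6 := rowStat_eq_sum S (le_refl M)
    rw [Fin.sum_univ_eq_sum_range (fun j => j * mu.rowLen j) M] at h6
    simp only [shiftedRows, mul_add, Finset.sum_add_distrib] at h4
    omega
  simp only [frobeniusClass]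
  rw [← Int.cast_sum, h2, Int.cast_zero]

theorem exists_partitionDiagram_eq (T : Tableau n lam) :
    ∃ μ : n.Partition, partitionDiagram μ = lam := by
  refine ⟨⟨lam.rowLens, fun {i} hi => lam.pos_of_mem_rowLens i (Multiset.mem_coe.1 hi), ?_⟩, ?_⟩
  · rw [Multiset.sum_coe, ← card_eq_sum_rowLens, T.card_eq]
  · have h : ((lam.rowLens : Multiset ℕ)).sort (· ≥ ·) = lam.rowLens := by
      rw [Multiset.coe_sort]
      exact List.mergeSort_eq_self _ lam.rowLens_sorted.pairwise
    refine Eq.trans ?_ (YoungDiagram.ofRowLens_to_rowLens_eq_self (μ := lam))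
    simp only [partitionDiagram, h]

theorem charInner_sum_left {G ι : Type*} [Group G] [Fintype G] (s : Finset ι) (φ : ι → G → ℂ)
    (ψ : G → ℂ) : charInner (∑ i ∈ s, φ i) ψ = ∑ i ∈ s, charInner (φ i) ψ := by
  classical
  induction s using Finset.induction_on with
  | empty => simp [charInner]
  | insert a s ha ih => rw [Finset.sum_insert ha, Finset.sum_insert ha, charInner_add_left, ih]

/-- The expansion of a class function in Specht characters. -/
theorem eq_sum_charInner_smul {φ : Equiv.Perm (Fin n) → ℂ}
    (hφ : ∀ g h, φ (h * g * h⁻¹) = φ g) (T : ∀ μ : n.Partition, Tableau n (partitionDiagram μ)) :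
    φ = ∑ μ, charInner φ (spechtCharacter (T μ)) • spechtCharacter (T μ) := by
  rw [← sub_eq_zero]
  refine eq_zero_of_charInner_spechtCharacter_eq_zero (fun g h => ?_) fun lam ⟨S⟩ => ?_
  · simp only [Pi.sub_apply, Finset.sum_apply, Pi.smul_apply, hφ, spechtCharacter_conj]
  · obtain ⟨μ, rfl⟩ := exists_partitionDiagram_eq S
    refine ⟨T μ, ?_⟩
    rw [sub_eq_add_neg, ← neg_one_smul ℂ, charInner_add_left, charInner_smul_left,
      charInner_sum_left, Finset.sum_eq_single μ]
    · rw [charInner_smul_left, charInner_spechtCharacter_self]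
      ring
    · intro ν _ hν
      rw [charInner_smul_left, charInner_spechtCharacter_of_ne, mul_zero]
      exact fun h => hν (partitionDiagram_injective h)
    · simp

/-- Frobenius' character formula. -/
theorem spechtCharacter_eq_frobeniusClass (T : Tableau n lam) (hN : lam.colLen 0 ≤ N) :
    spechtCharacter T = frobeniusClass N lam := by
  have hT : ∀ μ : n.Partition, Nonempty (Tableau n (partitionDiagram μ)) :=
    fun μ => nonempty_tableau (sum_rowLens_partitionDiagram μ)
  let U := fun μ => (hT μ).some
  -- Induction on the row statistic of μ: in the sum over the row group of μ, smaller shapes have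
  -- coefficient zero by induction and the other shapes sum to zero, so only the coefficient of μ
  -- remains.
  have hlow : ∀ k, ∀ μ : n.Partition, rowStat (partitionDiagram μ) = k → k < rowStat lam →
      charInner (frobeniusClass N lam) (spechtCharacter (U μ)) = 0 := by
    intro k
    induction k using Nat.strong_induction_on with
    | _ k ih =>
      intro μ hμ hk
      have h1 := sum_row_stabilizer_frobeniusClass T (U μ) hN (hμ ▸ hk)
      rw [eq_sum_charInner_smul frobeniusClass_conj U] at h1
      simp only [Finset.sum_apply, Pi.smul_apply, smul_eq_mul] at h1
      rw [Finset.sum_comm, Finset.sum_eq_single μ, ← Finset.mul_sum,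
        sum_colorStabilizer_row_spechtCharacter] at h1
      · refine (mul_eq_zero.1 h1).resolve_right (Nat.cast_ne_zero.2 ?_)
        exact Finset.card_ne_zero_of_mem
          (mem_colorStabilizer.2 fun _ => rfl : (1 : Equiv.Perm (Fin n)) ∈ _)
      · intro ν _ hν
        rw [← Finset.mul_sum]
        rcases lt_or_ge (rowStat (partitionDiagram ν)) k with hlt | hge
        · rw [ih _ hlt ν rfl (hlt.trans hk), zero_mul]
        · rw [sum_row_stabilizer_eq_zero _ _ (hμ.trans_le hge), mul_zero]
          exact fun h => hν (partitionDiagram_injective h).symm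
      · simp
  refine (sub_eq_zero.1 ?_).symm
  refine eq_zero_of_charInner_spechtCharacter_eq_zero (fun g h => ?_) fun mu ⟨S⟩ => ?_
  · simp only [Pi.sub_apply, frobeniusClass_conj, spechtCharacter_conj]
  · by_cases hmu : lam = mu
    · subst hmu
      refine ⟨T, ?_⟩
      rw [sub_eq_add_neg, ← neg_one_smul ℂ, charInner_add_left, charInner_smul_left,
        charInner_frobeniusClass_self T hN, charInner_spechtCharacter_self]
      ring
    · obtain ⟨μ, rfl⟩ := exists_partitionDiagram_eq S
      refine ⟨U μ, ?_⟩
      rw [sub_eq_add_neg, ← neg_one_smul ℂ, charInner_add_left, charInner_smul_left,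
        charInner_spechtCharacter_of_ne T _ hmu]
      rcases lt_or_ge (rowStat (partitionDiagram μ)) (rowStat lam) with hlt | hge
      · rw [hlow _ μ rfl hlt]
        ring
      · rw [charInner_frobeniusClass_eq_zero_of_le T _ hN hge hmu]
        ring

end Frobenius

/-! ### The Murnaghan–Nakayama recursion -/

/-- The sign of the permutation sorting `l` into `N - 1, …, 1, 0`, or `0` if there is none. -/
def sortSign : ℕ → List ℕ → ℤ
  | 0, _ => 1
  | N + 1, l => ((List.range (N + 1)).map fun i =>
      if l.getD i 0 = N then (-1) ^ i * sortSign N (l.eraseIdx i) else 0).sum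

/-- The Murnaghan–Nakayama recursion on beta-sequences. -/
def mnVal : List ℕ → List ℕ → ℤ
  | [], b => sortSign b.length b
  | r :: μ, b => ((List.range b.length).map fun i =>
      if r ≤ b.getD i 0 ∧ b.getD i 0 - r ∉ b then mnVal μ (b.set i (b.getD i 0 - r)) else 0).sum

/-- The beta-sequence of a partition. -/
def betaList : List ℕ → List ℕ
  | [] => []
  | x :: l => (x + l.length) :: betaList l

section MurnaghanNakayama

open MvPolynomial

variable {n N : ℕ} {lam : YoungDiagram}

/-! ### Exponent vectors as lists, and the recursion for power sums -/

theorem sum_map_range_eq_sum_fin (f : ℕ → ℤ) (N : ℕ) :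
    ((List.range N).map f).sum = ∑ i : Fin N, f i := by
  rw [Fin.sum_univ_eq_sum_range]
  rfl

theorem getD_ofFn (β : Fin N → ℕ) (i : Fin N) : (List.ofFn β).getD i 0 = β i := by
  simp [List.getD_eq_getElem?_getD]

theorem eraseIdx_ofFn (β : Fin (N + 1) → ℕ) (i : Fin (N + 1)) :
    (List.ofFn β).eraseIdx i = List.ofFn (β ∘ i.succAbove) := by
  refine List.ext_getElem ?_ fun k h1 h2 => ?_
  · rw [List.length_eraseIdx_of_lt (by rw [List.length_ofFn]; exact i.2)]
    simp
  · rw [List.getElem_eraseIdx]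
    have hk : k < N := by simpa using h2
    simp only [List.getElem_ofFn, Function.comp_apply, Fin.succAbove, Fin.lt_def]
    split_ifs <;> simp_all

theorem set_ofFn (β : Fin N → ℕ) (i : Fin N) (x : ℕ) :
    (List.ofFn β).set i x = List.ofFn (Function.update β i x) := by
  refine List.ext_getElem (by simp) fun k h1 h2 => ?_
  have hk : k < N := by simpa using h2
  rw [List.getElem_set]
  simp only [List.getElem_ofFn, Function.update_apply, Fin.ext_iff, eq_comm]

theorem coeffAt_vandermondePoly_eq_det (β : Fin N → ℕ) :
    coeffAt (vandermondePoly N) β =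
      (Matrix.of fun i j : Fin N => if β i = staircase N j then (1 : ℤ) else 0).det := by
  rw [coeffAt_vandermondePoly, ← Matrix.det_transpose, Matrix.det_apply']
  refine Finset.sum_congr rfl fun σ _ => ?_
  simp only [Matrix.transpose_apply, Matrix.of_apply]
  split_ifs with h
  · rw [Finset.prod_eq_one, mul_one, Int.cast_id]
    intro i _
    rw [if_pos]
    exact (congrFun h i).symm
  · have : ∃ i, β i ≠ staircase N (σ i) := by
      by_contra hcon
      push Not at hcon
      exact h (funext fun i => (hcon i).symm)
    obtain ⟨i, hi⟩ := this
    rw [Finset.prod_eq_zero (Finset.mem_univ i) (if_neg hi), mul_zero]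

/-- The coefficient is the determinant of a 0-1 matrix, and `sortSign` is its expansion along the
first column. -/
theorem coeffAt_vandermondePoly_eq_sortSign (β : Fin N → ℕ) :
    coeffAt (vandermondePoly N) β = sortSign N (List.ofFn β) := by
  rw [coeffAt_vandermondePoly_eq_det]
  induction N with
  | zero => simp [sortSign]
  | succ N ih =>
    rw [Matrix.det_succ_column_zero, sortSign, sum_map_range_eq_sum_fin]
    refine Finset.sum_congr rfl fun i _ => ?_
    rw [getD_ofFn, eraseIdx_ofFn, ← ih, Matrix.of_apply]
    have h0 : staircase (N + 1) 0 = N := by simp [staircase]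
    rw [h0, mul_assoc, ite_mul, one_mul, zero_mul, mul_ite, mul_zero]
    refine if_congr Iff.rfl ?_ rfl
    congr 2
    ext j k
    simp only [Matrix.submatrix_apply, Matrix.of_apply, Function.comp_apply]
    have : staircase (N + 1) k.succ = staircase N k := by
      simp only [staircase, Fin.val_succ]
      omega
    rw [this]

theorem coeffAt_mul_psum (P : MvPolynomial (Fin N) ℤ) (r : ℕ) (β : Fin N → ℕ) :
    coeffAt (P * psum (Fin N) ℤ r) β =
      ∑ i, if r ≤ β i then coeffAt P (Function.update β i (β i - r)) else 0 := by
  rw [psum, Finset.mul_sum, coeffAt_sum]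
  refine Finset.sum_congr rfl fun i _ => ?_
  have h : (X i ^ r : MvPolynomial (Fin N) ℤ) = ∏ j, X j ^ (Pi.single i r : Fin N → ℕ) j := by
    rw [Finset.prod_eq_single i]
    · simp
    · intro j _ hj
      simp [hj]
    · simp
  rw [h, coeffAt_mul_prod_X_pow]
  classical
  have hle : (Pi.single i r : Fin N → ℕ) ≤ β ↔ r ≤ β i := by
    constructor
    · intro hh
      simpa using hh i
    · intro hh j
      rcases eq_or_ne j i with rfl | hj
      · simpa using hh
      · simp [hj]
  rw [if_congr hle rfl rfl]
  refine if_congr Iff.rfl (congrArg _ ?_) rfl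
  funext j
  rcases eq_or_ne j i with rfl | hj
  · simp
  · simp [hj]

/-- A power sum p_r lowers one exponent by r. The exponents are never sorted along the way, so the
usual leg-length signs are all collected by `sortSign` at the end. -/
theorem coeffAt_vandermondePoly_mul_prod_psum (l : List ℕ) (hl : ∀ r ∈ l, 0 < r)
    (β : Fin N → ℕ) :
    coeffAt (vandermondePoly N * (l.map (psum (Fin N) ℤ)).prod) β = mnVal l (List.ofFn β) := by
  induction l generalizing β with
  | nil =>
    rw [List.map_nil, List.prod_nil, mul_one, coeffAt_vandermondePoly_eq_sortSign, mnVal,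
      List.length_ofFn]
  | cons r l ih =>
    have hr := hl r List.mem_cons_self
    have hsymm : ((l.map (psum (Fin N) ℤ)).prod).IsSymmetric := fun τ => by
      rw [map_list_prod, List.map_map]
      refine congrArg List.prod (List.map_congr_left fun r _ => ?_)
      exact psum_isSymmetric _ _ _ τ
    rw [List.map_cons, List.prod_cons, mul_comm (psum _ _ _), ← mul_assoc, coeffAt_mul_psum, mnVal,
      List.length_ofFn, sum_map_range_eq_sum_fin]
    refine Finset.sum_congr rfl fun i _ => ?_
    rw [getD_ofFn, set_ofFn, ← ih fun r hr => hl r (List.mem_cons_of_mem _ hr)]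
    by_cases h1 : r ≤ β i
    · by_cases h2 : β i - r ∈ List.ofFn β
      · rw [if_pos h1, if_neg fun h => h.2 h2]
        -- The lowered exponent coincides with another one, so the alternating coefficient vanishes.
        -- Here r > 0 is needed to have j ≠ i.
        obtain ⟨j, hj⟩ := (List.mem_ofFn).1 h2
        have hij : j ≠ i := by
          rintro rfl
          omega
        refine coeffAt_eq_zero (isAlternating_vandermondePoly.mul_isSymmetric hsymm) hij ?_
        simp [hij, hj]
      · rw [if_pos h1, if_pos ⟨h1, h2⟩]
    · rw [if_neg h1, if_neg fun h => h1 h.1]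

theorem length_betaList (l : List ℕ) : (betaList l).length = l.length := by
  induction l with
  | nil => rfl
  | cons x l ih => simp [betaList, ih]

theorem getElem_betaList (l : List ℕ) (i : ℕ) (h : i < (betaList l).length) :
    (betaList l)[i] = l[i]'(length_betaList l ▸ h) + (l.length - 1 - i) := by
  induction l generalizing i with
  | nil => simp [betaList] at h
  | cons x l ih =>
    cases i with
    | zero => simp [betaList]
    | succ i =>
      simp only [betaList, List.getElem_cons_succ, List.length_cons]
      rw [ih]
      omega

theorem ofFn_shiftedRows (lam : YoungDiagram) :
    List.ofFn (shiftedRows (lam.colLen 0) lam) = betaList lam.rowLens := by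
  refine List.ext_getElem ?_ fun k h1 h2 => ?_
  · rw [length_betaList, List.length_ofFn, YoungDiagram.length_rowLens]
  · rw [getElem_betaList]
    simp [shiftedRows, staircase]

/-- The cycles of a permutation, with its fixed points as trivial cycles. -/
abbrev CycleIndex (g : Equiv.Perm (Fin n)) : Type :=
  {c // c ∈ g.cycleFactorsFinset} ⊕ {a // g a = a}

/-- The cycle containing a label. -/
def cycleIndex (g : Equiv.Perm (Fin n)) (a : Fin n) : CycleIndex g :=
  if h : g a = a then Sum.inr ⟨a, h⟩
  else Sum.inl ⟨g.cycleOf a, Equiv.Perm.cycleOf_mem_cycleFactorsFinset_iff.2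
    (Equiv.Perm.mem_support.2 h)⟩

theorem cycleIndex_eq_inr {g : Equiv.Perm (Fin n)} {a : Fin n} {b : {a // g a = a}} :
    cycleIndex g a = Sum.inr b ↔ a = b.1 := by
  rw [cycleIndex]
  split_ifs with h
  · rw [Sum.inr.injEq, Subtype.ext_iff]
  · simp only [false_iff]
    rintro rfl
    exact h b.2

theorem cycleIndex_eq_inl {g : Equiv.Perm (Fin n)} {a : Fin n}
    {c : {c // c ∈ g.cycleFactorsFinset}} :
    cycleIndex g a = Sum.inl c ↔ a ∈ c.1.support := by
  rw [cycleIndex]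
  split_ifs with h
  · simp only [false_iff]
    intro ha
    exact Equiv.Perm.mem_support.1 (Equiv.Perm.mem_cycleFactorsFinset_support_le c.2 ha) h
  · rw [Sum.inl.injEq, Subtype.ext_iff]
    constructor
    · intro hc
      change g.cycleOf a = c.1 at hc
      rw [← hc, Equiv.Perm.mem_support_cycleOf_iff]
      exact ⟨Equiv.Perm.SameCycle.refl g a, Equiv.Perm.mem_support.2 h⟩
    · intro ha
      exact (Equiv.Perm.cycle_is_cycleOf ha c.2).symm

theorem cycleIndex_surjective (g : Equiv.Perm (Fin n)) : Function.Surjective (cycleIndex g) := by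
  rintro (c | b)
  · have hc := (Equiv.Perm.mem_cycleFactorsFinset_iff.1 c.2).1
    obtain ⟨a, ha, -⟩ := hc
    exact ⟨a, cycleIndex_eq_inl.2 (Equiv.Perm.mem_support.2 ha)⟩
  · exact ⟨b.1, cycleIndex_eq_inr.2 rfl⟩

theorem cycleIndex_apply (g : Equiv.Perm (Fin n)) (a : Fin n) :
    cycleIndex g (g a) = cycleIndex g a := by
  rcases h : cycleIndex g a with c | b
  · rw [cycleIndex_eq_inl] at h ⊢
    have := (Equiv.Perm.mem_cycleFactorsFinset_iff.1 c.2).2 a h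
    rw [← this, Equiv.Perm.apply_mem_support]
    exact h
  · rw [cycleIndex_eq_inr] at h ⊢
    rw [h, b.2]

theorem sameCycle_of_cycleIndex_eq {g : Equiv.Perm (Fin n)} {a b : Fin n}
    (h : cycleIndex g a = cycleIndex g b) : g.SameCycle a b := by
  rcases hb : cycleIndex g b with c | x
  · have ha := h.trans hb
    rw [cycleIndex_eq_inl] at ha hb
    have h1 := Equiv.Perm.cycle_is_cycleOf ha c.2
    rw [h1, Equiv.Perm.mem_support_cycleOf_iff] at hb
    exact hb.1
  · have ha := h.trans hb
    rw [cycleIndex_eq_inr] at ha hb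
    rw [ha, hb]

/-- A colouring fixed by g is a free choice of one colour per cycle. -/
theorem fixPoly_eq_prod_cycleIndex (g : Equiv.Perm (Fin n)) :
    fixPoly N g = ∏ k : CycleIndex g,
      psum (Fin N) ℤ (Finset.univ.filter fun a => cycleIndex g a = k).card := by
  simp only [psum]
  rw [Finset.prod_univ_sum, Fintype.piFinset_univ, fixPoly]
  symm
  refine Finset.sum_bij (fun F _ => F ∘ cycleIndex g) (fun F _ => ?_) (fun F _ F' _ h => ?_)
    (fun F hF => ?_) fun F _ => ?_
  · simp [cycleIndex_apply]
  · exact (cycleIndex_surjective g).injective_comp_right h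
  · have hF2 : ∀ a, F (g a) = F a := by simpa using hF
    have hpow : ∀ (i : ℕ) a, F ((g ^ i) a) = F a := by
      intro i
      induction i with
      | zero => simp
      | succ i ih => intro a; rw [pow_succ', Equiv.Perm.mul_apply, hF2, ih]
    have hF' : F.FactorsThrough (cycleIndex g) := by
      intro a b hab
      obtain ⟨i, hi⟩ := (sameCycle_of_cycleIndex_eq hab).exists_nat_pow_eq
      rw [← hi, hpow]
    obtain ⟨s, hs⟩ := (cycleIndex_surjective g).hasRightInverse
    exact ⟨F ∘ s, Finset.mem_univ _, funext fun a => hF' (hs (cycleIndex g a))⟩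
  · rw [← Finset.prod_fiberwise (s := Finset.univ) (g := cycleIndex g)]
    refine Finset.prod_congr rfl fun k _ => ?_
    rw [Finset.prod_congr rfl fun a ha => by
      rw [Function.comp_apply, (Finset.mem_filter.1 ha).2], Finset.prod_const]

theorem fixPoly_eq_prod_psum (g : Equiv.Perm (Fin n)) :
    fixPoly N g = (g.partition.parts.map (psum (Fin N) ℤ)).prod := by
  rw [fixPoly_eq_prod_cycleIndex, Fintype.prod_sum_type, Equiv.Perm.parts_partition,
    Multiset.map_add, Multiset.prod_add]
  congr 1
  · rw [Equiv.Perm.cycleType_def, Multiset.map_map]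
    refine Eq.trans ?_ (Finset.prod_coe_sort g.cycleFactorsFinset fun c =>
      psum (Fin N) ℤ c.support.card)
    refine Finset.prod_congr rfl fun c _ => ?_
    congr 2
    ext a
    rw [Finset.mem_filter, cycleIndex_eq_inl]
    simp
  · rw [Multiset.map_replicate, Multiset.prod_replicate]
    have h1 : ∀ b : {a // g a = a},
        (Finset.univ.filter fun a => cycleIndex g a = Sum.inr b).card = 1 := by
      intro b
      simp only [cycleIndex_eq_inr, Finset.filter_eq', Finset.mem_univ, if_true,
        Finset.card_singleton]
    simp only [h1, Finset.prod_const, Finset.card_univ]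
    congr 1
    rw [Fintype.card_subtype, ← Finset.card_compl]
    congr 1
    ext a
    simp

/-- The cycle lengths may be listed in any order; later arguments put the long cycle first. -/
theorem spechtCharacter_eq_mnVal (T : Tableau n lam) (g : Equiv.Perm (Fin n)) {l : List ℕ}
    (hl : (l : Multiset ℕ) = g.partition.parts) :
    spechtCharacter T g = (mnVal l (betaList lam.rowLens) : ℤ) := by
  rw [spechtCharacter_eq_frobeniusClass T le_rfl, frobeniusClass, fixPoly_eq_prod_psum, ← hl,
    Multiset.map_coe, Multiset.prod_coe, coeffAt_vandermondePoly_mul_prod_psum, ofFn_shiftedRows]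
  intro r hr
  exact g.partition.parts_pos (hl ▸ Multiset.mem_coe.2 hr)

end MurnaghanNakayama

/-! ### Characters of the alternating group -/

section Alternating

open Equiv.Perm

variable {n : ℕ} {lam mu : YoungDiagram}

theorem spechtCharacter_congr (T S : Tableau n lam) : spechtCharacter T = spechtCharacter S := by
  rw [spechtCharacter_eq_frobeniusClass T le_rfl, spechtCharacter_eq_frobeniusClass S le_rfl]

theorem charInner_spechtCharacter (T : Tableau n lam) (S : Tableau n mu) [Decidable (lam = mu)] :
    charInner (spechtCharacter T) (spechtCharacter S) = if lam = mu then 1 else 0 := by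
  split_ifs with h
  · subst h
    rw [spechtCharacter_congr S T, charInner_spechtCharacter_self]
  · exact charInner_spechtCharacter_of_ne T S h

theorem spechtCharacter_transposeTableau (T : Tableau n lam) (g : Equiv.Perm (Fin n)) :
    spechtCharacter (transposeTableau T) g = ((sign g : ℤ) : ℂ) * spechtCharacter T g :=
  spechtCharacter_transpose T _ (transposeTableau_apply T) g

theorem spechtCharacterAlt_transposeTableau (T : Tableau n lam) :
    spechtCharacterAlt (transposeTableau T) = spechtCharacterAlt T := by
  funext g
  rw [spechtCharacterAlt, spechtCharacter_transposeTableau, mem_alternatingGroup.1 g.2]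
  simp [spechtCharacterAlt]

theorem IsAltSpechtCharacter.transpose {T : Tableau n lam} {θ : alternatingGroup (Fin n) → ℂ}
    (h : IsAltSpechtCharacter T θ) : IsAltSpechtCharacter (transposeTableau T) θ := by
  obtain ⟨h1, ⟨h2, h3⟩ | ⟨h2, h3⟩⟩ := h
  · refine ⟨h1, Or.inl ⟨?_, ?_⟩⟩
    · rw [YoungDiagram.transpose_transpose]
      exact h2.symm
    · rw [spechtCharacterAlt_transposeTableau, h3]
  · refine ⟨h1, Or.inr ⟨?_, ?_⟩⟩
    · rw [YoungDiagram.transpose_transpose, h2]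
    · rw [spechtCharacterAlt_transposeTableau]
      exact h3

theorem sum_alternatingGroup (f : Equiv.Perm (Fin n) → ℂ) :
    ∑ g : alternatingGroup (Fin n), f g = ∑ g, if sign g = 1 then f g else 0 := by
  rw [← Finset.sum_filter]
  exact (Finset.sum_subtype _ (by simp) f).symm

theorem card_perm_eq_two_mul (hn : 2 ≤ n) :
    (Nat.card (Equiv.Perm (Fin n)) : ℂ) = 2 * Nat.card (alternatingGroup (Fin n)) := by
  have : Nontrivial (Fin n) := Fin.nontrivial_iff_two_le.2 hn
  rw [← two_mul_nat_card_alternatingGroup]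
  push_cast
  rfl

/-- The indicator of A_n is (1 + sign)/2, and A_n has half the order of S_n. -/
theorem charInner_restrict (hn : 2 ≤ n) (φ ψ : Equiv.Perm (Fin n) → ℂ) :
    charInner (fun g : alternatingGroup (Fin n) => φ g) (fun g => ψ g) =
      charInner φ ψ + charInner φ fun g => ((sign g : ℤ) : ℂ) * ψ g := by
  have h0 : (Nat.card (alternatingGroup (Fin n)) : ℂ) ≠ 0 := Nat.cast_ne_zero.2 Nat.card_pos.ne'
  simp only [charInner, card_perm_eq_two_mul hn, InvMemClass.coe_inv]
  rw [sum_alternatingGroup (fun g => φ g * ψ g⁻¹), ← mul_add, ← Finset.sum_add_distrib, mul_inv,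
    mul_comm (2 : ℂ)⁻¹, mul_assoc, Finset.mul_sum, Finset.mul_sum,
    Finset.mul_sum]
  refine Finset.sum_congr rfl fun g _ => ?_
  rw [sign_inv]
  rcases Int.units_eq_one_or (sign g) with h | h
  · rw [if_pos h, h]
    push_cast
    ring
  · rw [if_neg (by rw [h]; decide), h]
    push_cast
    ring

theorem charInner_spechtCharacterAlt (hn : 2 ≤ n) (T : Tableau n lam) (S : Tableau n mu)
    [Decidable (lam = mu)] [Decidable (lam = mu.transpose)] :
    charInner (spechtCharacterAlt T) (spechtCharacterAlt S) =
      (if lam = mu then 1 else 0) + if lam = mu.transpose then 1 else 0 := by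
  rw [← charInner_spechtCharacter T S, ← charInner_spechtCharacter T (transposeTableau S)]
  refine (charInner_restrict hn _ _).trans ?_
  congr 2
  funext g
  rw [spechtCharacter_transposeTableau]

theorem exists_multiset_sum_eq_spechtCharacterAlt (T : Tableau n lam) :
    ∃ L : Multiset (alternatingGroup (Fin n) → ℂ), (∀ θ ∈ L, IsIrreducibleCharacter θ) ∧
      spechtCharacterAlt T = L.sum :=
  exists_multiset_sum_eq_character ((spechtRep T).comp (alternatingGroup (Fin n)).subtype)

theorem isIrreducibleCharacter_spechtCharacterAlt (hn : 2 ≤ n) (T : Tableau n lam)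
    (h : lam.transpose ≠ lam) : IsIrreducibleCharacter (spechtCharacterAlt T) := by
  classical
  obtain ⟨L, hL, hsum⟩ := exists_multiset_sum_eq_spechtCharacterAlt T
  obtain ⟨k, hk, hcard, -⟩ := exists_nat_charInner_multiset_sum_self hL
  rw [← hsum, charInner_spechtCharacterAlt hn, if_pos rfl, if_neg h.symm, add_zero] at hk
  have hk1 : k = 1 := by exact_mod_cast hk.symm
  have hpos : L ≠ 0 := by
    rintro rfl
    have h1 := charInner_spechtCharacterAlt hn T T
    rw [hsum, if_pos rfl, if_neg h.symm, Multiset.sum_zero, charInner_zero_left] at h1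
    norm_num at h1
  have hc : L.card = 1 := le_antisymm (hcard.trans hk1.le) (Multiset.card_pos.2 hpos)
  obtain ⟨θ, rfl⟩ := Multiset.card_eq_one.1 hc
  rw [hsum, Multiset.sum_singleton]
  exact hL θ (Multiset.mem_singleton_self θ)

/-- The norm is 2. It bounds the number of constituents, strictly if one is repeated, and a single
constituent would have norm 1; hence two distinct ones. -/
theorem exists_spechtCharacterAlt_eq_add (hn : 2 ≤ n) (T : Tableau n lam)
    (h : lam.transpose = lam) : ∃ θ θ' : alternatingGroup (Fin n) → ℂ,
      IsIrreducibleCharacter θ ∧ IsIrreducibleCharacter θ' ∧ θ' ≠ θ ∧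
        spechtCharacterAlt T = θ + θ' := by
  classical
  obtain ⟨L, hL, hsum⟩ := exists_multiset_sum_eq_spechtCharacterAlt T
  have hnorm : charInner L.sum L.sum = 2 := by
    rw [← hsum, charInner_spechtCharacterAlt hn, if_pos rfl, if_pos h.symm]
    norm_num
  obtain ⟨k, hk, hcard, hnodup⟩ := exists_nat_charInner_multiset_sum_self hL
  have hk1 : k = 2 := by
    rw [hnorm] at hk
    exact_mod_cast hk.symm
  subst hk1
  have h0 : L.card ≠ 0 := by
    intro h0
    rw [Multiset.card_eq_zero.1 h0, Multiset.sum_zero, charInner_zero_left] at hnorm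
    norm_num at hnorm
  have h1 : L.card ≠ 1 := by
    intro h1
    obtain ⟨θ, rfl⟩ := Multiset.card_eq_one.1 h1
    rw [Multiset.sum_singleton, charInner_irreducible (hL θ (Multiset.mem_singleton_self θ))
      (hL θ (Multiset.mem_singleton_self θ)), if_pos rfl] at hnorm
    norm_num at hnorm
  have h2 : L.card = 2 := by omega
  have hnd : L.Nodup := by
    by_contra hnd
    have := hnodup hnd
    omega
  obtain ⟨θ, θ', rfl⟩ := Multiset.card_eq_two.1 h2
  refine ⟨θ, θ', hL θ (by simp), hL θ' (by simp), ?_, ?_⟩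
  · rintro rfl
    simp at hnd
  · rw [hsum]
    simp [Multiset.insert_eq_cons]

theorem exists_isAltSpechtCharacter (hn : 2 ≤ n) (T : Tableau n lam) :
    ∃ θ : alternatingGroup (Fin n) → ℂ, IsAltSpechtCharacter T θ := by
  by_cases h : lam.transpose = lam
  · obtain ⟨θ, θ', h1, h2, h3, h4⟩ := exists_spechtCharacterAlt_eq_add hn T h
    exact ⟨θ, h1, Or.inr ⟨h, θ', h2, h3, h4⟩⟩
  · exact ⟨_, isIrreducibleCharacter_spechtCharacterAlt hn T h, Or.inl ⟨h, rfl⟩⟩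

/-- Conjugation by a permutation, as an automorphism of the alternating group. -/
def conjAlt (τ : Equiv.Perm (Fin n)) (g : alternatingGroup (Fin n)) : alternatingGroup (Fin n) :=
  ⟨τ * g * τ⁻¹, (inferInstance : (alternatingGroup (Fin n)).Normal).conj_mem _ g.2 τ⟩

/-- A class function orthogonal to the restrictions of all characters of the symmetric group
changes sign under odd permutations. -/
theorem add_conjAlt_eq_zero (hn : 2 ≤ n) {D : alternatingGroup (Fin n) → ℂ}
    (hD : ∀ g x, D (x * g * x⁻¹) = D g)
    (h0 : ∀ lam : YoungDiagram, Nonempty (Tableau n lam) →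
      ∃ T : Tableau n lam, charInner D (spechtCharacterAlt T) = 0)
    {τ : Equiv.Perm (Fin n)} (hτ : τ ∉ alternatingGroup (Fin n)) (g : alternatingGroup (Fin n)) :
    D g + D (conjAlt τ g) = 0 := by
  classical
  have : Nontrivial (Fin n) := Fin.nontrivial_iff_two_le.2 hn
  -- Symmetrize D under τ and extend by zero. This is a class function on S_n, and by assumption it
  -- is orthogonal to all Specht characters.
  let E : Equiv.Perm (Fin n) → ℂ := fun g =>
    if h : g ∈ alternatingGroup (Fin n) then D ⟨g, h⟩ + D (conjAlt τ ⟨g, h⟩) else 0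
  have hE : E = 0 := by
    refine eq_zero_of_charInner_spechtCharacter_eq_zero (fun g x => ?_) fun lam hlam => ?_
    · have hmem : x * g * x⁻¹ ∈ alternatingGroup (Fin n) ↔ g ∈ alternatingGroup (Fin n) := by
        simp only [mem_alternatingGroup, map_mul, map_inv]
        rw [mul_comm, inv_mul_cancel_left]
      simp only [E]
      by_cases hg : g ∈ alternatingGroup (Fin n)
      · rw [dif_pos (hmem.2 hg), dif_pos hg]
        have hDc : ∀ (a b : alternatingGroup (Fin n)) (z : Equiv.Perm (Fin n)),
            z ∈ alternatingGroup (Fin n) → (a : Equiv.Perm (Fin n)) = z * b * z⁻¹ → D a = D b := by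
          intro a b z hz hab
          rw [← hD b ⟨z, hz⟩]
          exact congrArg D (Subtype.ext hab)
        have hidx := fun a b => @Subgroup.mul_mem_iff_of_index_two _ _ _
          (alternatingGroup.index_eq_two (α := Fin n)) a b
        by_cases hx : x ∈ alternatingGroup (Fin n)
        · congr 1
          · exact hDc _ _ x hx rfl
          · refine hDc _ _ (τ * x * τ⁻¹)
              ((inferInstance : (alternatingGroup (Fin n)).Normal).conj_mem _ hx τ) ?_
            simp only [conjAlt]
            group
        -- Conjugation by an odd x exchanges the two summands: τ x and x τ⁻¹ are even.
        · rw [add_comm]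
          congr 1
          · refine hDc _ _ (τ * x) ?_ ?_
            · rw [hidx]
              exact iff_of_false hτ hx
            · simp only [conjAlt]
              group
          · refine hDc _ _ (x * τ⁻¹) ?_ ?_
            · rw [hidx]
              exact iff_of_false hx fun h => hτ (inv_mem_iff.1 h)
            · simp only [conjAlt]
              group
      · rw [dif_neg fun h => hg (hmem.1 h), dif_neg hg]
    · obtain ⟨T, hT⟩ := h0 lam hlam
      refine ⟨T, ?_⟩
      rw [charInner]
      refine mul_eq_zero_of_right _ ?_
      have hz : ∑ g : alternatingGroup (Fin n),
          D g * spechtCharacter T (g : Equiv.Perm (Fin n)) = 0 := by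
        have := (mul_eq_zero.1 hT).resolve_left
          (inv_ne_zero (Nat.cast_ne_zero.2 Nat.card_pos.ne'))
        rw [← this]
        refine Finset.sum_congr rfl fun g _ => ?_
        rw [spechtCharacterAlt, InvMemClass.coe_inv, spechtCharacter_inv]
      have h1 : ∑ g, E g * spechtCharacter T g⁻¹ = ∑ g : alternatingGroup (Fin n),
          (D g + D (conjAlt τ g)) * spechtCharacter T (g : Equiv.Perm (Fin n)) := by
        have : ∀ g : alternatingGroup (Fin n),
            (D g + D (conjAlt τ g)) * spechtCharacter T (g : Equiv.Perm (Fin n)) =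
              E g * spechtCharacter T (g : Equiv.Perm (Fin n))⁻¹ := fun g => by
          rw [spechtCharacter_inv]
          simp only [E]
          rw [dif_pos g.2]
        rw [Finset.sum_congr rfl fun g _ => this g,
          sum_alternatingGroup fun g => E g * spechtCharacter T g⁻¹]
        refine Finset.sum_congr rfl fun g _ => ?_
        split_ifs with hg
        · rfl
        · simp only [E]
          rw [dif_neg fun h => hg (mem_alternatingGroup.1 h), zero_mul]
      rw [h1]
      simp only [add_mul]
      rw [Finset.sum_add_distrib, hz, zero_add, ← hz]
      refine Fintype.sum_equiv ⟨conjAlt τ, conjAlt τ⁻¹, fun g => ?_, fun g => ?_⟩ _ _ fun g => ?_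
      · refine Subtype.ext ?_
        simp only [conjAlt]
        group
      · refine Subtype.ext ?_
        simp only [conjAlt]
        group
      · simp only [Equiv.coe_fn_mk]
        congr 1
        exact (spechtCharacter_conj T _ τ).symm
  have := congrFun hE g
  simp only [E, SetLike.coe_mem, dite_true] at this
  exact this

theorem charInner_neg_left {G : Type*} [Group G] [Fintype G] (φ ψ : G → ℂ) :
    charInner (-φ) ψ = -charInner φ ψ := by
  rw [← neg_one_smul ℂ, charInner_smul_left, neg_one_mul]

/-- The irreducible constituents of a sum of two orthogonal characters. -/
theorem charInner_eq_zero_of_charInner_add_eq_zero {L : Multiset (alternatingGroup (Fin n) → ℂ)}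
    (hL : ∀ θ ∈ L, IsIrreducibleCharacter θ) {θ θ' : alternatingGroup (Fin n) → ℂ}
    (hθ : IsIrreducibleCharacter θ) (hθ' : IsIrreducibleCharacter θ')
    (h : charInner L.sum (θ + θ') = 0) : charInner L.sum θ = 0 ∧ charInner L.sum θ' = 0 := by
  classical
  rw [charInner_add_right, charInner_multiset_sum_irreducible hL hθ,
    charInner_multiset_sum_irreducible hL hθ'] at h
  rw [charInner_multiset_sum_irreducible hL hθ, charInner_multiset_sum_irreducible hL hθ']
  norm_cast at h ⊢
  omega

/-- The two constituents of the restriction of a self-conjugate character are exchanged by odd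
permutations. -/
theorem conjAlt_eq_of_spechtCharacterAlt_eq_add (hn : 2 ≤ n) (T : Tableau n lam)
    (hlam : lam.transpose = lam) {θ θ' : alternatingGroup (Fin n) → ℂ}
    (hθ : IsIrreducibleCharacter θ) (hθ' : IsIrreducibleCharacter θ') (hne : θ' ≠ θ)
    (hsum : spechtCharacterAlt T = θ + θ') {τ : Equiv.Perm (Fin n)}
    (hτ : τ ∉ alternatingGroup (Fin n)) (g : alternatingGroup (Fin n)) :
    θ (conjAlt τ g) = θ' g := by
  classical
  -- The difference θ - θ' is orthogonal to every restriction, hence negated by τ, while the sum θ +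
  -- θ' is invariant under τ.
  have hD := add_conjAlt_eq_zero hn (D := θ + -θ') (fun g x => by
    rw [Pi.add_apply, Pi.add_apply, Pi.neg_apply, Pi.neg_apply, hθ.conj_apply, hθ'.conj_apply])
    (fun mu ⟨S⟩ => ⟨S, ?_⟩) hτ g
  · have h1 : θ g + θ' g = θ (conjAlt τ g) + θ' (conjAlt τ g) := by
      rw [← Pi.add_apply, ← Pi.add_apply, ← hsum]
      exact (spechtCharacter_conj T _ τ).symm
    simp only [Pi.add_apply, Pi.neg_apply] at hD
    linear_combination (1 / 2) * hD - (1 / 2) * h1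
  · rw [charInner_add_left, charInner_neg_left, charInner_comm, charInner_comm θ']
    by_cases hmu : mu = lam
    · subst hmu
      have hS : spechtCharacterAlt S = θ + θ' := by
        rw [← hsum]
        funext g
        rw [spechtCharacterAlt, spechtCharacter_congr S T, spechtCharacterAlt]
      rw [hS, charInner_add_left, charInner_add_left, charInner_irreducible hθ hθ,
        charInner_irreducible hθ' hθ, charInner_irreducible hθ hθ', charInner_irreducible hθ' hθ',
        if_pos rfl, if_neg hne, if_neg hne.symm, if_pos rfl]
      ring
    · obtain ⟨L, hL, hLsum⟩ := exists_multiset_sum_eq_spechtCharacterAlt S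
      have h0 := charInner_spechtCharacterAlt hn S T
      rw [if_neg hmu, if_neg (by rwa [hlam]), add_zero, hLsum, hsum] at h0
      obtain ⟨h1, h2⟩ := charInner_eq_zero_of_charInner_add_eq_zero hL hθ hθ' h0
      rw [hLsum, h1, h2]
      ring

/-- Every irreducible character of the alternating group is a constituent of the restriction of a
Specht character. -/
theorem exists_isAltSpechtCharacter_of_isIrreducibleCharacter (hn : 2 ≤ n)
    {θ : alternatingGroup (Fin n) → ℂ} (hθ : IsIrreducibleCharacter θ) :
    ∃ (lam : YoungDiagram) (T : Tableau n lam), IsAltSpechtCharacter T θ := by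
  classical
  by_contra hno
  push Not at hno
  have hnt : Nontrivial (Fin n) := Fin.nontrivial_iff_two_le.2 hn
  obtain ⟨a, b, hab⟩ := exists_pair_ne (Fin n)
  have hτ : Equiv.swap a b ∉ alternatingGroup (Fin n) := by
    rw [mem_alternatingGroup, sign_swap hab]
    decide
  have h := add_conjAlt_eq_zero hn hθ.conj_apply (fun lam ⟨T⟩ => ⟨T, ?_⟩) hτ 1
  -- A character missing from every restriction would satisfy 2 θ(1) = 0.
  · have h1 : conjAlt (Equiv.swap a b) 1 = 1 := Subtype.ext (by simp [conjAlt])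
    rw [h1, ← two_mul] at h
    exact hθ.one_ne_zero ((mul_eq_zero.1 h).resolve_left two_ne_zero)
  · rw [charInner_comm]
    by_cases hlam : lam.transpose = lam
    · obtain ⟨θ₁, θ₂, h1, h2, h3, h4⟩ := exists_spechtCharacterAlt_eq_add hn T hlam
      rw [h4, charInner_add_left, charInner_irreducible h1 hθ, charInner_irreducible h2 hθ,
        if_neg, if_neg, add_zero]
      · rintro rfl
        exact hno lam T ⟨hθ, Or.inr ⟨hlam, θ₁, h1, h3.symm, by rw [h4, add_comm]⟩⟩
      · rintro rfl
        exact hno lam T ⟨hθ, Or.inr ⟨hlam, θ₂, h2, h3, h4⟩⟩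
    · rw [charInner_irreducible (isIrreducibleCharacter_spechtCharacterAlt hn T hlam) hθ, if_neg]
      rintro rfl
      exact hno lam T ⟨hθ, Or.inl ⟨hlam, rfl⟩⟩

/-- On elements centralized by an odd permutation, both constituents of a self-conjugate
character take half of its value. -/
theorem two_mul_apply_of_commute (hn : 2 ≤ n) {T : Tableau n lam} (hlam : lam.transpose = lam)
    {θ : alternatingGroup (Fin n) → ℂ} (hθ : IsAltSpechtCharacter T θ)
    {g : alternatingGroup (Fin n)} {τ : Equiv.Perm (Fin n)} (hτ : τ ∉ alternatingGroup (Fin n))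
    (hg : τ * g = g * τ) : 2 * θ g = spechtCharacter T g := by
  obtain ⟨h1, ⟨h2, -⟩ | ⟨-, θ', h2, h3, h4⟩⟩ := hθ
  · exact absurd hlam h2
  · have h5 := conjAlt_eq_of_spechtCharacterAlt_eq_add hn T hlam h1 h2 h3 h4 hτ g
    have h6 : conjAlt τ g = g := Subtype.ext (by simp [conjAlt, hg])
    have h7 := congrFun h4 g
    rw [h6] at h5
    rw [spechtCharacterAlt, Pi.add_apply, ← h5] at h7
    rw [h7, two_mul]

theorem two_mul_apply_one (hn : 2 ≤ n) {T : Tableau n lam} (hlam : lam.transpose = lam)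
    {θ : alternatingGroup (Fin n) → ℂ} (hθ : IsAltSpechtCharacter T θ) :
    2 * θ 1 = spechtCharacter T 1 := by
  have hnt : Nontrivial (Fin n) := Fin.nontrivial_iff_two_le.2 hn
  obtain ⟨a, b, hab⟩ := exists_pair_ne (Fin n)
  refine two_mul_apply_of_commute hn hlam hθ (g := 1) (τ := Equiv.swap a b) ?_ (by simp)
  rw [mem_alternatingGroup, sign_swap hab]
  decide

/-! ### Cycle partitions -/

theorem exists_partition_parts_eq {l : List ℕ} (hpos : ∀ r ∈ l, 0 < r) (hsum : l.sum = n) :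
    ∃ g : Equiv.Perm (Fin n), g.partition.parts = (l : Multiset ℕ) := by
  set m : Multiset ℕ := (l : Multiset ℕ).filter fun r => 2 ≤ r with hm
  have h1 : (l : Multiset ℕ).filter (fun r => ¬ 2 ≤ r) =
      Multiset.replicate ((l : Multiset ℕ).filter fun r => ¬ 2 ≤ r).card 1 := by
    rw [Multiset.eq_replicate]
    refine ⟨rfl, fun b hb => ?_⟩
    rw [Multiset.mem_filter] at hb
    have := hpos b (Multiset.mem_coe.1 hb.1)
    omega
  have h2 := Multiset.filter_add_not (fun r => 2 ≤ r) (l : Multiset ℕ)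
  have h3 : m.sum + ((l : Multiset ℕ).filter fun r => ¬ 2 ≤ r).card = n := by
    have := congrArg Multiset.sum h2
    rw [Multiset.sum_add, h1, Multiset.sum_replicate, Multiset.sum_coe, hsum] at this
    rwa [smul_eq_mul, mul_one] at this
  obtain ⟨g, hg⟩ := (Equiv.Perm.exists_with_cycleType_iff (α := Fin n) (m := m)).2
    ⟨by rw [Fintype.card_fin]; omega, fun a ha => (Multiset.mem_filter.1 ha).2⟩
  refine ⟨g, ?_⟩
  rw [parts_partition, ← sum_cycleType, hg, Fintype.card_fin]
  conv_rhs => rw [← h2, h1]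
  rw [← h3, Nat.add_sub_cancel_left]

theorem sign_eq_of_partition (g : Equiv.Perm (Fin n)) :
    sign g = (-1) ^ (n + g.partition.parts.card) := by
  have h1 := g.support.card_le_univ
  rw [Fintype.card_fin] at h1
  rw [sign_of_cycleType, parts_partition, Multiset.card_add, Multiset.card_replicate,
    Fintype.card_fin, sum_cycleType]
  have h2 : n + (g.cycleType.card + (n - g.support.card)) =
      g.support.card + g.cycleType.card + 2 * (n - g.support.card) := by omega
  rw [h2, pow_add _ _ (2 * _), pow_mul]
  simp

theorem mem_alternatingGroup_iff_partition (g : Equiv.Perm (Fin n)) :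
    g ∈ alternatingGroup (Fin n) ↔ Even (n + g.partition.parts.card) := by
  rw [mem_alternatingGroup, sign_eq_of_partition]
  rcases Nat.even_or_odd (n + g.partition.parts.card) with h | h
  · simp [h]
  · simp [h.neg_one_pow, h]

theorem dvd_orderOf_iff {p : ℕ} (hp : p.Prime) (g : Equiv.Perm (Fin n)) :
    p ∣ orderOf g ↔ ∃ r ∈ g.partition.parts, p ∣ r := by
  rw [← lcm_cycleType, parts_partition]
  constructor
  · intro h
    by_contra hno
    push Not at hno
    have : ∀ s : Multiset ℕ, (∀ r ∈ s, ¬ p ∣ r) → ¬ p ∣ s.lcm := by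
      intro s
      induction s using Multiset.induction_on with
      | empty => simpa using hp.one_lt.ne'
      | cons a s ih =>
        intro hs hdvd
        rw [Multiset.lcm_cons] at hdvd
        rcases (Nat.Prime.dvd_lcm hp).1 hdvd with h1 | h1
        · exact hs a (Multiset.mem_cons_self a s) h1
        · exact ih (fun r hr => hs r (Multiset.mem_cons_of_mem hr)) h1
    exact this _ (fun r hr => hno r (Multiset.mem_add.2 (Or.inl hr))) h
  · rintro ⟨r, hr, hpr⟩
    rcases Multiset.mem_add.1 hr with h | h
    · exact hpr.trans (Multiset.dvd_lcm h)
    · rw [Multiset.eq_of_mem_replicate h] at hpr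
      exact absurd (Nat.dvd_one.1 hpr) hp.one_lt.ne'

/-- The centralizer of g lies in A_n only when the cycle lengths, fixed points included, are odd and
distinct. -/
theorem exists_commute_odd (g : Equiv.Perm (Fin n))
    (h : (∃ r ∈ g.partition.parts, Even r) ∨ ¬ g.partition.parts.Nodup) :
    ∃ τ, τ ∉ alternatingGroup (Fin n) ∧ τ * g = g * τ := by
  by_contra hno
  push Not at hno
  have hle : Subgroup.centralizer {g} ≤ alternatingGroup (Fin n) := by
    intro τ hτ
    by_contra hτ'
    exact hno τ hτ' (Subgroup.mem_centralizer_singleton_iff.1 hτ)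
  rw [centralizer_le_alternating_iff, Fintype.card_fin] at hle
  obtain ⟨h1, h2, h3⟩ := hle
  have h4 : n - g.support.card ≤ 1 := by
    rw [sum_cycleType] at h2
    omega
  rw [parts_partition, Fintype.card_fin] at h
  rcases h with ⟨r, hr, hev⟩ | h
  · rcases Multiset.mem_add.1 hr with h | h
    · exact (Nat.not_even_iff_odd.2 (h1 r h)) hev
    · rw [Multiset.eq_of_mem_replicate h] at hev
      exact Nat.not_even_one hev
  · refine h ?_
    rw [Multiset.nodup_add]
    refine ⟨Multiset.nodup_iff_count_le_one.2 h3, ?_, ?_⟩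
    · rw [Multiset.nodup_iff_count_le_one]
      intro a
      exact (Multiset.count_le_card _ _).trans (by rwa [Multiset.card_replicate])
    · rw [Multiset.disjoint_left]
      intro a ha ha'
      rw [Multiset.eq_of_mem_replicate ha'] at ha
      exact absurd (two_le_of_mem_cycleType ha) (by norm_num)

end Alternating

/-! ### Enumeration of partitions -/

section Partitions

open Equiv.Perm

variable {n : ℕ} {lam : YoungDiagram}

/-- The decreasing lists of positive integers with sum `n` and entries at most `k`; the first
argument bounds the length. -/
def boundedPartitions : ℕ → ℕ → ℕ → List (List ℕ)
  | 0, _, n => if n = 0 then [[]] else []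
  | f + 1, k, n => if n = 0 then [[]] else
      (List.range (min k n)).reverse.flatMap fun i =>
        (boundedPartitions f (i + 1) (n - (i + 1))).map ((i + 1) :: ·)

/-- The partitions of `n`, as decreasing lists. -/
def listPartitions (n : ℕ) : List (List ℕ) := boundedPartitions n n n

theorem mem_boundedPartitions {l : List ℕ} (hs : l.Pairwise (· ≥ ·)) (hpos : ∀ r ∈ l, 0 < r)
    {f k : ℕ} (hk : ∀ r ∈ l, r ≤ k) (hf : l.length ≤ f) : l ∈ boundedPartitions f k l.sum := by
  induction l generalizing f k with
  | nil => cases f <;> simp [boundedPartitions]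
  | cons x l ih =>
    obtain ⟨f, rfl⟩ : ∃ f', f = f' + 1 := ⟨f - 1, by simp at hf; omega⟩
    have hx := hpos x List.mem_cons_self
    have hxk := hk x List.mem_cons_self
    rw [List.pairwise_cons] at hs
    rw [List.length_cons] at hf
    rw [boundedPartitions, if_neg (by simp; omega), List.mem_flatMap]
    refine ⟨x - 1, ?_, ?_⟩
    · rw [List.mem_reverse, List.mem_range, List.sum_cons]
      omega
    · rw [List.mem_map]
      refine ⟨l, ?_, ?_⟩
      · have h1 : (x :: l).sum - (x - 1 + 1) = l.sum := by
          rw [List.sum_cons]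
          omega
        rw [h1]
        refine ih hs.2 (fun r hr => hpos r (List.mem_cons_of_mem _ hr)) (fun r hr => ?_) (by omega)
        have := hs.1 r hr
        omega
      · rw [Nat.sub_add_cancel hx]

theorem length_le_sum_of_pos {l : List ℕ} (hpos : ∀ r ∈ l, 0 < r) : l.length ≤ l.sum := by
  simpa using List.card_nsmul_le_sum l 1 fun r hr => hpos r hr

theorem mem_listPartitions {l : List ℕ} (hs : l.Pairwise (· ≥ ·)) (hpos : ∀ r ∈ l, 0 < r) :
    l ∈ listPartitions l.sum :=
  mem_boundedPartitions hs hpos (fun _ hr => List.le_sum_of_mem hr) (length_le_sum_of_pos hpos)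

theorem sum_rowLens (T : Tableau n lam) : lam.rowLens.sum = n := by
  rw [← card_eq_sum_rowLens, T.card_eq]

theorem rowLens_mem_listPartitions (T : Tableau n lam) : lam.rowLens ∈ listPartitions n := by
  have h := mem_listPartitions lam.rowLens_sorted.pairwise fun r hr => lam.pos_of_mem_rowLens r hr
  rwa [sum_rowLens T] at h

theorem sort_parts_mem_listPartitions (g : Equiv.Perm (Fin n)) :
    g.partition.parts.sort (· ≥ ·) ∈ listPartitions n := by
  have h := mem_listPartitions (l := g.partition.parts.sort (· ≥ ·)) (Multiset.pairwise_sort _ _)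
    fun r hr => g.partition.parts_pos ((Multiset.mem_sort _).1 hr)
  have h1 : (g.partition.parts.sort (· ≥ ·)).sum = n := by
    rw [← Multiset.sum_coe, Multiset.sort_eq, g.partition.parts_sum, Fintype.card_fin]
  rwa [h1] at h

/-- The conjugate partition. -/
def conjList (l : List ℕ) : List ℕ :=
  (List.range (l.headD 0)).map fun j => l.countP fun x => decide (j < x)

theorem countP_range_lt (c M : ℕ) : (List.range M).countP (fun i => decide (i < c)) = min c M := by
  induction M with
  | zero => simp
  | succ M ih =>
    rw [List.range_succ, List.countP_append, ih, List.countP_singleton]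
    simp only [decide_eq_true_eq]
    split_ifs <;> omega

theorem headD_rowLens (lam : YoungDiagram) : lam.rowLens.headD 0 = lam.rowLen 0 := by
  rcases Nat.eq_zero_or_pos (lam.colLen 0) with h | h
  · have h1 : lam.rowLen 0 = 0 := by
      by_contra h1
      have := YoungDiagram.mem_iff_lt_rowLen.2 (Nat.pos_of_ne_zero h1)
      rw [YoungDiagram.mem_iff_lt_colLen] at this
      omega
    rw [YoungDiagram.rowLens, h, h1]
    rfl
  · obtain ⟨m, hm⟩ := Nat.exists_eq_succ_of_ne_zero h.ne'
    rw [YoungDiagram.rowLens, hm, List.range_succ_eq_map]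
    rfl

theorem rowLens_transpose (lam : YoungDiagram) : lam.transpose.rowLens = conjList lam.rowLens := by
  rw [conjList, headD_rowLens, YoungDiagram.rowLens, YoungDiagram.colLen_transpose]
  refine List.map_congr_left fun j _ => ?_
  rw [YoungDiagram.rowLen_transpose, YoungDiagram.rowLens, List.countP_map]
  have h : (fun x => decide (j < x)) ∘ lam.rowLen = fun i => decide (i < lam.colLen j) := by
    funext i
    simp only [Function.comp_apply, ← YoungDiagram.mem_iff_lt_rowLen,
      YoungDiagram.mem_iff_lt_colLen]
  rw [h, countP_range_lt]
  exact (min_eq_left (lam.colLen_anti 0 j (Nat.zero_le j))).symm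

theorem rowLens_injective : Function.Injective YoungDiagram.rowLens := by
  intro lam mu h
  rw [← YoungDiagram.ofRowLens_to_rowLens_eq_self (μ := lam),
    ← YoungDiagram.ofRowLens_to_rowLens_eq_self (μ := mu)]
  congr 1

theorem transpose_eq_self_iff (lam : YoungDiagram) :
    lam.transpose = lam ↔ conjList lam.rowLens = lam.rowLens := by
  rw [← rowLens_injective.eq_iff, rowLens_transpose]

end Partitions

/-! ### Values on regular classes -/

section Classes

open Equiv.Perm

variable {n p : ℕ} {lam : YoungDiagram}

/-- The cycle partitions of the even permutations of order prime to `p`. -/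
structure IsRegularType (n p : ℕ) (l : List ℕ) : Prop where
  pos : ∀ r ∈ l, 0 < r
  sum : l.sum = n
  even : Even (n + l.length)
  not_dvd : ∀ r ∈ l, ¬ p ∣ r

theorem orderOf_alt (g : alternatingGroup (Fin n)) : orderOf g = orderOf (g : Equiv.Perm (Fin n)) :=
  (Subgroup.orderOf_coe g).symm

theorem IsRegularType.exists_perm (hp : p.Prime) {l : List ℕ} (h : IsRegularType n p l) :
    ∃ g : alternatingGroup (Fin n), (l : Multiset ℕ) = (g : Equiv.Perm (Fin n)).partition.parts ∧
      ¬ p ∣ orderOf g := by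
  obtain ⟨g, hg⟩ := exists_partition_parts_eq h.pos h.sum
  refine ⟨⟨g, ?_⟩, hg.symm, ?_⟩
  · rw [mem_alternatingGroup_iff_partition, hg]
    exact h.even
  · rw [orderOf_alt, dvd_orderOf_iff hp, hg]
    rintro ⟨r, hr, hpr⟩
    exact h.not_dvd r (Multiset.mem_coe.1 hr) hpr

theorem isRegularType_sort (hp : p.Prime) {g : alternatingGroup (Fin n)} (hg : ¬ p ∣ orderOf g) :
    IsRegularType n p ((g : Equiv.Perm (Fin n)).partition.parts.sort (· ≥ ·)) where
  pos r hr := (g : Equiv.Perm (Fin n)).partition.parts_pos ((Multiset.mem_sort _).1 hr)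
  sum := by
    rw [← Multiset.sum_coe, Multiset.sort_eq, Nat.Partition.parts_sum, Fintype.card_fin]
  even := by
    rw [← Multiset.coe_card, Multiset.sort_eq, ← mem_alternatingGroup_iff_partition]
    exact g.2
  not_dvd r hr hpr := by
    rw [orderOf_alt, dvd_orderOf_iff hp] at hg
    exact hg ⟨r, (Multiset.mem_sort _).1 hr, hpr⟩

/-- The alternative `hns` describes when a zero of χ_λ passes to θ: either θ is the whole
restriction, or the class commutes with an odd permutation and θ is half of χ_λ there. -/
theorem mnVal_ne_zero_of_isQuasiSteinberg (hn : 2 ≤ n) (hp : p.Prime) {T : Tableau n lam}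
    {θ : alternatingGroup (Fin n) → ℂ} (hθ : IsAltSpechtCharacter T θ) (hq : IsQuasiSteinberg p θ)
    {l : List ℕ} (hl : IsRegularType n p l)
    (hns : lam.transpose ≠ lam ∨ (∃ r ∈ l, Even r) ∨ ¬ l.Nodup) :
    mnVal l (betaList lam.rowLens) ≠ 0 := by
  intro h0
  obtain ⟨g, hg, hgp⟩ := hl.exists_perm hp
  have hne := hq.2.2 g hgp
  have hval := spechtCharacter_eq_mnVal T (g : Equiv.Perm (Fin n)) hg
  rw [h0, Int.cast_zero] at hval
  by_cases hlam : lam.transpose = lam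
  · obtain ⟨τ, hτ, hτg⟩ := exists_commute_odd (g : Equiv.Perm (Fin n)) (by
      rw [← hg]
      exact hns.resolve_left fun h => h hlam)
    have := two_mul_apply_of_commute hn hlam hθ hτ hτg
    rw [hval] at this
    exact hne ((mul_eq_zero.1 this).resolve_left two_ne_zero)
  · obtain ⟨-, ⟨-, h⟩ | ⟨h, -⟩⟩ := hθ
    · exact hne (by rw [h, spechtCharacterAlt, hval])
    · exact hlam h

theorem isQuasiSteinberg_of_mnVal_ne_zero (hp : p.Prime) {T : Tableau n lam}
    {θ : alternatingGroup (Fin n) → ℂ} (hθ : IsAltSpechtCharacter T θ)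
    (hcard : p ∣ Nat.card (alternatingGroup (Fin n))) (hlam : lam.transpose ≠ lam)
    (h : ∀ l ∈ listPartitions n, IsRegularType n p l → mnVal l (betaList lam.rowLens) ≠ 0) :
    IsQuasiSteinberg p θ := by
  refine ⟨hcard, hθ.1, fun g hg => ?_⟩
  obtain ⟨-, ⟨-, h1⟩ | ⟨h1, -⟩⟩ := hθ
  · rw [h1, spechtCharacterAlt, spechtCharacter_eq_mnVal T (g : Equiv.Perm (Fin n))
      (Multiset.sort_eq _ (· ≥ ·)), Int.cast_ne_zero]
    exact h _ (sort_parts_mem_listPartitions _) (isRegularType_sort hp hg)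
  · exact absurd h1 hlam

theorem pow_eq_one_of_partition {g : Equiv.Perm (Fin n)} {m : ℕ}
    (h : ∀ r ∈ g.partition.parts, r ∣ m) : g ^ m = 1 := by
  rw [← orderOf_dvd_iff_pow_eq_one, ← lcm_cycleType, Multiset.lcm_dvd]
  intro r hr
  refine h r ?_
  rw [parts_partition]
  exact Multiset.mem_add.2 (Or.inl hr)

theorem parts_one : (1 : Equiv.Perm (Fin n)).partition.parts = (List.replicate n 1 : List ℕ) := by
  rw [parts_partition, Multiset.coe_replicate]
  simp

theorem spechtCharacter_one (T : Tableau n lam) :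
    spechtCharacter T 1 = (mnVal (List.replicate n 1) (betaList lam.rowLens) : ℤ) :=
  spechtCharacter_eq_mnVal T 1 parts_one.symm

/-- For self-conjugate λ the values of the halves on split classes need not be computed: it is
enough that each regular element has order a power of a prime not dividing the degree d. -/
theorem isQuasiSteinberg_of_prime_pow (hn : 2 ≤ n) (hp : p.Prime) {T : Tableau n lam}
    {θ : alternatingGroup (Fin n) → ℂ} (hθ : IsAltSpechtCharacter T θ)
    (hcard : p ∣ Nat.card (alternatingGroup (Fin n))) (hlam : lam.transpose = lam) {d : ℕ}
    (hd : mnVal (List.replicate n 1) (betaList lam.rowLens) = 2 * d)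
    (h : ∀ l ∈ listPartitions n, IsRegularType n p l →
      ∃ q k, q.Prime ∧ ¬ q ∣ d ∧ ∀ r ∈ l, r ∣ q ^ k) :
    IsQuasiSteinberg p θ := by
  refine ⟨hcard, hθ.1, fun g hg => ?_⟩
  obtain ⟨q, k, hq, hqd, hr⟩ := h _ (sort_parts_mem_listPartitions (g : Equiv.Perm (Fin n)))
    (isRegularType_sort hp hg)
  refine hθ.1.ne_zero_of_pow_eq_one hq (k := k) (d := d) (Subtype.ext ?_) ?_ hqd
  · rw [SubmonoidClass.coe_pow]
    exact pow_eq_one_of_partition fun r hr' => hr r ((Multiset.mem_sort _).2 hr')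
  · have h1 := two_mul_apply_one hn hlam hθ
    rw [spechtCharacter_one, hd] at h1
    push_cast at h1
    exact mul_left_cancel₀ two_ne_zero h1

end Classes

/-! ### Small degrees -/

section SmallDegrees

open Equiv.Perm

variable {n p : ℕ} {lam : YoungDiagram}

/-- The table as a list. -/
def altList : List (ℕ × List ℕ × ℕ) :=
  [(3, [2, 1], 3),
   (4, [2, 2], 2), (4, [3, 1], 3), (4, [2, 2], 3),
   (5, [4, 1], 2), (5, [3, 1, 1], 3), (5, [3, 2], 5),
   (6, [3, 2, 1], 2), (6, [4, 2], 3), (6, [5, 1], 5), (6, [3, 3], 5),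
   (8, [5, 2, 1], 2),
   (9, [7, 2], 3)]

theorem mem_altTable {x : ℕ × List ℕ × ℕ} : x ∈ altTable ↔ x ∈ altList := by
  simp [altTable, altList]

/-- The cycle partitions of the even permutations of order prime to `p`. -/
def regularTypes (n p : ℕ) : List (List ℕ) :=
  (listPartitions n).filter fun l => l.all (fun r => decide (0 < r)) && l.sum == n &&
    (n + l.length) % 2 == 0 && l.all fun r => r % p != 0

theorem mem_regularTypes {l : List ℕ} :
    l ∈ regularTypes n p ↔ l ∈ listPartitions n ∧ IsRegularType n p l := by
  rw [regularTypes, List.mem_filter]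
  refine and_congr_right fun _ => ?_
  simp only [Bool.and_eq_true, List.all_eq_true, decide_eq_true_eq, beq_iff_eq, bne_iff_ne, ne_eq]
  constructor
  · rintro ⟨⟨⟨h1, h2⟩, h3⟩, h4⟩
    exact ⟨h1, h2, Nat.even_iff.2 h3, fun r hr h => h4 r hr (Nat.mod_eq_zero_of_dvd h)⟩
  · rintro ⟨h1, h2, h3, h4⟩
    exact ⟨⟨⟨h1, h2⟩, Nat.even_iff.1 h3⟩, fun r hr h => h4 r hr (Nat.dvd_of_mod_eq_zero h)⟩

/-- Whether permutations with these cycle lengths commute with an odd permutation. -/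
def commutesWithOdd (l : List ℕ) : Bool := (l.any fun r => r % 2 == 0) || !decide l.Nodup

theorem commutesWithOdd_iff {l : List ℕ} :
    commutesWithOdd l = true ↔ (∃ r ∈ l, Even r) ∨ ¬ l.Nodup := by
  simp [commutesWithOdd, Nat.even_iff]

/-- Whether some value of the character at a class of even permutations of order prime to `p`
vanishes, and also the values of its constituents on the alternating group. -/
def hasVanishing (n p : ℕ) (l : List ℕ) : Bool :=
  (regularTypes n p).any fun t =>
    (commutesWithOdd t || conjList l != l) && mnVal t (betaList l) == 0

theorem not_isQuasiSteinberg_of_hasVanishing (hn : 2 ≤ n) (hp : p.Prime) {T : Tableau n lam}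
    {θ : alternatingGroup (Fin n) → ℂ} (hθ : IsAltSpechtCharacter T θ)
    (h : hasVanishing n p lam.rowLens = true) : ¬ IsQuasiSteinberg p θ := by
  intro hq
  rw [hasVanishing, List.any_eq_true] at h
  obtain ⟨t, ht, h1⟩ := h
  rw [Bool.and_eq_true, Bool.or_eq_true, beq_iff_eq, bne_iff_ne, commutesWithOdd_iff] at h1
  refine mnVal_ne_zero_of_isQuasiSteinberg hn hp hθ hq (mem_regularTypes.1 ht).2 ?_ h1.2
  rw [ne_eq, transpose_eq_self_iff]
  exact h1.1.symm

/-- Membership in the table, up to conjugation. -/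
def inTable (n : ℕ) (l : List ℕ) (p : ℕ) : Bool :=
  altList.contains (n, l, p) || altList.contains (n, conjList l, p)

theorem inTable_iff : inTable n lam.rowLens p = true ↔
    (n, lam.rowLens, p) ∈ altTable ∨ (n, lam.transpose.rowLens, p) ∈ altTable := by
  rw [inTable, Bool.or_eq_true, List.contains_iff_mem, List.contains_iff_mem, mem_altTable,
    mem_altTable, rowLens_transpose]

-- The finite search. Besides the table, it omits the primes not dividing |A_n| and the one case
-- (3,3,2), n = 8, p = 3, where this criterion is not applied.
set_option maxRecDepth 100000 in
theorem hasVanishing_of_le : ((List.range 15).drop 3).all (fun n =>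
    [2, 3, 5, 7, 11, 13].all fun p =>
      n < p || (n == 3 && p == 2) || (listPartitions n).all fun l =>
        l == [n] || l == List.replicate n 1 || inTable n l p ||
          (n == 8 && p == 3 && l == [3, 3, 2]) || hasVanishing n p l) = true := by
  decide +kernel

theorem prime_mem_of_le (hp : p.Prime) (h : p ≤ 14) : p ∈ [2, 3, 5, 7, 11, 13] := by
  interval_cases p <;> first | decide | (exfalso; revert hp; norm_num)

theorem card_alternatingGroup_fin (hn : 2 ≤ n) :
    Nat.card (alternatingGroup (Fin n)) = n.factorial / 2 := by
  have : Nontrivial (Fin n) := Fin.nontrivial_iff_two_le.2 hn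
  rw [nat_card_alternatingGroup, Nat.card_fin]

theorem le_of_dvd_card (hn : 2 ≤ n) (hp : p.Prime)
    (h : p ∣ Nat.card (alternatingGroup (Fin n))) : p ≤ n ∧ ¬ (n = 3 ∧ p = 2) := by
  have : Nontrivial (Fin n) := Fin.nontrivial_iff_two_le.2 hn
  constructor
  · have h2 : p ∣ Nat.card (Equiv.Perm (Fin n)) := by
      rw [← two_mul_nat_card_alternatingGroup]
      exact h.mul_left 2
    rw [Nat.card_perm, Nat.card_fin] at h2
    exact hp.dvd_factorial.1 h2
  · rintro ⟨rfl, rfl⟩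
    rw [card_alternatingGroup_fin hn] at h
    revert h
    decide

theorem inTable_of_isQuasiSteinberg_of_le (hn : 3 ≤ n) (hn' : n ≤ 14) (hp : p.Prime)
    {T : Tableau n lam} {θ : alternatingGroup (Fin n) → ℂ} (hθ : IsAltSpechtCharacter T θ)
    (h1 : lam.rowLens ≠ [n]) (h2 : lam.rowLens ≠ List.replicate n 1) (hq : IsQuasiSteinberg p θ) :
    inTable n lam.rowLens p = true ∨ (n = 8 ∧ p = 3 ∧ lam.rowLens = [3, 3, 2]) := by
  obtain ⟨h3, h4⟩ := le_of_dvd_card (by omega) hp hq.1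
  have h := List.all_eq_true.1 hasVanishing_of_le n (by
    rw [show (List.range 15).drop 3 = [3, 4, 5, 6, 7, 8, 9, 10, 11, 12, 13, 14] by decide]
    simp only [List.mem_cons, List.not_mem_nil]
    omega)
  replace h := List.all_eq_true.1 h p (prime_mem_of_le hp (h3.trans hn'))
  simp only [Bool.or_eq_true, decide_eq_true_eq, Bool.and_eq_true, beq_iff_eq] at h
  rcases h with (h | h) | h
  · exact absurd h3 (not_le.2 h)
  · exact absurd h h4
  · replace h := List.all_eq_true.1 h _ (rowLens_mem_listPartitions T)
    simp only [Bool.or_eq_true, Bool.and_eq_true, beq_iff_eq] at h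
    rcases h with (((h | h) | h) | h) | h
    · exact absurd h h1
    · exact absurd h h2
    · exact Or.inl h
    · exact Or.inr ⟨h.1.1, h.1.2, h.2⟩
    · exact absurd hq (not_isQuasiSteinberg_of_hasVanishing (by omega) hp hθ h)

/-- A certificate that the constituents of a character are quasi Steinberg. -/
def isNonvanishing (n : ℕ) (l : List ℕ) (p : ℕ) : Bool :=
  (n.factorial / 2) % p == 0 &&
  if conjList l = l then
    let d := (mnVal (List.replicate n 1) (betaList l)).toNat / 2
    mnVal (List.replicate n 1) (betaList l) == 2 * d && (regularTypes n p).all fun t =>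
      -- The exponent 3 suffices: the self-conjugate entries of the table have n ≤ 6, so prime power
      -- cycle lengths divide q³.
      [2, 3, 5].any fun q => d % q != 0 && t.all fun r => q ^ 3 % r == 0
  else (regularTypes n p).all fun t => mnVal t (betaList l) != 0

set_option maxRecDepth 100000 in
theorem isNonvanishing_of_mem_altList :
    altList.all (fun x => 2 ≤ x.1 && [2, 3, 5].contains x.2.2 && isNonvanishing x.1 x.2.1 x.2.2) =
      true := by
  decide +kernel

theorem isQuasiSteinberg_of_isNonvanishing (hn : 2 ≤ n) (hp : p.Prime) {T : Tableau n lam}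
    {θ : alternatingGroup (Fin n) → ℂ} (hθ : IsAltSpechtCharacter T θ)
    (h : isNonvanishing n lam.rowLens p = true) : IsQuasiSteinberg p θ := by
  rw [isNonvanishing, Bool.and_eq_true, beq_iff_eq, ← card_alternatingGroup_fin hn] at h
  obtain ⟨hc, h⟩ := h
  replace hc := Nat.dvd_of_mod_eq_zero hc
  split_ifs at h with hl
  · simp only [Bool.and_eq_true, beq_iff_eq] at h
    obtain ⟨h1, h2⟩ := h
    refine isQuasiSteinberg_of_prime_pow hn hp hθ hc ((transpose_eq_self_iff lam).2 hl) h1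
      fun t ht hr => ?_
    replace h2 := List.all_eq_true.1 h2 t (mem_regularTypes.2 ⟨ht, hr⟩)
    rw [List.any_eq_true] at h2
    obtain ⟨q, hq, h3⟩ := h2
    rw [Bool.and_eq_true, bne_iff_ne, List.all_eq_true] at h3
    refine ⟨q, 3, ?_, fun hd => h3.1 (Nat.mod_eq_zero_of_dvd hd), fun r hr' =>
      Nat.dvd_of_mod_eq_zero (beq_iff_eq.1 (h3.2 r hr'))⟩
    simp only [List.mem_cons, List.not_mem_nil, or_false] at hq
    rcases hq with rfl | rfl | rfl <;> norm_num
  · refine isQuasiSteinberg_of_mnVal_ne_zero hp hθ hc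
      (fun h' => hl ((transpose_eq_self_iff lam).1 h')) fun t ht hr => ?_
    exact bne_iff_ne.1 (List.all_eq_true.1 h t (mem_regularTypes.2 ⟨ht, hr⟩))

theorem isQuasiSteinberg_of_mem_altTable {T : Tableau n lam}
    {θ : alternatingGroup (Fin n) → ℂ} (hθ : IsAltSpechtCharacter T θ)
    (h : (n, lam.rowLens, p) ∈ altTable) : IsQuasiSteinberg p θ := by
  have h1 := List.all_eq_true.1 isNonvanishing_of_mem_altList _ (mem_altTable.1 h)
  simp only [Bool.and_eq_true, decide_eq_true_eq] at h1
  obtain ⟨⟨h2, h3⟩, h4⟩ := h1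
  refine isQuasiSteinberg_of_isNonvanishing h2 ?_ hθ h4
  rw [List.contains_iff_mem] at h3
  simp only [List.mem_cons, List.not_mem_nil, or_false] at h3
  rcases h3 with rfl | rfl | rfl <;> norm_num

/-! ### The partition `(3, 3, 2)` -/

/-- The embedding of permutations that adds a fixed point. -/
def extendPerm (n : ℕ) : Equiv.Perm (Fin n) →* Equiv.Perm (Fin (n + 1)) :=
  Equiv.Perm.extendDomainHom
    (finSuccAboveEquiv (Fin.last n) : Fin n ≃ {x : Fin (n + 1) // x ≠ Fin.last n})

theorem parts_extendPerm (g : Equiv.Perm (Fin n)) :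
    (extendPerm n g).partition.parts = 1 ::ₘ g.partition.parts := by
  have h : (extendPerm n g).cycleType = g.cycleType := cycleType_extendDomain _
  have h1 := g.support.card_le_univ
  rw [Fintype.card_fin] at h1
  rw [parts_partition, parts_partition, ← sum_cycleType, ← sum_cycleType, h, Fintype.card_fin,
    Fintype.card_fin, sum_cycleType, Nat.succ_sub h1, Multiset.replicate_succ, Multiset.add_cons]

/-- The embedding of alternating groups that adds a fixed point. -/
def extendAlt (n : ℕ) : alternatingGroup (Fin n) →* alternatingGroup (Fin (n + 1)) :=
  ((extendPerm n).comp (alternatingGroup (Fin n)).subtype).codRestrict _ fun g => by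
    have := g.2
    rw [mem_alternatingGroup] at this
    rw [mem_alternatingGroup]
    exact (sign_extendDomain _ _).trans this

theorem extendAlt_coe (g : alternatingGroup (Fin n)) :
    (extendAlt n g : Equiv.Perm (Fin (n + 1))) = extendPerm n g := rfl

/-- If the restriction of `θ + θ'` is twice an irreducible character, then both restrictions are
multiples of it. -/
theorem exists_comp_eq_nsmul {G H : Type*} [Group G] [Group H] [Fintype H] (f : H →* G)
    {θ θ' : G → ℂ} (hθ : IsIrreducibleCharacter θ) (hθ' : IsIrreducibleCharacter θ') {ψ : H → ℂ}
    (hψ : IsIrreducibleCharacter ψ) (h : ∀ g, θ (f g) + θ' (f g) = 2 * ψ g) :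
    ∃ k : ℕ, ∀ g, θ (f g) = k * ψ g := by
  classical
  obtain ⟨d, ρ, hρ, rfl⟩ := hθ
  obtain ⟨d', ρ', hρ', rfl⟩ := hθ'
  obtain ⟨L, hL, hLs⟩ := exists_multiset_sum_eq_character (ρ.comp f)
  obtain ⟨L', hL', hLs'⟩ := exists_multiset_sum_eq_character (ρ'.comp f)
  have hsum : L.sum + L'.sum = (2 : ℂ) • ψ := by
    rw [← hLs, ← hLs']
    funext g
    exact h g
  have hall : ∀ φ ∈ L, φ = ψ := by
    intro φ hφ
    by_contra hne
    have h1 := congrArg (fun F => charInner F φ) hsum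
    simp only [charInner_add_left, charInner_smul_left,
      charInner_multiset_sum_irreducible hL (hL φ hφ),
      charInner_multiset_sum_irreducible hL' (hL φ hφ), charInner_irreducible hψ (hL φ hφ)] at h1
    rw [if_neg fun h => hne h.symm, mul_zero] at h1
    norm_cast at h1
    have := Multiset.count_pos.2 hφ
    omega
  refine ⟨L.card, fun g => ?_⟩
  have h2 := congrFun hLs g
  rw [Multiset.eq_replicate_card.2 hall, Multiset.sum_replicate] at h2
  exact h2.trans (by simp)

set_option maxRecDepth 100000 in
theorem mnVal_branching : (listPartitions 7).all (fun t => mnVal (1 :: t) (betaList [3, 3, 2]) ==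
    mnVal t (betaList [3, 2, 2]) + mnVal t (betaList [3, 3, 1])) = true := by
  decide +kernel

/-- On S_7 the character of (3,3,2) branches into those of the conjugate partitions (3,2,2) and
(3,3,1), whose restrictions to A_7 are one irreducible ψ. Both halves therefore restrict to
multiples of ψ. -/
theorem not_isQuasiSteinberg_three_three_two {T : Tableau 8 lam}
    (hlam : lam.rowLens = [3, 3, 2]) {θ : alternatingGroup (Fin 8) → ℂ}
    (hθ : IsAltSpechtCharacter T θ) : ¬ IsQuasiSteinberg 3 θ := by
  intro hq
  obtain ⟨mu, hmu⟩ : ∃ mu : YoungDiagram, mu.rowLens = [3, 2, 2] :=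
    ⟨YoungDiagram.ofRowLens [3, 2, 2] (by decide),
      YoungDiagram.rowLens_ofRowLens_eq_self (by decide)⟩
  obtain ⟨S⟩ : Nonempty (Tableau 7 mu) := nonempty_tableau (by rw [hmu]; rfl)
  have hmu' : mu.transpose.rowLens = [3, 3, 1] := by
    rw [rowLens_transpose, hmu]
    decide
  have hself : lam.transpose = lam := by
    rw [transpose_eq_self_iff, hlam]
    decide
  have hne : mu.transpose ≠ mu := by
    rw [ne_eq, transpose_eq_self_iff, hmu]
    decide
  obtain ⟨h1, ⟨h2, -⟩ | ⟨-, θ', h2, h3, h4⟩⟩ := hθ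
  · exact h2 hself
  obtain ⟨k, hk⟩ := exists_comp_eq_nsmul (extendAlt 7) h1 h2
    (isIrreducibleCharacter_spechtCharacterAlt (by norm_num) S hne) fun g => by
      have h5 := congrFun h4 (extendAlt 7 g)
      rw [Pi.add_apply] at h5
      rw [← h5, spechtCharacterAlt, extendAlt_coe]
      have hb := beq_iff_eq.1 (List.all_eq_true.1 mnVal_branching _
        (sort_parts_mem_listPartitions (g : Equiv.Perm (Fin 7))))
      have hs := Multiset.sort_eq (g : Equiv.Perm (Fin 7)).partition.parts (· ≥ ·)
      rw [spechtCharacter_eq_mnVal T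
        (l := 1 :: (g : Equiv.Perm (Fin 7)).partition.parts.sort (· ≥ ·)) _ (by rw [parts_extendPerm, ← Multiset.cons_coe, hs]), hlam, hb]
      rw [two_mul]
      nth_rewrite 2 [← spechtCharacterAlt_transposeTableau S]
      rw [spechtCharacterAlt, spechtCharacterAlt, spechtCharacter_eq_mnVal S _ hs,
        spechtCharacter_eq_mnVal (transposeTableau S) _ hs, hmu, hmu']
      push_cast
      rfl
  -- A 7-cycle is 3-regular and ψ vanishes on it. In A_8 its cycle lengths 7, 1 are odd and
  -- distinct, so the halving argument is unavailable there.
  have hreg : IsRegularType 7 3 [7] := ⟨by decide, rfl, by decide, by decide⟩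
  obtain ⟨g, hg, hg3⟩ := hreg.exists_perm Nat.prime_three
  refine hq.2.2 (extendAlt 7 g) ?_ ?_
  · rw [orderOf_alt, dvd_orderOf_iff Nat.prime_three, extendAlt_coe, parts_extendPerm, ← hg]
    rintro ⟨r, hr, h⟩
    rw [Multiset.mem_cons, Multiset.mem_coe, List.mem_singleton] at hr
    rcases hr with rfl | rfl <;> revert h <;> decide
  · rw [hk, spechtCharacterAlt, spechtCharacter_eq_mnVal S _ hg, hmu]
    have : mnVal [7] (betaList [3, 2, 2]) = 0 := by decide +kernel
    rw [this, Int.cast_zero, mul_zero]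

end SmallDegrees

/-! ### Large degrees -/

section LargeDegrees

open Equiv.Perm

variable {n p : ℕ} {lam : YoungDiagram}

/-- A nonzero value of the Murnaghan–Nakayama recursion yields a hook. -/
theorem exists_hook_of_mnVal_ne_zero {m : ℕ} {σ : List ℕ} (hm : 0 < m)
    (h : mnVal (m :: σ) (betaList lam.rowLens) ≠ 0) :
    ∃ i j, j < lam.rowLen i ∧ lam.rowLen i + lam.colLen j = m + i + j + 1 := by
  obtain ⟨N, hN⟩ : ∃ N, N = lam.colLen 0 := ⟨_, rfl⟩
  rw [← ofFn_shiftedRows, mnVal, List.length_ofFn, sum_map_range_eq_sum_fin, ← hN] at h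
  obtain ⟨i, -, hi⟩ := Finset.exists_ne_zero_of_sum_ne_zero h
  rw [getD_ofFn] at hi
  obtain ⟨hle, hc⟩ : m ≤ shiftedRows N lam i ∧
      shiftedRows N lam i - m ∉ List.ofFn (shiftedRows N lam) := by
    by_contra hcon
    exact hi (if_neg hcon)
  set c := shiftedRows N lam i - m with hcdef
  have hcne : ∀ k < N, lam.rowLen k + (N - 1 - k) ≠ c := fun k hk hkc =>
    hc (List.mem_ofFn.2 ⟨⟨k, hk⟩, hkc⟩)
  have hx : shiftedRows N lam i = lam.rowLen i + (N - 1 - i) := rfl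
  have hiN := i.2
  have hex : ∃ k, N ≤ k ∨ lam.rowLen k + (N - 1 - k) < c := ⟨N, Or.inl le_rfl⟩
  classical
  -- C counts the beads above the vacant position c. The hook has its foot in row C - 1 and lies
  -- over the column c - (N - C), the number of vacancies below c.
  set C := Nat.find hex with hC
  have hCN : C ≤ N := Nat.find_min' hex (Or.inl le_rfl)
  have hbig : ∀ k < C, c < lam.rowLen k + (N - 1 - k) := fun k hk => by
    have := Nat.find_min hex hk
    push Not at this
    exact lt_of_le_of_ne this.2 (hcne k this.1).symm
  have hiC : (i : ℕ) < C := by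
    by_contra hcon
    rcases Nat.find_spec hex with h1 | h1
    · omega
    · have := lam.rowLen_anti C i (not_lt.1 hcon)
      rw [← hC] at h1
      omega
  have hpos : ∀ k < N, 0 < lam.rowLen k := fun k hk => by
    rw [← YoungDiagram.mem_iff_lt_rowLen, YoungDiagram.mem_iff_lt_colLen, ← hN]
    exact hk
  have hNc : N - C ≤ c := by
    rcases Nat.find_spec hex with h1 | h1
    · omega
    · rw [← hC] at h1
      rcases Nat.lt_or_ge C N with h2 | h2
      · have := hpos C h2
        omega
      · omega
  have hlast : c + C - N < lam.rowLen (C - 1) := by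
    have := hbig (C - 1) (by omega)
    omega
  have hcol : lam.colLen (c + C - N) = C := by
    refine le_antisymm ?_ ?_
    · rcases Nat.find_spec hex with h1 | h1
      · rw [← hC] at h1
        exact (lam.colLen_anti 0 _ (Nat.zero_le _)).trans (hN ▸ h1)
      · rw [← hC] at h1
        by_contra hcon
        rw [not_le, ← YoungDiagram.mem_iff_lt_colLen, YoungDiagram.mem_iff_lt_rowLen] at hcon
        rcases Nat.lt_or_ge C N with h2 | h2
        · omega
        · have h3 : lam.rowLen C = 0 := by
            by_contra h3
            have := YoungDiagram.mem_iff_lt_rowLen.2 (Nat.pos_of_ne_zero h3)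
            rw [YoungDiagram.mem_iff_lt_colLen] at this
            omega
          omega
    · have := YoungDiagram.mem_iff_lt_rowLen.2 hlast
      rw [YoungDiagram.mem_iff_lt_colLen] at this
      omega
  refine ⟨i, c + C - N, lt_of_lt_of_le hlast (lam.rowLen_anti _ _ (by omega)), ?_⟩
  rw [hcol]
  omega

/-- Rows 0 to i have at least λ_i cells each, and the rows of the leg have at least j + 1 each. -/
theorem hook_le_sum {i j : ℕ} (h : j < lam.rowLen i) :
    (i + 1) * lam.rowLen i + (lam.colLen j - i - 1) * (j + 1) ≤ lam.rowLens.sum := by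
  have hi : i < lam.colLen j := by
    rwa [← YoungDiagram.mem_iff_lt_colLen, YoungDiagram.mem_iff_lt_rowLen]
  have h0 : lam.rowLens.sum = ∑ k ∈ Finset.range (lam.colLen 0), lam.rowLen k := rfl
  have h1 : ∑ k ∈ Finset.range (lam.colLen j), lam.rowLen k ≤ lam.rowLens.sum := by
    rw [h0]
    exact Finset.sum_le_sum_of_subset
      (Finset.range_subset_range.2 (lam.colLen_anti 0 j (Nat.zero_le j)))
  refine le_trans ?_ h1
  have h2 : lam.colLen j = (i + 1) + (lam.colLen j - i - 1) := by omega
  conv_rhs => rw [h2, Finset.sum_range_add]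
  refine add_le_add ?_ ?_
  · have := Finset.card_nsmul_le_sum (Finset.range (i + 1)) (fun k => lam.rowLen k) (lam.rowLen i)
      fun k hk => lam.rowLen_anti k i (by rw [Finset.mem_range] at hk; omega)
    simpa using this
  · have := Finset.card_nsmul_le_sum (Finset.range (lam.colLen j - i - 1))
      (fun k => lam.rowLen (i + 1 + k)) (j + 1) fun k hk => by
        rw [Finset.mem_range] at hk
        have : i + 1 + k < lam.colLen j := by omega
        rw [← YoungDiagram.mem_iff_lt_colLen, YoungDiagram.mem_iff_lt_rowLen] at this
        exact this
    simpa using this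

/-- A long hook away from the first row forces a long first column. -/
theorem le_colLen_of_hook {m i j D : ℕ} (hs : lam.rowLens.sum = n) (h : j < lam.rowLen i)
    (hm : lam.rowLen i + lam.colLen j = m + i + j + 1) (hi : 0 < i) (hD : n ≤ m + D)
    (hn : 2 * D < n) : n + 2 ≤ lam.colLen 0 + 2 * D := by
  have h1 := hook_le_sum h
  have hiC : i < lam.colLen j := by
    rwa [← YoungDiagram.mem_iff_lt_colLen, YoungDiagram.mem_iff_lt_rowLen]
  obtain ⟨L, hL⟩ : ∃ L, lam.colLen j = i + 1 + L := ⟨lam.colLen j - i - 1, by omega⟩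
  have h2 : lam.colLen j - i - 1 = L := by omega
  rw [hs, h2, add_mul, mul_add, one_mul, mul_one] at h1
  have h3 : lam.rowLen i ≤ i * lam.rowLen i := Nat.le_mul_of_pos_left _ hi
  -- In column 0 the arm has size at most D, which leaves a long leg. With j > 0 every cell of the
  -- hook would count at least twice in n, contradicting 2D < n.
  rcases Nat.eq_zero_or_pos j with rfl | hj
  · omega
  · have h4 : L ≤ L * j := Nat.le_mul_of_pos_right _ hj
    omega

/-- The corner (0, 0) has a single hook length, so one of the two hooks lies off the corner;
transposition reduces the case of the first row to that of the first column. -/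
theorem long_of_two_hooks (T : Tableau n lam) {m m' D : ℕ} {σ σ' : List ℕ} (hne : m ≠ m')
    (hD : n ≤ m + D) (hD' : n ≤ m' + D) (hn : 2 * D < n)
    (h : mnVal (m :: σ) (betaList lam.rowLens) ≠ 0)
    (h' : mnVal (m' :: σ') (betaList lam.rowLens) ≠ 0) :
    n + 2 ≤ lam.colLen 0 + 2 * D ∨ n + 2 ≤ lam.rowLen 0 + 2 * D := by
  have key : ∀ {m i j : ℕ}, n ≤ m + D → j < lam.rowLen i →
      lam.rowLen i + lam.colLen j = m + i + j + 1 → (i = 0 ∧ j = 0) ∨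
      n + 2 ≤ lam.colLen 0 + 2 * D ∨ n + 2 ≤ lam.rowLen 0 + 2 * D := by
    intro m i j hD h1 h2
    rcases Nat.eq_zero_or_pos i with hi | hi
    · rcases Nat.eq_zero_or_pos j with hj | hj
      · exact Or.inl ⟨hi, hj⟩
      · right; right
        rw [← YoungDiagram.colLen_transpose]
        refine le_colLen_of_hook (lam := lam.transpose) (sum_rowLens (transposeTableau T))
          (i := j) (j := i) (m := m) ?_ ?_ hj hD hn
        · rw [YoungDiagram.rowLen_transpose, ← YoungDiagram.mem_iff_lt_colLen,
            YoungDiagram.mem_iff_lt_rowLen]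
          exact h1
        · rw [YoungDiagram.rowLen_transpose, YoungDiagram.colLen_transpose]
          omega
    · exact Or.inr (Or.inl (le_colLen_of_hook (sum_rowLens T) h1 h2 hi hD hn))
  obtain ⟨i, j, h1, h2⟩ := exists_hook_of_mnVal_ne_zero (by omega) h
  obtain ⟨i', j', h1', h2'⟩ := exists_hook_of_mnVal_ne_zero (by omega) h'
  rcases key hD h1 h2 with ⟨rfl, rfl⟩ | h3
  · rcases key hD' h1' h2' with ⟨rfl, rfl⟩ | h3
    · omega
    · exact h3
  · exact h3

/-! ### Characters with a long first row -/

theorem mnVal_cons_cons_of_lt {m x : ℕ} {σ b : List ℕ} (hm : 0 < m) (hb : ∀ y ∈ b, y < m) :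
    mnVal (m :: σ) (x :: b) =
      if m ≤ x ∧ x - m ∉ b then mnVal σ ((x - m) :: b) else 0 := by
  rw [mnVal, List.length_cons, List.range_succ_eq_map, List.map_cons, List.sum_cons, List.map_map]
  have h0 : ((List.range b.length).map ((fun i => if m ≤ (x :: b).getD i 0 ∧
      (x :: b).getD i 0 - m ∉ x :: b then mnVal σ ((x :: b).set i ((x :: b).getD i 0 - m)) else 0) ∘
        Nat.succ)).sum = 0 := by
    refine List.sum_eq_zero fun y hy => ?_
    obtain ⟨i, hi, rfl⟩ := List.mem_map.1 hy
    rw [List.mem_range] at hi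
    rw [Function.comp_apply, List.getD_cons_succ, List.getD_eq_getElem _ _ hi, if_neg]
    intro hcon
    exact absurd hcon.1 (not_le.2 (hb _ (List.getElem_mem hi)))
  rw [h0, add_zero, List.getD_cons_zero]
  refine if_congr (and_congr_right fun h => ?_) rfl rfl
  rw [List.mem_cons, not_or]
  exact and_iff_right (by omega)

/-- The value of the character of `(n - |ν|, ν)` at a permutation with cycle lengths `n - |σ|` and
`σ`, for large `n`. -/
def tailVal (ν σ : List ℕ) : ℤ :=
  if ν.sum ≤ ν.length + σ.sum ∧ ν.length + σ.sum - ν.sum ∉ betaList ν then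
    mnVal σ ((ν.length + σ.sum - ν.sum) :: betaList ν) else 0

/-- Only the first bead is large enough to lose n - |σ|. What remains of it is |σ| - |ν| plus the
number of parts of ν, independent of n. -/
theorem mnVal_eq_tailVal {ν σ : List ℕ} (hν : ν.sum ≤ n) (hσ : σ.sum < n)
    (hb : ∀ y ∈ betaList ν, y < n - σ.sum) :
    mnVal ((n - σ.sum) :: σ) (betaList ((n - ν.sum) :: ν)) = tailVal ν σ := by
  rw [betaList, mnVal_cons_cons_of_lt (by omega) hb, tailVal]
  have h1 : n - σ.sum ≤ n - ν.sum + ν.length ↔ ν.sum ≤ ν.length + σ.sum := by omega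
  by_cases h2 : ν.sum ≤ ν.length + σ.sum
  · have h3 : n - ν.sum + ν.length - (n - σ.sum) = ν.length + σ.sum - ν.sum := by omega
    rw [h3]
    simp only [h1]
  · rw [if_neg fun h => h2 (h1.1 h.1), if_neg fun h => h2 h.1]

/-- Cycle lengths besides a long cycle. -/
def tailTypes : List (List ℕ) :=
  [[], [1], [1, 1], [2], [1, 1, 1], [2, 1], [1, 1, 1, 1], [3, 1], [4], [2, 2, 1], [3, 1, 1], [4, 1],
    [4, 2], [4, 1, 1, 1], [5, 1, 1], [4, 2, 1, 1]]

/-- The cycle lengths `σ` for which the character of `(n - |ν|, ν)` vanishes at even permutations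
with cycle lengths `n - |σ|` and `σ`, when `n` has the parity of `e`. -/
def tailZeros (e : ℕ) (ν : List ℕ) : List (List ℕ) :=
  tailTypes.filter fun σ => σ.all (fun r => decide (0 < r)) && (e + σ.length) % 2 == 1 &&
    (commutesWithOdd σ || decide (ν.sum ≤ 6)) &&
    -- With n ≥ 15 this ensures that the beads of ν are smaller than n - |σ|.
    (betaList ν).all (fun y => decide (y + σ.sum < 15)) && tailVal ν σ == 0

-- For p = 2 a zero with all cycle lengths odd is needed. For odd p, two zeros with parts powers of
-- 2 and |σ| - |σ'| ∈ {1, 2, 4}: p cannot divide both n - |σ| and n - |σ'|.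
set_option maxRecDepth 100000 in
theorem exists_mem_tailZeros : ((List.range 9).drop 1).all (fun r => (listPartitions r).all fun ν =>
    [0, 1].all fun e =>
      ((tailZeros e ν).any fun σ => σ.all (fun r => r % 2 == 1) && (e + σ.sum) % 2 == 1) &&
      (((tailZeros e ν).filter fun σ => σ.all fun r => [1, 2, 4, 8].contains r).any fun σ =>
        ((tailZeros e ν).filter fun σ => σ.all fun r => [1, 2, 4, 8].contains r).any fun σ' =>
          [1, 2, 4].contains (σ.sum - σ'.sum))) = true := by
  decide +kernel

theorem not_dvd_of_mem_powers (hp : p.Prime) (hp2 : p ≠ 2) {r : ℕ} (h : r ∈ [1, 2, 4, 8]) :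
    ¬ p ∣ r := by
  intro hpr
  have h2 : r ∣ 2 ^ 3 := by
    simp only [List.mem_cons, List.not_mem_nil, or_false] at h
    rcases h with rfl | rfl | rfl | rfl <;> norm_num
  exact hp2 ((Nat.prime_dvd_prime_iff_eq hp Nat.prime_two).1 (hp.dvd_of_dvd_pow (hpr.trans h2)))

theorem mod_two_mem (n : ℕ) : n % 2 ∈ [0, 1] := by
  rcases Nat.mod_two_eq_zero_or_one n with h | h <;> simp [h]

theorem not_isQuasiSteinberg_of_le_rowLen (hn : 15 ≤ n) (hp : p.Prime) {T : Tableau n lam}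
    {θ : alternatingGroup (Fin n) → ℂ} (hθ : IsAltSpechtCharacter T θ) (hrow : lam.rowLens ≠ [n])
    (hle : n ≤ lam.rowLen 0 + 8) : ¬ IsQuasiSteinberg p θ := by
  intro hq
  have hsum := sum_rowLens T
  obtain ⟨x, ν, hxν⟩ : ∃ x ν, lam.rowLens = x :: ν := by
    rcases h : lam.rowLens with _ | ⟨x, ν⟩
    · rw [h] at hsum
      simp at hsum
      omega
    · exact ⟨x, ν, rfl⟩
  have hx : x = lam.rowLen 0 := by
    rw [← headD_rowLens, hxν]
    rfl
  rw [hxν, List.sum_cons] at hsum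
  have hpos : ∀ r ∈ ν, 0 < r := fun r hr =>
    lam.pos_of_mem_rowLens r (by rw [hxν]; exact List.mem_cons_of_mem _ hr)
  have hsort : ν.Pairwise (· ≥ ·) := by
    have := lam.rowLens_sorted.pairwise
    rw [hxν, List.pairwise_cons] at this
    exact this.2
  have hν0 : 0 < ν.sum := by
    rcases ν with _ | ⟨y, ν⟩
    · exact absurd (by rw [hxν]; simp at hsum; rw [hsum]) hrow
    · have := hpos y List.mem_cons_self
      rw [List.sum_cons]
      omega
  have hxn : x = n - ν.sum := by omega
  have hcheck := List.all_eq_true.1 exists_mem_tailZeros ν.sum (by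
    rw [show (List.range 9).drop 1 = [1, 2, 3, 4, 5, 6, 7, 8] by decide]
    simp only [List.mem_cons, List.not_mem_nil]
    omega)
  replace hcheck := List.all_eq_true.1 (List.all_eq_true.1 hcheck ν (mem_listPartitions hsort hpos))
    (n % 2) (mod_two_mem n)
  rw [Bool.and_eq_true, List.any_eq_true, List.any_eq_true] at hcheck
  -- The first column has at most |ν| + 1 ≤ 7 cells, the first row at least 9. For |ν| = 7 this
  -- fails, as (8, 1⁷) shows.
  have hself : ν.sum ≤ 6 → lam.transpose ≠ lam := by
    intro h6 hlam
    have h1 : lam.colLen 0 = lam.rowLen 0 := by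
      conv_rhs => rw [← hlam, YoungDiagram.rowLen_transpose]
    have h2 := length_le_sum_of_pos hpos
    have h3 : lam.rowLens.length = lam.colLen 0 := YoungDiagram.length_rowLens
    rw [hxν, List.length_cons] at h3
    omega
  -- A quasi p-Steinberg character can vanish at such a class only if p divides a cycle length, and
  -- the long cycle is the only candidate.
  have key : ∀ σ ∈ tailZeros (n % 2) ν, (∀ r ∈ σ, ¬ p ∣ r) → p ∣ n - σ.sum := by
    intro σ hσ hσp
    by_contra hdvd
    rw [tailZeros, List.mem_filter] at hσ
    simp only [Bool.and_eq_true, Bool.or_eq_true, List.all_eq_true, decide_eq_true_eq,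
      beq_iff_eq, commutesWithOdd_iff] at hσ
    obtain ⟨hσs, ⟨⟨⟨h1, h2⟩, h3⟩, h4⟩, h5⟩ := hσ
    have hσ9 : σ.sum < n := by
      by_contra hcon
      rw [not_lt] at hcon
      have : ν ≠ [] := by
        rintro rfl
        simp at hν0
      obtain ⟨y, ν', rfl⟩ := List.exists_cons_of_ne_nil this
      have := h4 (y + ν'.length) (by rw [betaList]; exact List.mem_cons_self)
      omega
    have hreg : IsRegularType n p ((n - σ.sum) :: σ) := by
      refine ⟨?_, ?_, ?_, ?_⟩
      · rw [List.forall_mem_cons]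
        exact ⟨by omega, h1⟩
      · rw [List.sum_cons]
        omega
      · rw [List.length_cons, Nat.even_iff]
        omega
      · rw [List.forall_mem_cons]
        exact ⟨hdvd, hσp⟩
    refine mnVal_ne_zero_of_isQuasiSteinberg (by omega) hp hθ hq hreg ?_ ?_
    · rcases h3 with (⟨r, hr, her⟩ | h3) | h3
      · exact Or.inr (Or.inl ⟨r, List.mem_cons_of_mem _ hr, her⟩)
      · exact Or.inr (Or.inr fun hnd => h3 (List.nodup_cons.1 hnd).2)
      · exact Or.inl (hself h3)
    · rw [hxν, hxn, mnVal_eq_tailVal (by omega) hσ9 fun y hy => by have := h4 y hy; omega]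
      exact h5
  by_cases hp2 : p = 2
  · obtain ⟨σ, hσ, h1⟩ := hcheck.1
    simp only [Bool.and_eq_true, List.all_eq_true, beq_iff_eq] at h1
    have := key σ hσ fun r hr => by
      have := h1.1 r hr
      rw [hp2]
      omega
    rw [hp2] at this
    have h2 : σ.sum < n ∨ n ≤ σ.sum := lt_or_ge _ _
    rcases h2 with h2 | h2
    · omega
    · rw [tailZeros, List.mem_filter] at hσ
      simp only [Bool.and_eq_true, List.all_eq_true, decide_eq_true_eq] at hσ
      have : ν ≠ [] := by
        rintro rfl
        simp at hν0
      obtain ⟨y, ν', rfl⟩ := List.exists_cons_of_ne_nil this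
      have := hσ.2.1.2 (y + ν'.length) (by rw [betaList]; exact List.mem_cons_self)
      omega
  · obtain ⟨σ, hσ, h1⟩ := hcheck.2
    rw [List.any_eq_true] at h1
    obtain ⟨σ', hσ', h2⟩ := h1
    rw [List.mem_filter, List.all_eq_true] at hσ hσ'
    simp only [List.contains_iff_mem] at hσ hσ' h2
    have h3 := key σ hσ.1 fun r hr => not_dvd_of_mem_powers hp hp2 (hσ.2 r hr)
    have h4 := key σ' hσ'.1 fun r hr => not_dvd_of_mem_powers hp hp2 (hσ'.2 r hr)
    have h5 : σ.sum - σ'.sum ∈ [1, 2, 4, 8] := by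
      simp only [List.mem_cons, List.not_mem_nil, or_false] at h2 ⊢
      omega
    refine not_dvd_of_mem_powers hp hp2 h5 ?_
    have h6 : σ.sum < n := by
      rw [tailZeros, List.mem_filter] at hσ
      simp only [Bool.and_eq_true, List.all_eq_true, decide_eq_true_eq] at hσ
      have : ν ≠ [] := by
        rintro rfl
        simp at hν0
      obtain ⟨y, ν', rfl⟩ := List.exists_cons_of_ne_nil this
      have := hσ.1.2.1.2 (y + ν'.length) (by rw [betaList]; exact List.mem_cons_self)
      omega
    have h7 : σ.sum - σ'.sum = (n - σ'.sum) - (n - σ.sum) := by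
      omega
    rw [h7]
    exact Nat.dvd_sub h4 h3

theorem mnVal_ne_zero_of_small (hn : 15 ≤ n) (hp : p.Prime) {T : Tableau n lam}
    {θ : alternatingGroup (Fin n) → ℂ} (hθ : IsAltSpechtCharacter T θ) (hq : IsQuasiSteinberg p θ)
    (σ : List ℕ) (hs : σ.sum ≤ 5) (hpos : ∀ r ∈ σ, 0 < r) (hodd : Odd (n + σ.length))
    (hσ : (∃ r ∈ σ, Even r) ∨ ¬ σ.Nodup) (h : ∀ r ∈ σ, ¬ p ∣ r) (hd : ¬ p ∣ n - σ.sum) :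
    mnVal ((n - σ.sum) :: σ) (betaList lam.rowLens) ≠ 0 := by
  refine mnVal_ne_zero_of_isQuasiSteinberg (by omega) hp hθ hq ⟨?_, ?_, ?_, ?_⟩ (Or.inr ?_)
  · rw [List.forall_mem_cons]
    exact ⟨by omega, hpos⟩
  · rw [List.sum_cons]
    omega
  · rw [List.length_cons, ← add_assoc]
    exact hodd.add_one
  · rw [List.forall_mem_cons]
    exact ⟨hd, h⟩
  · rcases hσ with ⟨r, hr, her⟩ | h3
    · exact Or.inl ⟨r, List.mem_cons_of_mem _ hr, her⟩
    · exact Or.inr fun hnd => h3 (List.nodup_cons.1 hnd).2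

theorem conjList_singleton (n : ℕ) : conjList [n] = List.replicate n 1 := by
  rw [conjList, List.headD_cons, List.eq_replicate_iff]
  refine ⟨by simp, fun b hb => ?_⟩
  obtain ⟨j, hj, rfl⟩ := List.mem_map.1 hb
  rw [List.mem_range] at hj
  simp [hj]

theorem not_isQuasiSteinberg_of_large (hn : 15 ≤ n) (hp : p.Prime) {T : Tableau n lam}
    {θ : alternatingGroup (Fin n) → ℂ} (hθ : IsAltSpechtCharacter T θ) (h1 : lam.rowLens ≠ [n])
    (h2 : lam.rowLens ≠ List.replicate n 1) : ¬ IsQuasiSteinberg p θ := by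
  intro hq
  have hlong : n ≤ lam.colLen 0 + 8 ∨ n ≤ lam.rowLen 0 + 8 := by
    have two : ∀ σ σ' : List ℕ, σ.sum ≤ 5 → σ'.sum ≤ 5 → σ.sum ≠ σ'.sum →
        mnVal ((n - σ.sum) :: σ) (betaList lam.rowLens) ≠ 0 →
        mnVal ((n - σ'.sum) :: σ') (betaList lam.rowLens) ≠ 0 →
        n ≤ lam.colLen 0 + 8 ∨ n ≤ lam.rowLen 0 + 8 := by
      intro σ σ' hs hs' hne h h'
      have := long_of_two_hooks T (m := n - σ.sum) (m' := n - σ'.sum) (D := 5) (by omega) (by omega)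
        (by omega) (by omega) h h'
      omega
    have test := mnVal_ne_zero_of_small hn hp hθ hq
    by_cases hp2 : p = 2
    · subst hp2
      -- For p = 2 the short cycles are fixed points, with the parity of their number chosen to make
      -- the long cycle odd; two or more fixed points give an odd centralizing transposition.
      rcases Nat.even_or_odd n with he | ho
      · refine two [1, 1, 1] [1, 1, 1, 1, 1] (by decide) (by decide) (by decide)
          (test _ (by decide) (by decide) (he.add_odd (by decide)) (by decide) (by decide) ?_)
          (test _ (by decide) (by decide) (he.add_odd (by decide)) (by decide) (by decide) ?_)
        · simp; grind
        · simp; grind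
      · refine two [1, 1] [1, 1, 1, 1] (by decide) (by decide) (by decide)
          (test _ (by decide) (by decide) (ho.add_even (by decide)) (by decide) (by decide) ?_)
          (test _ (by decide) (by decide) (ho.add_even (by decide)) (by decide) (by decide) ?_)
        · simp; grind
        · simp; grind
    · have hpow : ∀ σ : List ℕ, (∀ r ∈ σ, r ∈ [1, 2, 4, 8]) → ∀ r ∈ σ, ¬ p ∣ r :=
        fun σ h r hr => not_dvd_of_mem_powers hp hp2 (h r hr)
      -- Among n - 2, n - 3, n - 4 an odd prime divides at most one, since the differences are 1 and
      -- 2. Two of the three classes thus remain available.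
      have hdiff : ∀ a b : ℕ, 2 ≤ a → a < b → b ≤ 4 → p ∣ n - a → ¬ p ∣ n - b := by
        intro a b ha hab hb h3 h4
        have h5 := Nat.dvd_sub h3 h4
        have h6 : n - a - (n - b) = b - a := by omega
        rw [h6] at h5
        refine not_dvd_of_mem_powers hp hp2 ?_ h5
        have : b - a = 1 ∨ b - a = 2 := by omega
        rcases this with h | h <;> rw [h] <;> decide
      have choose : ∀ σ₂ σ₃ σ₄ : List ℕ, σ₂.sum = 2 → σ₃.sum = 3 → σ₄.sum = 4 →
          (¬ p ∣ n - 2 → mnVal ((n - σ₂.sum) :: σ₂) (betaList lam.rowLens) ≠ 0) →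
          (¬ p ∣ n - 3 → mnVal ((n - σ₃.sum) :: σ₃) (betaList lam.rowLens) ≠ 0) →
          (¬ p ∣ n - 4 → mnVal ((n - σ₄.sum) :: σ₄) (betaList lam.rowLens) ≠ 0) →
          n ≤ lam.colLen 0 + 8 ∨ n ≤ lam.rowLen 0 + 8 := by
        intro σ₂ σ₃ σ₄ e2 e3 e4 t2 t3 t4
        by_cases d2 : p ∣ n - 2
        · exact two σ₃ σ₄ (by omega) (by omega) (by omega)
            (t3 (hdiff 2 3 (by omega) (by omega) (by omega) d2))
            (t4 (hdiff 2 4 (by omega) (by omega) (by omega) d2))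
        · by_cases d3 : p ∣ n - 3
          · exact two σ₂ σ₄ (by omega) (by omega) (by omega) (t2 d2)
              (t4 (hdiff 3 4 (by omega) (by omega) (by omega) d3))
          · exact two σ₂ σ₃ (by omega) (by omega) (by omega) (t2 d2) (t3 d3)
      rcases Nat.even_or_odd n with he | ho
      · exact choose [2] [1, 1, 1] [2, 1, 1] rfl rfl rfl
          (test [2] (by decide) (by decide) (he.add_odd (by decide)) (by decide)
            (hpow _ (by decide)))
          (test [1, 1, 1] (by decide) (by decide) (he.add_odd (by decide)) (by decide)
            (hpow _ (by decide)))
          (test [2, 1, 1] (by decide) (by decide) (he.add_odd (by decide)) (by decide)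
            (hpow _ (by decide)))
      · exact choose [1, 1] [2, 1] [2, 2] rfl rfl rfl
          (test [1, 1] (by decide) (by decide) (ho.add_even (by decide)) (by decide)
            (hpow _ (by decide)))
          (test [2, 1] (by decide) (by decide) (ho.add_even (by decide)) (by decide)
            (hpow _ (by decide)))
          (test [2, 2] (by decide) (by decide) (ho.add_even (by decide)) (by decide)
            (hpow _ (by decide)))
  rcases hlong with h | h
  -- A long first column is a long first row of the conjugate partition, which has the same
  -- restriction to A_n.
  · refine not_isQuasiSteinberg_of_le_rowLen hn hp hθ.transpose ?_ ?_ hq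
    · intro h3
      have := rowLens_transpose lam.transpose
      rw [h3, conjList_singleton, YoungDiagram.transpose_transpose] at this
      exact h2 this
    · rwa [YoungDiagram.rowLen_transpose]
  · exact not_isQuasiSteinberg_of_le_rowLen hn hp hθ h1 h hq

end LargeDegrees

/-! ### The classification -/

section Classification

variable {n p : ℕ} {lam : YoungDiagram}

theorem isQuasiSteinberg_iff_mem_altTable (hn : 3 ≤ n) (hp : p.Prime) {T : Tableau n lam}
    {θ : alternatingGroup (Fin n) → ℂ} (hθ : IsAltSpechtCharacter T θ) (h1 : lam.rowLens ≠ [n])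
    (h2 : lam.rowLens ≠ List.replicate n 1) :
    IsQuasiSteinberg p θ ↔
      (n, lam.rowLens, p) ∈ altTable ∨ (n, lam.transpose.rowLens, p) ∈ altTable := by
  constructor
  · intro hq
    rcases Nat.lt_or_ge 14 n with hn' | hn'
    · exact absurd hq (not_isQuasiSteinberg_of_large hn' hp hθ h1 h2)
    · rcases inTable_of_isQuasiSteinberg_of_le hn hn' hp hθ h1 h2 hq with h | ⟨rfl, rfl, h⟩
      · exact inTable_iff.1 h
      · exact absurd hq (not_isQuasiSteinberg_three_three_two h hθ)
  · rintro (h | h)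
    · exact isQuasiSteinberg_of_mem_altTable hθ h
    · exact isQuasiSteinberg_of_mem_altTable hθ.transpose h

theorem le_nine_of_mem_altTable {l : List ℕ} (h : (n, l, p) ∈ altTable) : n ≤ 9 := by
  have h1 : altList.all (fun x => decide (x.1 ≤ 9)) = true := by decide
  exact of_decide_eq_true (List.all_eq_true.1 h1 _ (mem_altTable.1 h))

theorem mnVal_replicate_one (n : ℕ) : mnVal (List.replicate n 1) [n] = 1 := by
  induction n with
  | zero => decide
  | succ n ih => simpa [List.replicate_succ, mnVal] using ih

/-- Together with its transpose this excludes (n) and (1^n) when the degree is not 1, so that the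
table decides the final bound. -/
theorem apply_one_of_rowLens_eq_singleton (hn : 2 < n) {T : Tableau n lam}
    {θ : alternatingGroup (Fin n) → ℂ} (hθ : IsAltSpechtCharacter T θ)
    (h : lam.rowLens = [n]) : θ 1 = 1 := by
  have hne : lam.transpose ≠ lam := by
    rw [ne_eq, transpose_eq_self_iff, h, conjList_singleton]
    intro h1
    have := congrArg List.length h1
    simp at this
    omega
  obtain ⟨-, ⟨-, h1⟩ | ⟨h1, -⟩⟩ := hθ
  · have h2 : betaList [n] = [n] := rfl
    rw [h1, spechtCharacterAlt, OneMemClass.coe_one, spechtCharacter_one, h, h2,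
      mnVal_replicate_one, Int.cast_one]
  · exact absurd h1 hne

theorem conjList_replicate (hn : 0 < n) : conjList (List.replicate n 1) = [n] := by
  obtain ⟨m, rfl⟩ := Nat.exists_eq_succ_of_ne_zero hn.ne'
  simp [conjList, List.replicate_succ, List.countP_replicate]

end Classification

end QuasiSteinberg
end

theorem theorem1p2 :
    (∀ n : ℕ, 3 ≤ n → ∀ (lam : YoungDiagram) (T : QuasiSteinberg.Tableau n lam),
      lam.rowLens ≠ [n] → lam.rowLens ≠ List.replicate n 1 →
      (∃ θ : alternatingGroup (Fin n) → ℂ, QuasiSteinberg.IsAltSpechtCharacter T θ) ∧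
      ∀ θ : alternatingGroup (Fin n) → ℂ, QuasiSteinberg.IsAltSpechtCharacter T θ →
        ∀ p : ℕ, p.Prime →
          (QuasiSteinberg.IsQuasiSteinberg p θ ↔
            (n, lam.rowLens, p) ∈ QuasiSteinberg.altTable ∨
              (n, lam.transpose.rowLens, p) ∈ QuasiSteinberg.altTable)) ∧
    (∀ (n p : ℕ), p.Prime → ∀ θ : alternatingGroup (Fin n) → ℂ,
      QuasiSteinberg.IsQuasiSteinberg p θ → θ 1 ≠ 1 → n ≤ 9) := by
  constructor
  · intro n hn lam T h1 h2
    exact ⟨QuasiSteinberg.exists_isAltSpechtCharacter (by omega) T, fun θ hθ p hp =>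
      QuasiSteinberg.isQuasiSteinberg_iff_mem_altTable hn hp hθ h1 h2⟩
  · intro n p hp θ hq hθ1
    by_contra hn
    rw [not_le] at hn
    obtain ⟨lam, T, hθ⟩ :=
      QuasiSteinberg.exists_isAltSpechtCharacter_of_isIrreducibleCharacter (by omega) hq.2.1
    have h1 : lam.rowLens ≠ [n] := fun h =>
      hθ1 (QuasiSteinberg.apply_one_of_rowLens_eq_singleton (by omega) hθ h)
    have h2 : lam.rowLens ≠ List.replicate n 1 := fun h =>
      hθ1 (QuasiSteinberg.apply_one_of_rowLens_eq_singleton (by omega) hθ.transpose (by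
        rw [QuasiSteinberg.rowLens_transpose, h, QuasiSteinberg.conjList_replicate (by omega)]))
    rcases (QuasiSteinberg.isQuasiSteinberg_iff_mem_altTable (by omega) hp hθ h1 h2).1 hq with h | h
    · exact absurd (QuasiSteinberg.le_nine_of_mem_altTable h) (by omega)
    · exact absurd (QuasiSteinberg.le_nine_of_mem_altTable h) (by omega)
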